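/- Let $n\ge 1$. Identify $\mathbb{C}^{n(n+1)/2}$ with the space of symmetric complex $n\times n$ matrices $Z=(z_{ij})$, with coordinates $z_{ij}=z_{ji}$, $i\le j$, and write $\vec Z_K=(Z_1,\dots,Z_K)\in(\mathbb{C}^{n(n+1)/2})^K$, where $Z_k$ has the coordinates $z_{k,ij}$. Put $$M_k(Z)=\begin{pmatrix} I_n&Z\\0&I_n\end{pmatrix}\ (k\text{ odd}),\qquad M_k(Z)=\begin{pmatrix} I_n&0\\Z&I_n\end{pmatrix}\ (k\text{ even}),\qquad \Phi_K(\vec Z_K)=M_K(Z_K)\cdots M_1(Z_1)e_{2n},\quad \Phi_0=e_{2n}.$$ For $(u,v)\in\mathbb{C}^n\times\mathbb{C}^n$ let $\pi_K(u,v)=u$ if $K$ is even and $\pi_K(u,v)=v$ if $K$ is odd, and let $\tilde P^K=\pi_{K+1}\circ\Phi_K$. For $y\in\mathbb{C}^{2n}\setminus\{0\}$ let $\mathcal F^K_y=\Phi_K^{-1}(y)$; this fiber is called generic if $\pi_K(y)\ne 0$. Let $\mathcal W_K$ be the set of all $\vec Z_K$ such that $Z_{2i-1}e_n\neq 0$ for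 some $1\le i\le\lceil\frac{K-1}{2}\rceil$. A holomorphic vector field $X$ is $\mathbb{C}$-complete if its integral curves exist for all complex times, with flow $\alpha^X_t$, and it is fiber-preserving for $\Phi_K$ if $d\Phi_K(X)=0$. For a set $A$ of $\mathbb{C}$-complete holomorphic vector fields let $G_A$ be the group generated by all $\alpha^X_t$, $X\in A$, $t\in\mathbb{C}$, and $\Gamma(A)=\{\alpha^*X:\alpha\in G_A,\ X\in A\}$. A vector field on $(\mathbb{C}^{n(n+1)/2})^K$ is also regarded as a vector field on $(\mathbb{C}^{n(n+1)/2})^{K+1}$ that does not depend on $Z_{K+1}$ and has no component in the direction of $Z_{K+1}$. For an $(n+1)$-tuple $x=(x_0,\dots,x_n)$ of distinct variables among the $z_{k,ij}$, $k\le K$ (ordered with nondecreasing $k$), let $$\partial^K_x=\det\begin{pmatrix}\partial/\partial x_0&\cdots&\partial/\partial x_n\\ \partial \tilde P^K/\partial x_0&\cdots&\partial \tilde P^K/\partial x_n\end{pmatrix},$$ and let $\mathcal T^C_K$ be the set of those $x$ for which $\partial_x^K$ is $\mathbb{C}$-complete. For $L\ge 3$, $x\in\mathcal T^C_{L-1}$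 and $1\le j\le n$ put, with $P=\tilde P^{L-1}$ and $u_i=\partial_x^{L-1}(\tilde P^{L-2}_i)$, $$\varphi^L_{x,j}=P_j^2\,\partial_x^{L-1}-P_j\sum_{i\ne j}u_i\frac{\partial}{\partial z_{L,ji}}+\Big(\sum_{i\neq j}P_iu_i-P_ju_j\Big)\frac{\partial}{\partial z_{L,jj}},$$ and for $L\ge 2$, $1\le r\le s\le n$, $r\neq j$, $s\ne j$, again with $P=\tilde P^{L-1}$, $$\gamma^L_{rs,j}=P_j^2\frac{\partial}{\partial z_{L,rs}}+\frac1{1+\delta_{rs}}\Big(2P_rP_s\frac{\partial}{\partial z_{L,jj}}-P_rP_j\frac{\partial}{\partial z_{L,js}}-P_sP_j\frac{\partial}{\partial z_{L,jr}}\Big).$$ The principal vector fields are $$\mathcal V_2=\Big\{(\tilde P^1_j)^2\frac{\partial}{\partial z_{1,rs}}:1\le r\le s<n,\ 1\le j\le n\Big\}\cup\{\gamma^2_{rs,j}\},\qquad \mathcal V_L=\mathcal V_{L-1}\cup\{\varphi^L_{x,j}:x\in\mathcal T^C_{L-1},\ 1\le j\le n\}\cup\{\gamma^L_{rs,j}\}\quad(L\ge3),$$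 and $\mathcal Q_K=\Gamma(\mathcal V_K)$ for $K\ge 2$. **Theorem (Spanning theorem).** There are sets $A_K\subset\mathcal Q_K$, $K\ge2$, such that for every $K\geq 2$: 1. $A_K$ is finite, and each of its elements is a $\mathbb{C}$-complete holomorphic vector field on $(\mathbb{C}^{n(n+1)/2})^K$ that is fiber-preserving for $\Phi_K$; 2. $\Phi_K$ is a submersion at every point of $\mathcal W_K$ (so that $\mathcal F^K_y\cap\mathcal W_K$ is a complex submanifold with tangent spaces $\ker d\Phi_K$), and $A_K$ spans the tangent bundle of $\mathcal F^K_y\cap \mathcal W_K$ for every generic fiber $\mathcal F^K_y$: for every $\vec Z_K\in\mathcal F^K_y\cap\mathcal W_K$ the vectors $X(\vec Z_K)$, $X\in A_K$, span $T_{\vec Z_K}\mathcal F^K_y=\ker d\Phi_K(\vec Z_K)$ over $\mathbb{C}$; 3. $A_K\subset A_{K+1}$, when the elements of $A_K$ are regarded as vector fields on $(\mathbb{C}^{n(n+1)/2})^{K+1}$. -/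

import Mathlib

open scoped Matrix

noncomputable section

namespace SymplecticSpray

/-! ### The space of `K` symmetric matrices and the map `Φ_K` -/

/-- The coordinates `z_{ij} = z_{ji}` of a complex symmetric `n × n` matrix. They are indexed by
unordered pairs `s(i, j)`, so this is `ℂ^{n(n+1)/2}`. -/
abbrev SymCoord (n : ℕ) : Type := Sym2 (Fin n) → ℂ

/-- The symmetric matrix `Z` with the given coordinates. -/
def symMat {n : ℕ} (z : SymCoord n) : Matrix (Fin n) (Fin n) ℂ :=
  Matrix.of fun i j => z s(i, j)

/-- `(ℂ^{n(n+1)/2})^K`. The factor with index `k : Fin K` is the matrix `Z_{k+1}`. -/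
abbrev Conf (n K : ℕ) : Type := Fin K → SymCoord n

/-- The projection `(Z_1, …, Z_{K+1}) ↦ (Z_1, …, Z_K)`. -/
def proj {n K : ℕ} (Z : Conf n (K + 1)) : Conf n K := fun k => Z k.castSucc

/-- The last standard basis vector `e_n` of `ℂ^n`. -/
def eLast (n : ℕ) : Fin n → ℂ := fun i => if (i : ℕ) + 1 = n then 1 else 0

/-- The elementary symplectic matrix `M_K(Z)`: upper triangular for odd `K`, lower triangular for
even `K`. -/
def elemMat {n : ℕ} (K : ℕ) (z : SymCoord n) : Matrix (Fin n ⊕ Fin n) (Fin n ⊕ Fin n) ℂ :=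
  if Odd K then Matrix.fromBlocks 1 (symMat z) 0 1 else Matrix.fromBlocks 1 0 (symMat z) 1

/-- `Φ_K(Z_1, …, Z_K) = M_K(Z_K) ⋯ M_1(Z_1) e_{2n}`. The first summand of `Fin n ⊕ Fin n` indexes the
first `n` coordinates of `ℂ^{2n}`, the second one the last `n` coordinates. -/
def Phi (n : ℕ) : (K : ℕ) → Conf n K → (Fin n ⊕ Fin n → ℂ)
  | 0, _ => Sum.elim 0 (eLast n)
  | K + 1, Z => elemMat (K + 1) (Z (Fin.last K)) *ᵥ Phi n K (proj Z)

/-- `π_K(u, v) = u` for even `K` and `π_K(u, v) = v` for odd `K`. -/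
def halfProj {n : ℕ} (K : ℕ) (y : Fin n ⊕ Fin n → ℂ) : Fin n → ℂ :=
  if Even K then fun i => y (Sum.inl i) else fun i => y (Sum.inr i)

/-- `P̃^K = π_{K+1} ∘ Φ_K`. -/
def Ptil (n K : ℕ) (Z : Conf n K) : Fin n → ℂ := halfProj (K + 1) (Phi n K Z)

/-- The fiber `F^K_y` of `Φ_K`. -/
def fiber (n K : ℕ) (y : Fin n ⊕ Fin n → ℂ) : Set (Conf n K) := {Z | Phi n K Z = y}

/-- The generic stratum of `ℂ^{2n} \ {0}`. -/
def genericStratum (n K : ℕ) : Set (Fin n ⊕ Fin n → ℂ) := {y | y ≠ 0 ∧ halfProj K y ≠ 0}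

/-- `W_K`: some `Z_{2i-1} e_n` with `1 ≤ i ≤ ⌈(K-1)/2⌉` is nonzero. Here `k = 2i - 2` is the index of
`Z_{2i-1}`, and `i ≤ ⌈(K-1)/2⌉ = ⌊K/2⌋` says `k + 2 ≤ K`. -/
def WSet (n K : ℕ) : Set (Conf n K) :=
  {Z | ∃ k : Fin K, Even (k : ℕ) ∧ (k : ℕ) + 2 ≤ K ∧ symMat (Z k) *ᵥ eLast n ≠ 0}

/-! ### Vector fields on a complex vector space -/

section General

variable {E F : Type*} [NormedAddCommGroup E] [NormedSpace ℂ E]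
  [NormedAddCommGroup F] [NormedSpace ℂ F]

/-- `γ` is a complex integral curve `ℂ → E` of the vector field `X`. -/
def IsCurve (X : E → E) (γ : ℂ → E) : Prop := ∀ t : ℂ, HasDerivAt γ (X (γ t)) t

/-- `X` is `ℂ`-complete: there is an integral curve through every point for all complex times. -/
def IsCComplete (X : E → E) : Prop := ∀ p : E, ∃ γ : ℂ → E, γ 0 = p ∧ IsCurve X γ

/-- `X` is tangential to the fibers of `f`: `df_x(X_x) = 0` for all `x`. -/
def FiberPreserving (f : E → F) (X : E → E) : Prop := ∀ p : E, fderiv ℂ f p (X p) = 0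

/-- `σ` is the time-`t` flow map `α^X_t` of `X`. -/
def IsFlowMap (X : E → E) (t : ℂ) (σ : Equiv.Perm E) : Prop :=
  ∀ p : E, ∃ γ : ℂ → E, γ 0 = p ∧ IsCurve X γ ∧ γ t = σ p

/-- `G_A`: the group generated by all flow maps of the fields in `A`. When the fields in `A` are
holomorphic and complete, all its elements are biholomorphic. -/
def flowGroup (A : Set (E → E)) : Subgroup (Equiv.Perm E) :=
  Subgroup.closure {σ | ∃ X ∈ A, ∃ t : ℂ, IsFlowMap X t σ}

/-- `Γ(A) = {α^* X : α ∈ G_A, X ∈ A}`, where `(α^* X)(p) = (dα_p)⁻¹ X(α(p))`. -/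
def generated (A : Set (E → E)) : Set (E → E) :=
  {Y | ∃ σ ∈ flowGroup A, ∃ X ∈ A, Y = VectorField.pullback ℂ σ X}

end General

/-! ### The principal vector fields -/

/-- Vector fields on `(ℂ^{n(n+1)/2})^K`. -/
abbrev VField (n K : ℕ) : Type := Conf n K → Conf n K

/-- The coordinate field `∂/∂z_{k,ij}`; the pair `(k, s(i, j))` is the index of the variable. -/
def coordDir {n K : ℕ} (a : Fin K × Sym2 (Fin n)) : Conf n K := Pi.single a.1 (Pi.single a.2 1)

/-- A vector field on `(ℂ^{n(n+1)/2})^K` regarded as a field on `(ℂ^{n(n+1)/2})^{K+1}`: it has no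
component in the direction of the new variables and does not depend on them. -/
def lift {n K : ℕ} (X : VField n K) : VField n (K + 1) :=
  fun Z => Fin.snoc (α := fun _ => SymCoord n) (X (proj Z)) 0

/-- `T_K`: choices `x = (z_{i_0,j_0k_0}, …, z_{i_n,j_nk_n})` of `n + 1` distinct variables with
`i_0 ≤ … ≤ i_n`. Another order of the variables within a factor only affects the sign of
the field `∂_x^K`. -/
def tuples (n K : ℕ) : Set (Fin (n + 1) → Fin K × Sym2 (Fin n)) :=
  {x | Function.Injective x ∧ Monotone fun r => (x r).1}

/-- `∂_x^K = D_x(P̃^K)`: the formal determinant with first row `∂/∂x_0, …, ∂/∂x_n` and with the rows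
`∂P̃^K_i/∂x_0, …, ∂P̃^K_i/∂x_n` below. Its component along the variable with index `(k, s)`
is obtained by applying the entries of the first row to that variable. -/
def detField (n K : ℕ) (x : Fin (n + 1) → Fin K × Sym2 (Fin n)) : VField n K :=
  fun Z k s => Matrix.det (Matrix.of (Matrix.vecCons
    (fun r => if x r = (k, s) then 1 else 0)
    (fun (i : Fin n) (r : Fin (n + 1)) =>
      fderiv ℂ (fun W => Ptil n K W i) Z (coordDir (x r)))))

/-- `T_K^C`: the tuples whose field `∂_x^K` is complete. -/
def completeTuples (n K : ℕ) : Set (Fin (n + 1) → Fin K × Sym2 (Fin n)) :=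
  {x | x ∈ tuples n K ∧ IsCComplete (detField n K x)}

/-- The field `∂/∂z_{K+1,ij}` on `(ℂ^{n(n+1)/2})^{K+1}`. -/
def newDir {n : ℕ} (K : ℕ) (i j : Fin n) : Conf n (K + 1) := coordDir (Fin.last K, s(i, j))

/-- `u_i = ∂_x^{K+1}(P̃^K_i)`, a function on `(ℂ^{n(n+1)/2})^{K+1}`. -/
def uFun (n K : ℕ) (x : Fin (n + 1) → Fin (K + 1) × Sym2 (Fin n)) (Z : Conf n (K + 1))
    (i : Fin n) : ℂ :=
  fderiv ℂ (fun W : Conf n (K + 1) => Ptil n K (proj W) i) Z (detField n (K + 1) x Z)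

/-- The field `φ^{K+2}_{x,j}`. -/
def phiField (n K : ℕ) (x : Fin (n + 1) → Fin (K + 1) × Sym2 (Fin n)) (j : Fin n) :
    VField n (K + 2) := fun Z =>
  let P := Ptil n (K + 1) (proj Z)
  let u := uFun n K x (proj Z)
  (P j) ^ 2 • lift (detField n (K + 1) x) Z
    - P j • ∑ i ∈ Finset.univ.erase j, u i • newDir (K + 1) j i
    + ((∑ i ∈ Finset.univ.erase j, P i * u i) - P j * u j) • newDir (K + 1) j j

/-- The field `γ^{K+1}_{rs,j}`. -/
def gammaField (n K : ℕ) (r s j : Fin n) : VField n (K + 1) := fun Z =>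
  let P := Ptil n K (proj Z)
  (P j) ^ 2 • newDir K r s
    + (1 / (1 + if r = s then (1 : ℂ) else 0)) •
      ((2 * P r * P s) • newDir K j j - (P r * P j) • newDir K j s - (P s * P j) • newDir K j r)

/-- The fields `γ^{K+1}_{rs,j}` with `r ≤ s`, `r ≠ j` and `s ≠ j`. -/
def gammaFields (n K : ℕ) : Set (VField n (K + 1)) :=
  {X | ∃ r s j : Fin n, r ≤ s ∧ r ≠ j ∧ s ≠ j ∧ X = gammaField n K r s j}

/-- The fields `(P̃^1_j)^2 ∂/∂z_{1,rs}` on `(ℂ^{n(n+1)/2})^2` with `r ≤ s < n`. -/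
def baseFields (n : ℕ) : Set (VField n 2) :=
  {X | ∃ r s j : Fin n, r ≤ s ∧ (s : ℕ) + 1 < n ∧
    X = fun Z => (Ptil n 1 (proj Z) j) ^ 2 • coordDir ((0 : Fin 2), s(r, s))}

/-- The principal vector fields `V_K`, for `K ≥ 2`. The fields of `V_2` are the images of the
coordinate fields under the parametrizations of the generic fibers of `Φ_2`, multiplied by
`(P̃^1_j)^2`, which clears the denominators. -/
def principal (n : ℕ) : (K : ℕ) → Set (VField n K)
  | 0 => ∅
  | 1 => ∅
  | 2 => baseFields n ∪ gammaFields n 1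
  | K + 3 => lift '' principal n (K + 2)
      ∪ {X | ∃ x ∈ completeTuples n (K + 2), ∃ j : Fin n, X = phiField n (K + 1) x j}
      ∪ gammaFields n (K + 2)

/-- `Q_K = Γ(V_K)`. -/
def QSet (n K : ℕ) : Set (VField n K) := generated (principal n K)

/-- The collection `A` spans the tangent bundle of `F^K_y ∩ S`, where `S` is an open set on which `Φ_K`
is a submersion, so that the tangent space at `Z` is the kernel of `dΦ_K(Z)`. -/
def SpansTangent (n K : ℕ) (A : Set (VField n K)) (y : Fin n ⊕ Fin n → ℂ)
    (S : Set (Conf n K)) : Prop :=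
  ∀ Z ∈ fiber n K y ∩ S,
    Submodule.span ℂ {v | ∃ X ∈ A, v = X Z} = LinearMap.ker (fderiv ℂ (Phi n K) Z).toLinearMap

end SymplecticSpray

end

open scoped Matrix

noncomputable section

namespace SymplecticSpray

open scoped ContDiff

/-! Everything is expressed through the chain `om`: 0, e_n, Z_1 e_n, e_n + Z_2 Z_1 e_n, …, in which
each block applies to the current vector and adds the result to the preceding one. `Phi` records the
two end vectors `om K` and `om (K + 1)`, so a field is tangent to the fibers exactly when it fixes
these two to first order, and a fiber is generic when `om K` does not vanish.

The spanning property is proved by induction on the number of blocks. For two blocks the principal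
fields span directly (`mem_span_goodFields_two`). With p + 3 blocks, a vector tangent to the fiber
is resolved in three layers: its effect on `om (p + 2)`, which is a vector of ℂ^n; a remainder that
projects to a vector tangent to the fiber of `Phi` for p + 2 blocks, covered by the lifted fields of
the induction hypothesis; and a change of the last block that annihilates `om (p + 3)`, covered by
the γ fields (`extend_zero_mem_span`). At the points of `goodSet` the fields φ fill the first layer,
which gives `mem_span_of_mem_goodSet`. Any other point of the set W in a generic fiber is carried
into `goodSet` by flow maps that preserve `Phi` (`reach_goodSet`), and the pulled back fields then
span at the original point (`ker_le_span_pullback`). Finitely many flow maps suffice for all points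
at once, so the resulting family is finite.

All this needs complete determinantal fields with explicit flows. Two families are enough. In
`CrossData` a diagonal variable is combined with a row of an earlier block: moving both changes the
Jacobian by a rank one matrix whose column is the very vector that the adjugate is applied to, so
the direction and the rate are constants of motion and the flow is exponential. In `StarData` one
variable is combined with a row of the next block, and the flow is quadratic in time.
`Admissible.isSmoothFlow_phi` passes from these flows to the flows of φ.

To enter `goodSet`, interior vectors of the chain must become nonzero, one of them must not be
proportional to a certain basis vector, and a principal minor must not vanish. Flows of φ displace
chain vectors by multiples of a column of an adjugate or of a basis vector; flows of γ keep the
chain fixed and make the relevant adjugate column or minor nonzero (`Reach.of_kernel`). -/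

/-! ### Smooth flows and groups of biholomorphic maps -/

section Flows

variable {E F : Type*} [NormedAddCommGroup E] [NormedSpace ℂ E]
  [NormedAddCommGroup F] [NormedSpace ℂ F]

/-- `fl` is a globally defined flow of `X` by biholomorphic maps. -/
structure IsSmoothFlow (X : E → E) (fl : ℂ → E → E) : Prop where
  zero : ∀ p, fl 0 p = p
  neg : ∀ t p, fl (-t) (fl t p) = p
  smooth : ∀ t, ContDiff ℂ ∞ (fl t)
  curve : ∀ p, IsCurve X fun t => fl t p

namespace IsSmoothFlow

variable {X : E → E} {fl : ℂ → E → E}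

lemma complete (h : IsSmoothFlow X fl) : IsCComplete X :=
  fun p => ⟨fun t => fl t p, h.zero p, h.curve p⟩

/-- The time-`t` flow map. -/
def perm (h : IsSmoothFlow X fl) (t : ℂ) : Equiv.Perm E where
  toFun := fl t
  invFun := fl (-t)
  left_inv := h.neg t
  right_inv p := by simpa using h.neg (-t) p

lemma isFlowMap (h : IsSmoothFlow X fl) (t : ℂ) : IsFlowMap X t (h.perm t) :=
  fun p => ⟨fun t => fl t p, h.zero p, h.curve p, rfl⟩

/-- A function annihilated by a field is constant along its flow. -/
lemma invariant (h : IsSmoothFlow X fl) {f : E → F} (hf : Differentiable ℂ f)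
    (hX : FiberPreserving f X) (t : ℂ) (p : E) : f (fl t p) = f p := by
  have hd : ∀ s : ℂ, HasDerivAt (fun s => f (fl s p)) 0 s := fun s => by
    have := (hf (fl s p)).hasFDerivAt.comp_hasDerivAt s (h.curve p s)
    rwa [hX] at this
  have := is_const_of_deriv_eq_zero (fun s => (hd s).differentiableAt) (fun s => (hd s).deriv) t 0
  simpa [h.zero] using this

/-- Needed because putting the variables of a tuple in monotone order changes a determinantal field
by a sign. -/
lemma const_smul (h : IsSmoothFlow X fl) (c : ℂ) :
    IsSmoothFlow (c • X) (fun t => fl (c * t)) where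
  zero p := by simp [h.zero]
  neg t p := by simp [h.neg]
  smooth t := h.smooth _
  curve p t := by
    have := (h.curve p (c * t)).scomp t ((hasDerivAt_id t).const_mul c)
    simpa [Function.comp_def] using this

/-- A field that is constant along the lines that it spans. -/
lemma of_straight (hX : ContDiff ℂ ∞ X) (h : ∀ (t : ℂ) p, X (p + t • X p) = X p) :
    IsSmoothFlow X (fun t p => p + t • X p) where
  zero p := by simp
  neg t p := by simp [h]
  smooth t := contDiff_id.add (contDiff_const.smul hX)
  curve p t := by
    rw [h]
    simpa using ((hasDerivAt_id t).smul_const (X p)).const_add p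

end IsSmoothFlow

/-- The biholomorphic elements of `G_A` that preserve `f`. -/
def preservingGroup (A : Set (E → E)) (f : E → F) : Subgroup (Equiv.Perm E) where
  carrier := {σ | σ ∈ flowGroup A ∧ ContDiff ℂ ∞ σ ∧ ContDiff ℂ ∞ σ.symm ∧ ∀ p, f (σ p) = f p}
  mul_mem' := fun {σ τ} hσ hτ => ⟨mul_mem hσ.1 hτ.1, hσ.2.1.comp hτ.2.1, hτ.2.2.1.comp hσ.2.2.1,
    fun p => by rw [Equiv.Perm.mul_apply, hσ.2.2.2, hτ.2.2.2]⟩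
  one_mem' := ⟨one_mem _, contDiff_id, contDiff_id, fun _ => rfl⟩
  inv_mem' := fun {σ} hσ => ⟨inv_mem hσ.1, hσ.2.2.1, hσ.2.1, fun p => by
    have h := hσ.2.2.2 (σ.symm p)
    rw [Equiv.apply_symm_apply] at h
    exact h.symm⟩

lemma IsSmoothFlow.perm_mem {A : Set (E → E)} {f : E → F} {X : E → E} {fl : ℂ → E → E}
    (h : IsSmoothFlow X fl) (hXA : X ∈ A) (hf : Differentiable ℂ f) (hX : FiberPreserving f X)
    (t : ℂ) : h.perm t ∈ preservingGroup A f :=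
  ⟨Subgroup.subset_closure ⟨X, hXA, t, h.isFlowMap t⟩, h.smooth t, h.smooth (-t),
    h.invariant hf hX t⟩

/-! ### Pullback of vector fields by biholomorphic maps -/

section Pullback

variable {σ τ : Equiv.Perm E}

lemma fderiv_symm_comp (hσ : ContDiff ℂ ∞ σ) (hσ' : ContDiff ℂ ∞ σ.symm) (p : E) :
    (fderiv ℂ σ.symm (σ p)).comp (fderiv ℂ σ p) = ContinuousLinearMap.id ℂ E := by
  rw [← fderiv_comp p (hσ'.differentiable (by simp) _) (hσ.differentiable (by simp) _)]
  simp [Function.comp_def]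

lemma fderiv_comp_symm (hσ : ContDiff ℂ ∞ σ) (hσ' : ContDiff ℂ ∞ σ.symm) (p : E) :
    (fderiv ℂ σ p).comp (fderiv ℂ σ.symm (σ p)) = ContinuousLinearMap.id ℂ E := by
  have := fderiv_symm_comp (σ := σ.symm) hσ' hσ (σ p)
  simpa using this

/-- Replaces the inverse of a derivative by the derivative of the inverse map, from which regularity
in p can be read off. -/
lemma pullback_perm (hσ : ContDiff ℂ ∞ σ) (hσ' : ContDiff ℂ ∞ σ.symm) (X : E → E) (p : E) :
    VectorField.pullback ℂ σ X p = fderiv ℂ σ.symm (σ p) (X (σ p)) := by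
  have := ContinuousLinearMap.inverse_eq (fderiv_comp_symm hσ hσ' p) (fderiv_symm_comp hσ hσ' p)
  rw [VectorField.pullback, this]

lemma differentiable_pullback (hσ : ContDiff ℂ ∞ σ) (hσ' : ContDiff ℂ ∞ σ.symm) {X : E → E}
    (hX : Differentiable ℂ X) : Differentiable ℂ (VectorField.pullback ℂ σ X) := by
  have h1 : VectorField.pullback ℂ σ X = fun p => fderiv ℂ σ.symm (σ p) (X (σ p)) :=
    funext (pullback_perm hσ hσ' X)
  have hd : Differentiable ℂ σ := hσ.differentiable (by simp)
  have h2 : Differentiable ℂ (fderiv ℂ σ.symm) :=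
    (hσ'.fderiv_right (m := 1) (by norm_cast)).differentiable (by simp)
  rw [h1]
  exact (h2.comp hd).clm_apply (hX.comp hd)

/-- The inverse of σ carries integral curves of X to integral curves of the pullback. -/
lemma complete_pullback (hσ : ContDiff ℂ ∞ σ) (hσ' : ContDiff ℂ ∞ σ.symm) {X : E → E}
    (hX : IsCComplete X) : IsCComplete (VectorField.pullback ℂ σ X) := by
  intro p
  obtain ⟨γ, h0, hγ⟩ := hX (σ p)
  refine ⟨fun t => σ.symm (γ t), by simp [h0], fun t => ?_⟩
  rw [pullback_perm hσ hσ', Equiv.apply_symm_apply]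
  exact ((hσ'.differentiable (by simp)) (γ t)).hasFDerivAt.comp_hasDerivAt t (hγ t)

lemma fderiv_invariant (hσ : ContDiff ℂ ∞ σ) {f : E → F} (hf : Differentiable ℂ f)
    (h : ∀ p, f (σ p) = f p) (p v : E) : fderiv ℂ f (σ p) (fderiv ℂ σ p v) = fderiv ℂ f p v := by
  have h1 : f ∘ σ = f := funext h
  conv_rhs => rw [← h1]
  rw [fderiv_comp p (hf _) (hσ.differentiable (by simp) _)]
  rfl

lemma fiberPreserving_pullback (hσ : ContDiff ℂ ∞ σ) (hσ' : ContDiff ℂ ∞ σ.symm) {f : E → F}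
    (hf : Differentiable ℂ f) (h : ∀ p, f (σ p) = f p) {X : E → E} (hX : FiberPreserving f X) :
    FiberPreserving f (VectorField.pullback ℂ σ X) := by
  intro p
  have h1 := DFunLike.congr_fun (fderiv_comp_symm hσ hσ' p) (X (σ p))
  rw [pullback_perm hσ hσ', ← fderiv_invariant hσ hf h]
  simp only [ContinuousLinearMap.comp_apply, ContinuousLinearMap.id_apply] at h1
  rw [h1, hX]

lemma pullback_one (X : E → E) : VectorField.pullback ℂ (1 : Equiv.Perm E) X = X := by
  funext p
  rw [pullback_perm (σ := 1) contDiff_id contDiff_id]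
  change fderiv ℂ id _ _ = _
  simp

lemma pullback_mul (hσ : ContDiff ℂ ∞ σ) (hσ' : ContDiff ℂ ∞ σ.symm) (hτ : ContDiff ℂ ∞ τ)
    (hτ' : ContDiff ℂ ∞ τ.symm) (X : E → E) :
    VectorField.pullback ℂ (τ * σ : Equiv.Perm E) X =
      VectorField.pullback ℂ σ (VectorField.pullback ℂ τ X) := by
  funext p
  have h1 : ContDiff ℂ ∞ (τ * σ : Equiv.Perm E) := hτ.comp hσ
  have h2 : ContDiff ℂ ∞ (τ * σ : Equiv.Perm E).symm := hσ'.comp hτ'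
  rw [pullback_perm h1 h2, pullback_perm hσ hσ', pullback_perm hτ hτ']
  change fderiv ℂ (σ.symm ∘ τ.symm) (τ (σ p)) _ = _
  rw [fderiv_comp _ (hσ'.differentiable (by simp) _) (hτ'.differentiable (by simp) _)]
  simp

/-- If the values of `A` at `σ p` span the kernel of `df`, then so do the values of the pullbacks
at `p`. -/
lemma ker_le_span_pullback (hσ : ContDiff ℂ ∞ σ) (hσ' : ContDiff ℂ ∞ σ.symm) {f : E → F}
    (hf : Differentiable ℂ f) (h : ∀ p, f (σ p) = f p) {A : Set (E → E)} {p : E}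
    (hA : ∀ v, fderiv ℂ f (σ p) v = 0 → v ∈ Submodule.span ℂ {v | ∃ X ∈ A, v = X (σ p)})
    {v : E} (hv : fderiv ℂ f p v = 0) :
    v ∈ Submodule.span ℂ {v | ∃ X ∈ A, v = VectorField.pullback ℂ σ X p} := by
  have h1 := hA (fderiv ℂ σ p v) (by rw [fderiv_invariant hσ hf h, hv])
  have h2 := Submodule.mem_map_of_mem (f := (fderiv ℂ σ.symm (σ p)).toLinearMap) h1
  have h3 := DFunLike.congr_fun (fderiv_symm_comp hσ hσ' p) v
  simp only [ContinuousLinearMap.comp_apply, ContinuousLinearMap.id_apply] at h3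
  rw [Submodule.map_span] at h2
  simp only [ContinuousLinearMap.coe_coe, h3] at h2
  refine Submodule.span_mono ?_ h2
  rintro _ ⟨_, ⟨X, hX, rfl⟩, rfl⟩
  exact ⟨X, hX, by rw [pullback_perm hσ hσ']⟩

end Pullback

end Flows

/-! ### Determinants, adjugates and symmetric matrices -/

section MatrixLemmas

variable {n : ℕ}

/-- On the line A + s·1 the determinant vanishes only at the finitely many eigenvalues of -A. -/
lemma dense_det_ne_zero : Dense {A : Matrix (Fin n) (Fin n) ℂ | A.det ≠ 0} := by
  intro A
  have hc : Continuous fun s : ℂ => A + s • (1 : Matrix (Fin n) (Fin n) ℂ) := by fun_prop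
  have hfin : {s : ℂ | (A + s • (1 : Matrix (Fin n) (Fin n) ℂ)).det = 0}.Finite := by
    refine ((-A).charpoly.roots.toFinset.finite_toSet).subset fun s hs => ?_
    have : (-A).charpoly.eval s = 0 := by
      rw [Matrix.eval_charpoly]
      rw [← (show (A + s • (1 : Matrix (Fin n) (Fin n) ℂ)).det = 0 from hs)]
      congr 1
      ext i j
      simp [Matrix.scalar_apply, Matrix.diagonal_apply, Matrix.one_apply, add_comm]
    simpa [(Matrix.charpoly_monic (-A)).ne_zero] using this
  have hd : Dense {s : ℂ | (A + s • (1 : Matrix (Fin n) (Fin n) ℂ)).det ≠ 0} :=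
    hfin.countable.dense_compl ℂ
  have := hc.range_subset_closure_image_dense hd ⟨0, rfl⟩
  simp only [zero_smul, add_zero] at this
  refine closure_mono ?_ this
  rintro _ ⟨s, hs, rfl⟩
  exact hs

lemma eq_of_eq_of_det_ne_zero {α : Type*} [TopologicalSpace α] [T2Space α]
    {f g : Matrix (Fin n) (Fin n) ℂ → α} (hf : Continuous f) (hg : Continuous g)
    (h : ∀ A, A.det ≠ 0 → f A = g A) (A : Matrix (Fin n) (Fin n) ℂ) : f A = g A :=
  congrFun (hf.ext_on dense_det_ne_zero hg h) A

/-- The matrix determinant lemma in adjugate form, since it is applied to Jacobians that may be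
singular; for invertible A one factors A out. -/
lemma det_add_vecMulVec (A : Matrix (Fin n) (Fin n) ℂ) (g f : Fin n → ℂ) :
    (A + Matrix.vecMulVec g f).det = A.det + f ⬝ᵥ (A.adjugate *ᵥ g) := by
  refine eq_of_eq_of_det_ne_zero (f := fun A => (A + Matrix.vecMulVec g f).det)
    (g := fun A => A.det + f ⬝ᵥ (A.adjugate *ᵥ g)) (by fun_prop) (by fun_prop) ?_ A
  intro A hA
  have hu : IsUnit A.det := hA.isUnit
  have h1 : A + Matrix.vecMulVec g f = A * (1 + Matrix.vecMulVec (A⁻¹ *ᵥ g) f) := by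
    rw [mul_add, mul_one, Matrix.mul_vecMulVec, Matrix.mulVec_mulVec, Matrix.mul_nonsing_inv _ hu,
      Matrix.one_mulVec]
  have h2 : (1 + Matrix.vecMulVec (A⁻¹ *ᵥ g) f).det = 1 + f ⬝ᵥ (A⁻¹ *ᵥ g) := by
    rw [Matrix.vecMulVec_eq Unit, Matrix.det_one_add_replicateCol_mul_replicateRow]
  have h3 : A.adjugate = A.det • A⁻¹ := by
    rw [Matrix.inv_def, smul_smul, Ring.mul_inverse_cancel _ hu, one_smul]
  rw [h1, Matrix.det_mul, h2, h3, Matrix.smul_mulVec, dotProduct_smul, smul_eq_mul]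
  ring

/-- By Cramer, entry i is the determinant with column i replaced by g, and adding multiples of g to
the other columns does not change it. This makes the direction of a `CrossData` field a constant of
motion. -/
lemma adjugate_add_vecMulVec_mulVec (A : Matrix (Fin n) (Fin n) ℂ) (g f : Fin n → ℂ) :
    (A + Matrix.vecMulVec g f).adjugate *ᵥ g = A.adjugate *ᵥ g := by
  rw [← Matrix.cramer_eq_adjugate_mulVec, ← Matrix.cramer_eq_adjugate_mulVec]
  funext i
  rw [Matrix.cramer_apply, Matrix.cramer_apply, ← Matrix.det_transpose,
    ← Matrix.det_transpose (A.updateCol i g)]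
  refine (Matrix.det_eq_of_forall_row_eq_smul_add_const (fun j => if j = i then 0 else f j) i
    (by simp) ?_)
  intro j r
  by_cases h : j = i
  · subst h; simp
  · simp [h, Matrix.vecMulVec_apply, mul_comm]

/-- For invertible X the push-through identity adj(1 + XY) X = X adj(1 + YX) holds. Insert it into
adj(1 + XY)(1 + XY) = det(1 + YX). -/
lemma adjugate_one_add_mul (X Y : Matrix (Fin n) (Fin n) ℂ) :
    (1 + X * Y).adjugate = (1 + Y * X).det • 1 - X * (1 + Y * X).adjugate * Y := by
  refine eq_of_eq_of_det_ne_zero (f := fun X => (1 + X * Y).adjugate)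
    (g := fun X => (1 + Y * X).det • (1 : Matrix (Fin n) (Fin n) ℂ)
      - X * (1 + Y * X).adjugate * Y) (by fun_prop) (by fun_prop) ?_ X
  intro X hX
  have hu : IsUnit X.det := hX.isUnit
  have h1 : X.adjugate * (1 + X * Y).adjugate = (1 + Y * X).adjugate * X.adjugate := by
    rw [← Matrix.adjugate_mul_distrib, ← Matrix.adjugate_mul_distrib]
    congr 1
    noncomm_ring
  have h2 : X.det • ((1 + X * Y).adjugate * X) = X.det • (X * (1 + Y * X).adjugate) := by
    calc _ = X * (X.adjugate * (1 + X * Y).adjugate) * X := by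
          rw [← mul_assoc X, Matrix.mul_adjugate]; simp
      _ = _ := by rw [h1, mul_assoc, mul_assoc, Matrix.adjugate_mul]; simp
  have h3 : (1 + X * Y).adjugate * X = X * (1 + Y * X).adjugate := smul_right_injective _ hX h2
  have h4 : (1 + X * Y).adjugate * (X * Y) = X * (1 + Y * X).adjugate * Y := by
    rw [← mul_assoc, h3]
  have h5 : (1 + X * Y).adjugate * (1 + X * Y) = (1 + Y * X).det • 1 := by
    rw [Matrix.adjugate_mul, Matrix.det_one_add_mul_comm]
  rw [← h4, ← h5]
  noncomm_ring

/-- The determinant of a matrix with distinguished first row and column. -/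
lemma det_bordered (e : Fin (n + 1) → ℂ) (h : Fin n → ℂ) (J : Matrix (Fin n) (Fin n) ℂ) :
    (Matrix.of (Matrix.vecCons e fun i => Matrix.vecCons (h i) (J i))).det =
      e 0 * J.det - ∑ r, e r.succ * (J.adjugate *ᵥ h) r := by
  have hc : ∀ i j, Continuous fun J : Matrix (Fin n) (Fin n) ℂ =>
      (Matrix.of (Matrix.vecCons e fun i => Matrix.vecCons (h i) (J i))) i j := by
    intro i j
    refine Fin.cases ?_ (fun i => ?_) i
    · simpa using continuous_const
    · refine Fin.cases ?_ (fun j => ?_) j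
      · simpa using continuous_const
      · simpa using continuous_id.matrix_elem i j
  refine eq_of_eq_of_det_ne_zero
    (f := fun J => (Matrix.of (Matrix.vecCons e fun i => Matrix.vecCons (h i) (J i))).det)
    (g := fun J => e 0 * J.det - ∑ r, e r.succ * (J.adjugate *ᵥ h) r)
    (Continuous.matrix_det (continuous_matrix hc)) ?_ ?_ J
  · refine Continuous.sub (by fun_prop) (continuous_finsetSum _ fun r _ => ?_)
    have : Continuous fun J : Matrix (Fin n) (Fin n) ℂ => J.adjugate *ᵥ h := by fun_prop
    exact continuous_const.mul ((continuous_apply r).comp this)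
  intro J hJ
  -- A column operation: since J adj(J) h = det(J) h, multiplication by T on the right clears the
  -- first column below its top entry, which becomes the claimed value. T itself has determinant det
  -- J, which is cancelled at the end.
  set T : Matrix (Fin (n + 1)) (Fin (n + 1)) ℂ :=
    Matrix.of (Matrix.vecCons (Matrix.vecCons J.det 0)
      fun i => Matrix.vecCons (-(J.adjugate *ᵥ h) i) ((1 : Matrix (Fin n) (Fin n) ℂ) i)) with hT
  have hTdet : T.det = J.det := by
    rw [Matrix.det_succ_row_zero, Fin.sum_univ_succ]
    simp only [hT, Matrix.of_apply, Matrix.cons_val_zero, Matrix.cons_val_succ, Pi.zero_apply]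
    have : (Matrix.submatrix (Matrix.of (Matrix.vecCons (Matrix.vecCons J.det 0)
      fun i => Matrix.vecCons (-(J.adjugate *ᵥ h) i) ((1 : Matrix (Fin n) (Fin n) ℂ) i)))
        Fin.succ (Fin.succAbove 0)) = 1 := by
      ext i j; simp
    rw [this]
    simp
  have hprod : ((Matrix.of (Matrix.vecCons e fun i => Matrix.vecCons (h i) (J i))) * T).det =
      (e 0 * J.det - ∑ r, e r.succ * (J.adjugate *ᵥ h) r) * J.det := by
    have hJh : J *ᵥ (J.adjugate *ᵥ h) = J.det • h := by
      rw [Matrix.mulVec_mulVec, Matrix.mul_adjugate, Matrix.smul_mulVec, Matrix.one_mulVec]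
    rw [Matrix.det_succ_column_zero, Fin.sum_univ_succ, Finset.sum_eq_zero, add_zero]
    · have : (Matrix.submatrix ((Matrix.of (Matrix.vecCons e
          fun i => Matrix.vecCons (h i) (J i))) * T) (Fin.succAbove 0) Fin.succ) = J := by
        ext i j
        simp [Matrix.mul_apply, Fin.sum_univ_succ, hT, Matrix.one_apply]
      rw [this]
      simp [Matrix.mul_apply, Fin.sum_univ_succ, hT, sub_eq_add_neg]
    · intro i _
      have := congrFun hJh i
      simp only [Matrix.mulVec, dotProduct, Pi.smul_apply, smul_eq_mul] at this
      simp [Matrix.mul_apply, Fin.sum_univ_succ, hT, Matrix.mulVec, dotProduct, this]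
      left
      ring
  rw [Matrix.det_mul, hTdet] at hprod
  exact mul_right_cancel₀ hJ hprod

/-! ### Cofactors -/

/-- The hypothesis says that the rows other than row i are independent. Were column i of the
adjugate zero, replacing row i by any vector would give determinant zero, including a vector outside
the span of the other rows. -/
lemma adjugate_mulVec_single_ne_zero {M : Matrix (Fin n) (Fin n) ℂ} {i : Fin n}
    (h : ∀ y : Fin n → ℂ, y i = 0 → y ᵥ* M = 0 → y = 0) :
    M.adjugate *ᵥ Pi.single i 1 ≠ 0 := by
  intro h0
  have hdet : ∀ z, (M.updateRow i z).det = 0 := by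
    intro z
    rw [← Matrix.cramer_transpose_apply, Matrix.cramer_eq_adjugate_mulVec,
      ← Matrix.adjugate_transpose]
    simp only [Matrix.mulVec, dotProduct, Matrix.transpose_apply]
    refine Finset.sum_eq_zero fun k _ => ?_
    have := congrFun h0 k
    simp only [Matrix.mulVec_single_one, Matrix.col_apply, Pi.zero_apply] at this
    rw [this, zero_mul]
  obtain ⟨z, hz⟩ : ∃ z, z ∉ Submodule.span ℂ (Set.range fun r : {r // r ≠ i} => M r) := by
    by_contra! hcon
    have htop : Submodule.span ℂ (Set.range fun r : {r // r ≠ i} => M r) = ⊤ :=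
      Submodule.eq_top_iff'.2 hcon
    have hle := finrank_range_le_card (R := ℂ) (fun r : {r // r ≠ i} => M r)
    rw [Set.finrank, htop, finrank_top, Module.finrank_fin_fun, Fintype.card_subtype_compl] at hle
    simp only [Fintype.card_fin, Fintype.card_unique] at hle
    have := i.pos
    omega
  obtain ⟨y, hy0, hy⟩ := Matrix.exists_vecMul_eq_zero_iff.2 (hdet z)
  have hsum : y i • z + ∑ r ∈ Finset.univ.erase i, y r • M r = 0 := by
    rw [Matrix.vecMul_eq_sum, ← Finset.add_sum_erase _ _ (Finset.mem_univ i)] at hy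
    rw [← hy]
    congr 1
    · simp
    · refine Finset.sum_congr rfl fun r hr => ?_
      rw [Matrix.updateRow_ne (Finset.ne_of_mem_erase hr)]
  have hmem : ∑ r ∈ Finset.univ.erase i, y r • M r ∈
      Submodule.span ℂ (Set.range fun r : {r // r ≠ i} => M r) :=
    Submodule.sum_mem _ fun r hr => Submodule.smul_mem _ _
      (Submodule.subset_span ⟨⟨r, Finset.ne_of_mem_erase hr⟩, rfl⟩)
  have hyi : y i = 0 := by
    by_contra hne
    apply hz
    have : y i • z = -∑ r ∈ Finset.univ.erase i, y r • M r := eq_neg_of_add_eq_zero_left hsum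
    rw [← inv_smul_smul₀ hne z, this]
    exact Submodule.smul_mem _ _ (Submodule.neg_mem _ hmem)
  refine hy0 (h y hyi ?_)
  rw [Matrix.vecMul_eq_sum, ← Finset.add_sum_erase _ _ (Finset.mem_univ i), hyi, zero_smul]
  rwa [hyi, zero_smul] at hsum

/-- The entry is the determinant with row j replaced by e_j, so a kernel vector has vanishing entry
j and is killed by the other rows of Z. -/
lemma adjugate_apply_self_ne_zero {Z : Matrix (Fin n) (Fin n) ℂ} {j : Fin n}
    (h : ∀ y : Fin n → ℂ, y j = 0 → (∀ r, r ≠ j → (Z *ᵥ y) r = 0) → y = 0) :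
    Z.adjugate j j ≠ 0 := by
  rw [Matrix.adjugate_apply]
  intro h0
  obtain ⟨y, hy0, hy⟩ := Matrix.exists_mulVec_eq_zero_iff.2 h0
  refine hy0 (h y ?_ fun r hr => ?_)
  · have := congrFun hy j
    simpa [Matrix.mulVec] using this
  · have := congrFun hy r
    simpa [Matrix.mulVec, Matrix.updateRow_ne hr] using this

/-- The vector `v_i e_r - v_r e_i`, which is orthogonal to `v`. -/
def orthVec (v : Fin n → ℂ) (i r : Fin n) : Fin n → ℂ :=
  v i • Pi.single r 1 - v r • Pi.single i 1

lemma dotProduct_orthVec (v y : Fin n → ℂ) {i r : Fin n} (hy : y i = 0) :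
    y ⬝ᵥ orthVec v i r = v i * y r := by
  simp [orthVec, dotProduct_sub, dotProduct_smul, hy]

lemma orthVec_dotProduct (v : Fin n → ℂ) (i r : Fin n) : orthVec v i r ⬝ᵥ v = 0 := by
  simp [orthVec, sub_dotProduct, smul_dotProduct, mul_comm]

/-- Pair the equation for y' with X y. By symmetry (1 + YX) y = 0, so the old part contributes y' X
(1 + YX) y = 0 and the rank one part contributes -(y'·ρ)(ρ·y), a nonzero multiple of y'_r y_r. Hence
the shift cuts the old kernel down by the condition y'_r = 0. -/
lemma kernel_one_add_mul_shift {X Y : Matrix (Fin n) (Fin n) ℂ} (hX : X.IsSymm) (hY : Y.IsSymm)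
    {v : Fin n → ℂ} {i r : Fin n} (hv : v i ≠ 0) {y y' : Fin n → ℂ} (hy : y i = 0)
    (hyM : y ᵥ* (1 + X * Y) = 0) (hyr : y r ≠ 0) (hy' : y' i = 0)
    (hyM' : y' ᵥ* (1 + (X + Matrix.vecMulVec (orthVec v i r) (orthVec v i r)) * Y) = 0) :
    y' r = 0 ∧ y' ᵥ* (1 + X * Y) = 0 := by
  set ρ := orthVec v i r with hρ
  have h1 : (1 + Y * X) *ᵥ y = 0 := by
    rw [← Matrix.vecMul_transpose]
    simpa [Matrix.transpose_mul, hX.eq, hY.eq] using hyM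
  have h2 : y' ᵥ* (1 + X * Y) + (y' ⬝ᵥ ρ) • (ρ ᵥ* Y) = 0 := by
    rw [← hyM', add_mul, ← add_assoc, Matrix.vecMul_add (1 + X * Y), Matrix.vecMulVec_mul,
      Matrix.vecMul_vecMulVec]
  have h3 : y' ᵥ* (1 + X * Y) ⬝ᵥ (X *ᵥ y) = 0 := by
    rw [← Matrix.dotProduct_mulVec, Matrix.mulVec_mulVec]
    have : (1 + X * Y) * X = X * (1 + Y * X) := by noncomm_ring
    rw [this, ← Matrix.mulVec_mulVec, h1]
    simp
  have h4 : ρ ᵥ* Y ⬝ᵥ (X *ᵥ y) = -(ρ ⬝ᵥ y) := by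
    rw [← Matrix.dotProduct_mulVec, Matrix.mulVec_mulVec]
    rw [Matrix.add_mulVec, Matrix.one_mulVec] at h1
    rw [← dotProduct_neg, eq_neg_of_add_eq_zero_right h1]
  have hd : ρ ⬝ᵥ y = v i * y r := by rw [dotProduct_comm, hρ, dotProduct_orthVec v y hy]
  have hd' : y' ⬝ᵥ ρ = v i * y' r := dotProduct_orthVec v y' hy'
  have h5 := congrArg (fun w => w ⬝ᵥ (X *ᵥ y)) h2
  simp only [add_dotProduct, smul_dotProduct, h3, h4, hd, hd', zero_dotProduct, smul_eq_mul,
    zero_add] at h5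
  have h6 : y' r = 0 := by
    have : v i * y' r * (v i * y r) = 0 := by linear_combination -h5
    simpa [hv, hyr] using this
  refine ⟨h6, ?_⟩
  rw [hρ, dotProduct_orthVec v y' hy', h6] at h2
  simpa using h2

/-- Same mechanism with the bilinear form of Z: y·Zy' = Zy·y' vanishes because Zy is supported at i
while y'_i = 0, so pairing with y isolates the rank one term. -/
lemma kernel_shift {Z : Matrix (Fin n) (Fin n) ℂ} (hZ : Z.IsSymm)
    {v : Fin n → ℂ} {i r : Fin n} (hv : v i ≠ 0) {y y' : Fin n → ℂ} (hy : y i = 0)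
    (hyM : ∀ s, s ≠ i → (Z *ᵥ y) s = 0) (hyr : y r ≠ 0) (hy' : y' i = 0)
    (hyM' : ∀ s, s ≠ i → ((Z + Matrix.vecMulVec (orthVec v i r) (orthVec v i r)) *ᵥ y') s = 0) :
    y' r = 0 ∧ ∀ s, s ≠ i → (Z *ᵥ y') s = 0 := by
  set ρ := orthVec v i r with hρ
  have hdot : ∀ {z w : Fin n → ℂ}, z i = 0 → (∀ s, s ≠ i → w s = 0) → z ⬝ᵥ w = 0 := by
    intro z w hz hw
    refine Finset.sum_eq_zero fun s _ => ?_
    by_cases hs : s = i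
    · simp [hs, hz]
    · simp [hw s hs]
  have h1 : ∀ s, ((Z + Matrix.vecMulVec ρ ρ) *ᵥ y') s = (Z *ᵥ y') s + (v i * y' r) * ρ s := by
    intro s
    rw [Matrix.add_mulVec, Pi.add_apply, Matrix.vecMulVec_mulVec]
    simp [hρ, dotProduct_comm _ y', dotProduct_orthVec v y' hy', mul_comm]
  have h2 := hdot hy hyM'
  have h3 : (Z + Matrix.vecMulVec ρ ρ) *ᵥ y' = Z *ᵥ y' + (v i * y' r) • ρ := by
    funext s; rw [h1]; rfl
  have h4 : y ⬝ᵥ (Z *ᵥ y') = 0 := by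
    rw [Matrix.dotProduct_mulVec, ← Matrix.mulVec_transpose, hZ.eq, dotProduct_comm]
    exact hdot hy' hyM
  rw [h3, dotProduct_add, h4, dotProduct_smul, dotProduct_orthVec v y hy, smul_eq_mul,
    zero_add] at h2
  have h6 : y' r = 0 := by simpa [hv, hyr] using h2
  refine ⟨h6, fun s hs => ?_⟩
  have := hyM' s hs
  rw [h1, h6] at this
  simpa using this

end MatrixLemmas

/-! ### Symmetric matrices and row perturbations -/

section Star

variable {n : ℕ}

lemma symMat_apply (z : SymCoord n) (i j : Fin n) : symMat z i j = z s(i, j) := rfl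

@[simp] lemma symMat_zero : symMat (0 : SymCoord n) = 0 := rfl

@[simp] lemma symMat_add (z w : SymCoord n) : symMat (z + w) = symMat z + symMat w := rfl

@[simp] lemma symMat_smul (c : ℂ) (z : SymCoord n) : symMat (c • z) = c • symMat z := rfl

@[simp] lemma symMat_sub (z w : SymCoord n) : symMat (z - w) = symMat z - symMat w := rfl

@[simp] lemma symMat_sum {ι : Type*} (s : Finset ι) (z : ι → SymCoord n) :
    symMat (∑ i ∈ s, z i) = ∑ i ∈ s, symMat (z i) := by
  ext i j
  simp [symMat_apply, Matrix.sum_apply]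

lemma symMat_isSymm (z : SymCoord n) : (symMat z).IsSymm := by
  ext i j
  simp [symMat_apply, Sym2.eq_swap]

lemma symMat_injective : Function.Injective (symMat (n := n)) := by
  intro z w h
  funext s
  induction s using Sym2.ind with
  | _ i j => exact congrFun (congrFun h i) j

/-- The coordinate vector of the variable `z_s`. -/
abbrev unitCoord (s : Sym2 (Fin n)) : SymCoord n := Pi.single s 1

lemma symMat_unitCoord (i j : Fin n) :
    symMat (unitCoord s(i, j)) = if i = j then Matrix.single i i 1
      else Matrix.single i j 1 + Matrix.single j i 1 := by
  ext a b
  split_ifs with h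
  · subst h
    simp only [symMat_apply, Pi.single_apply, Matrix.single_apply, Sym2.eq_iff]
    congr 1
    simp only [eq_iff_iff]
    tauto
  · simp only [symMat_apply, Pi.single_apply, Matrix.single_apply, Matrix.add_apply, Sym2.eq_iff]
    by_cases h1 : a = i ∧ b = j
    · obtain ⟨rfl, rfl⟩ := h1
      simp [Ne.symm h]
    · by_cases h2 : a = j ∧ b = i
      · obtain ⟨rfl, rfl⟩ := h2
        simp [h]
      · rw [if_neg (by tauto), if_neg (by tauto), if_neg (by tauto), add_zero]

lemma symMat_unitCoord_mulVec (i j : Fin n) (v : Fin n → ℂ) :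
    symMat (unitCoord s(i, j)) *ᵥ v = if i = j then Pi.single i (v i)
      else Pi.single i (v j) + Pi.single j (v i) := by
  rw [symMat_unitCoord]
  split_ifs with h
  · simp [Matrix.single_mulVec, Pi.single]
  · simp [Matrix.add_mulVec, Matrix.single_mulVec, Pi.single]

/-- The derivative of `S ↦ S v` with respect to the `m`-th row of the symmetric matrix `S`. -/
def starMat (m : Fin n) (v : Fin n → ℂ) : Matrix (Fin n) (Fin n) ℂ :=
  Matrix.of fun i r => (symMat (unitCoord s(m, r)) *ᵥ v) i

lemma starMat_eq (m : Fin n) (v : Fin n → ℂ) : starMat m v =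
    v m • 1 + Matrix.vecMulVec (Pi.single m 1) (v - v m • Pi.single m 1) := by
  ext i r
  rw [starMat, Matrix.of_apply, symMat_unitCoord_mulVec]
  split_ifs with h
  · subst h
    simp [Matrix.vecMulVec_apply, Matrix.one_apply, Pi.single_apply]
  · by_cases him : i = m <;> by_cases hir : i = r <;>
      simp_all [Matrix.vecMulVec_apply, eq_comm]

lemma starMat_mulVec (m : Fin n) (v η : Fin n → ℂ) :
    starMat m v *ᵥ η = symMat (∑ r, η r • unitCoord s(m, r)) *ᵥ v := by
  rw [symMat_sum, Matrix.sum_mulVec]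
  funext i
  simp [Matrix.mulVec, dotProduct, starMat, Matrix.smul_mulVec, mul_comm]

lemma det_smul_one_add_vecMulVec (m : Fin n) (c : ℂ) {f : Fin n → ℂ} (hf : f m = 0) :
    (c • (1 : Matrix (Fin n) (Fin n) ℂ) + Matrix.vecMulVec (Pi.single m 1) f).det = c ^ n := by
  have : Nonempty (Fin n) := ⟨m⟩
  rw [det_add_vecMulVec, Matrix.adjugate_smul, Matrix.adjugate_one, Matrix.smul_mulVec,
    Matrix.one_mulVec, dotProduct_smul, Matrix.det_smul]
  simp [hf]

lemma det_starMat (m : Fin n) (v : Fin n → ℂ) : (starMat m v).det = v m ^ n := by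
  rw [starMat_eq, det_smul_one_add_vecMulVec m _ (by simp)]

lemma continuous_adjugate_aux (m : Fin n) (f : Fin n → ℂ) : Continuous fun c : ℂ =>
    (c • (1 : Matrix (Fin n) (Fin n) ℂ) + Matrix.vecMulVec (Pi.single m 1) f).adjugate := by
  fun_prop

/-- The matrix is c + N with c = v_m and N² = 0, so (c + N)(c - N) = c² and its determinant is c^n.
This settles c ≠ 0; continuity in c covers c = 0. Writing n = k + 2 keeps the exponent n - 2 a
natural number. -/
lemma adjugate_starMat {k : ℕ} (hk : n = k + 2) (m : Fin n) (v : Fin n → ℂ) :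
    (starMat m v).adjugate = v m ^ k •
      (v m • 1 - Matrix.vecMulVec (Pi.single m 1) (v - v m • Pi.single m 1)) := by
  set f := v - v m • Pi.single m 1 with hf
  have hfm : f m = 0 := by simp [hf]
  have key : (fun c : ℂ => (c • (1 : Matrix (Fin n) (Fin n) ℂ)
      + Matrix.vecMulVec (Pi.single m 1) f).adjugate) =
      fun c => c ^ k • (c • 1 - Matrix.vecMulVec (Pi.single m 1) f) := by
    refine (continuous_adjugate_aux m f).ext_on (dense_compl_singleton (0 : ℂ)) (by fun_prop) ?_
    intro c hc
    have hc : c ≠ 0 := hc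
    have hdet : (c • (1 : Matrix (Fin n) (Fin n) ℂ)
        + Matrix.vecMulVec (Pi.single m 1) f).det = c ^ n := det_smul_one_add_vecMulVec m c hfm
    have hv : Matrix.vecMulVec (Pi.single m 1) f * Matrix.vecMulVec (Pi.single m 1) f = 0 := by
      rw [Matrix.vecMulVec_mul_vecMulVec]
      simp [hfm]
    have hmul : (c • (1 : Matrix (Fin n) (Fin n) ℂ) + Matrix.vecMulVec (Pi.single m 1) f)
        * (c • 1 - Matrix.vecMulVec (Pi.single m 1) f) = (c ^ 2) • 1 := by
      rw [add_mul, mul_sub, mul_sub, hv]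
      simp [smul_smul, sq]
    have h := congrArg (fun B => (c • (1 : Matrix (Fin n) (Fin n) ℂ)
      + Matrix.vecMulVec (Pi.single m 1) f).adjugate * B) hmul
    simp only [← mul_assoc, Matrix.adjugate_mul, hdet, Matrix.smul_mul, one_mul, Matrix.mul_smul,
      mul_one] at h
    have h2 := congrArg (fun B => (c ^ 2)⁻¹ • B) h
    simp only [smul_smul, inv_mul_cancel₀ (pow_ne_zero 2 hc), one_smul] at h2
    have hp : c ^ n = c ^ 2 * c ^ k := by rw [← pow_add, add_comm, ← hk]
    simp only
    rw [← h2, hp, inv_mul_cancel_left₀ (pow_ne_zero 2 hc)]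
  rw [starMat_eq]
  exact congrFun key (v m)

end Star

/-! ### The function `(1 - e^{-z}) / z` -/

/-- The entire function `(1 - e^{-z}) / z`. -/
def expQuot : ℂ → ℂ := dslope (fun z => -Complex.exp (-z)) 0

lemma mul_expQuot (z : ℂ) : z * expQuot z = 1 - Complex.exp (-z) := by
  have := sub_smul_dslope (fun z => -Complex.exp (-z)) 0 z
  simp only [sub_zero, smul_eq_mul, neg_zero, Complex.exp_zero] at this
  rw [expQuot, this]
  ring

lemma expQuot_zero : expQuot 0 = 1 := by
  rw [expQuot, dslope_same]
  have : HasDerivAt (fun z : ℂ => -Complex.exp (-z)) (-(Complex.exp (-0) * -1)) 0 :=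
    ((hasDerivAt_neg (0 : ℂ)).cexp).neg
  simpa using this.deriv

lemma contDiff_expQuot : ContDiff ℂ ∞ expQuot := by
  have h : Differentiable ℂ fun z : ℂ => -Complex.exp (-z) := by fun_prop
  have := (Complex.differentiableOn_dslope (s := Set.univ) (c := 0) Filter.univ_mem).2
    h.differentiableOn
  exact (differentiableOn_univ.1 this).contDiff

lemma expQuot_neg (z : ℂ) : expQuot (-z) * Complex.exp (-z) = expQuot z := by
  by_cases hz : z = 0
  · simp [hz, expQuot_zero]
  · have h1 := mul_expQuot z
    have h2 := mul_expQuot (-z)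
    rw [neg_neg] at h2
    have h3 : Complex.exp z * Complex.exp (-z) = 1 := by rw [← Complex.exp_add]; simp
    apply mul_left_cancel₀ hz
    linear_combination -Complex.exp (-z) * h2 - h1 + h3

/-- The function is the integral of e^{-cs} from 0 to t, written so that c = 0 needs no separate
treatment in the flows. -/
lemma hasDerivAt_mul_expQuot (c t : ℂ) :
    HasDerivAt (fun t => t * expQuot (c * t)) (Complex.exp (-(c * t))) t := by
  by_cases hc : c = 0
  · subst hc
    simpa [expQuot_zero] using hasDerivAt_id' t
  · have h : (fun t => t * expQuot (c * t)) = fun t => c⁻¹ * (1 - Complex.exp (-(c * t))) := by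
      funext t
      rw [← mul_expQuot]
      field_simp
    rw [h]
    have h1 : HasDerivAt (fun t : ℂ => -(c * t)) (-c) t := by
      simpa using! ((hasDerivAt_id' t).const_mul c).fun_neg
    have := ((h1.cexp).const_sub 1).const_mul c⁻¹
    rwa [show c⁻¹ * -(Complex.exp (-(c * t)) * -c) = Complex.exp (-(c * t)) by field_simp] at this

/-- Every zero is a nonzero multiple of 2πi, and z and iz cannot both be purely imaginary unless z =
0. Consequently one of the times 1 and i always produces a nonzero displacement, which keeps the
list of moves finite. -/
lemma expQuot_ne_zero_or (z : ℂ) : expQuot z ≠ 0 ∨ expQuot (z * Complex.I) ≠ 0 := by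
  by_contra! h
  obtain ⟨h1, h2⟩ := h
  have hz : z ≠ 0 := by
    rintro rfl
    simp [expQuot_zero] at h1
  have e1 : Complex.exp (-z) = 1 := by
    have := mul_expQuot z
    rw [h1, mul_zero] at this
    linear_combination this
  have e2 : Complex.exp (-(z * Complex.I)) = 1 := by
    have := mul_expQuot (z * Complex.I)
    rw [h2, mul_zero] at this
    linear_combination this
  obtain ⟨a, ha⟩ := Complex.exp_eq_one_iff.1 e1
  obtain ⟨b, hb⟩ := Complex.exp_eq_one_iff.1 e2
  have hre := congrArg Complex.re ha
  have him := congrArg Complex.im hb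
  simp at hre him
  apply hz
  apply Complex.ext
  · simpa using hre
  · have h3 := congrArg Complex.re hb
    simp at h3
    exact h3

/-! ### The recursion for the components of `Φ_K` -/

section Recursion

variable {n : ℕ}

/-- The vectors `0, e_n, Z_1 e_n, e_n + Z_2 Z_1 e_n, …`; two consecutive ones are the components of
`Φ_K`. -/
def om (z : ℕ → SymCoord n) : ℕ → Fin n → ℂ
  | 0 => 0
  | 1 => eLast n
  | j + 2 => om z j + symMat (z j) *ᵥ om z (j + 1)

/-- The derivative of `om z j` with respect to `om z (l + 2)`. -/
def prop (z : ℕ → SymCoord n) (l : ℕ) : ℕ → Matrix (Fin n) (Fin n) ℂ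
  | 0 => 0
  | 1 => 0
  | j + 2 => prop z l j + symMat (z j) * prop z l (j + 1) + if j = l then 1 else 0

lemma om_zero (z : ℕ → SymCoord n) : om z 0 = 0 := by rw [om]

lemma om_one (z : ℕ → SymCoord n) : om z 1 = eLast n := by rw [om]

lemma om_add_two (z : ℕ → SymCoord n) (j : ℕ) :
    om z (j + 2) = om z j + symMat (z j) *ᵥ om z (j + 1) := by rw [om]

lemma prop_add_two (z : ℕ → SymCoord n) (l j : ℕ) : prop z l (j + 2) =
    prop z l j + symMat (z j) * prop z l (j + 1) + if j = l then 1 else 0 := by rw [prop]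

lemma om_congr {z z' : ℕ → SymCoord n} : ∀ {j : ℕ}, (∀ k, k + 2 ≤ j → z k = z' k) →
    om z j = om z' j
  | 0, _ => by rw [om_zero, om_zero]
  | 1, _ => by rw [om_one, om_one]
  | j + 2, h => by
    rw [om_add_two, om_add_two, om_congr fun k hk => h k (by omega),
      om_congr fun k hk => h k (by omega), h j le_rfl]

lemma prop_of_lt (z : ℕ → SymCoord n) {l : ℕ} : ∀ {j : ℕ}, j < l + 2 → prop z l j = 0
  | 0, _ => by rw [prop]
  | 1, _ => by rw [prop]
  | j + 2, h => by
    rw [prop_add_two, prop_of_lt z (by omega), prop_of_lt z (by omega), if_neg (by omega)]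
    simp

@[simp] lemma prop_self (z : ℕ → SymCoord n) (l : ℕ) : prop z l (l + 2) = 1 := by
  rw [prop_add_two, prop_of_lt z (by omega), prop_of_lt z (by omega)]
  simp

lemma prop_add_three (z : ℕ → SymCoord n) (l : ℕ) :
    prop z l (l + 3) = symMat (z (l + 1)) := by
  rw [show l + 3 = (l + 1) + 2 from rfl, prop_add_two, prop_self, prop_of_lt z (by omega),
    if_neg (by omega)]
  simp

lemma prop_add_four (z : ℕ → SymCoord n) (l : ℕ) :
    prop z l (l + 4) = 1 + symMat (z (l + 2)) * symMat (z (l + 1)) := by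
  rw [show l + 4 = (l + 2) + 2 from rfl, prop_add_two, prop_self, prop_add_three,
    if_neg (by omega)]
  simp

/-- The perturbation of the `m`-th row of block `l` by `η` and of the `i`-th diagonal entry of
block `k` by `s`. -/
def crossPert (l k : ℕ) (m i : Fin n) (s : ℂ) (η : Fin n → ℂ) : ℕ → SymCoord n :=
  Pi.single l (∑ r, η r • unitCoord s(m, r)) + Pi.single k (s • unitCoord s(i, i))

/-! ### Exact change of the chain under a row and a diagonal perturbation -/

section Cross

variable {l k : ℕ} (hlk : l < k) (m i : Fin n) (s : ℂ) (η : Fin n → ℂ) (z : ℕ → SymCoord n)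

include hlk

/-- Propagation from block k only involves blocks after k, which the perturbation leaves alone. -/
lemma prop_add_crossPert_right (j : ℕ) :
    prop (z + crossPert l k m i s η) k j = prop z k j := by
  induction j using Nat.twoStepInduction with
  | zero => rw [prop, prop]
  | one => rw [prop, prop]
  | more j h1 h2 =>
    rw [prop_add_two, prop_add_two, h1, h2]
    by_cases hj : j ≤ k
    · rw [prop_of_lt z (j := j + 1) (by omega), mul_zero, mul_zero]
    · rw [Pi.add_apply, crossPert, Pi.add_apply, Pi.single_eq_of_ne (by omega),
        Pi.single_eq_of_ne (by omega)]
      simp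

/-- The perturbed diagonal entry is used once, at block k: it reads row i of the propagation up to
there and feeds it into the propagation from k. The change is therefore of rank one and exactly
linear in s. -/
lemma prop_add_crossPert_left (j : ℕ) :
    prop (z + crossPert l k m i s η) l j = prop z l j +
      s • Matrix.vecMulVec (prop z k j *ᵥ Pi.single i 1) (prop z l (k + 1) i) := by
  induction j using Nat.twoStepInduction with
  | zero => simp only [prop, Matrix.zero_mulVec, Matrix.zero_vecMulVec, smul_zero, add_zero]
  | one => simp only [prop, Matrix.zero_mulVec, Matrix.zero_vecMulVec, smul_zero, add_zero]
  | more j h1 h2 =>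
    rw [prop_add_two, prop_add_two, h1, h2, prop_add_two]
    by_cases hj : j ≤ l
    · rw [prop_of_lt z (l := l) (j := j + 1) (by omega), prop_of_lt z (l := k) (j := j + 1)
        (by omega), prop_of_lt z (l := k) (j := j) (by omega), if_neg (c := j = k) (by omega)]
      simp only [Matrix.zero_mulVec, Matrix.zero_vecMulVec, smul_zero, add_zero, mul_zero]
    · rw [Pi.add_apply, crossPert, Pi.add_apply, Pi.single_eq_of_ne (by omega : j ≠ l), zero_add]
      by_cases hk : j = k
      · subst hk
        rw [Pi.single_eq_same, prop_of_lt z (l := j) (j := j + 1) (by omega),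
          prop_of_lt z (l := j) (j := j) (by omega), if_pos rfl, if_neg (by omega)]
        simp only [Matrix.zero_mulVec, Matrix.zero_vecMulVec, smul_zero,
          add_zero, mul_zero, zero_add, Matrix.one_mulVec, symMat_add, symMat_smul, add_mul]
        rw [symMat_unitCoord, if_pos rfl]
        rw [add_assoc]
        congr 2
        rw [Matrix.smul_mul]
        congr 1
        ext a b
        by_cases h : i = a <;> simp [Matrix.vecMulVec_apply, Matrix.mul_apply, Matrix.single_apply,
          h, eq_comm]
      · rw [Pi.single_eq_of_ne hk, if_neg hk, if_neg (by omega)]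
        simp only [add_zero, mul_add, Matrix.mul_smul, Matrix.mul_vecMulVec, Matrix.mulVec_mulVec,
          Matrix.add_mulVec, Matrix.add_vecMulVec, smul_add]
        abel

/-- An exact formula, not only a first order one: each of the two perturbations enters linearly, and
their interaction is the single bilinear term in s and η. -/
lemma om_add_crossPert (j : ℕ) :
    om (z + crossPert l k m i s η) j = om z j + prop z l j *ᵥ (starMat m (om z (l + 1)) *ᵥ η) +
      (s * (om z (k + 1) i + (prop z l (k + 1) *ᵥ (starMat m (om z (l + 1)) *ᵥ η)) i)) •
        (prop z k j *ᵥ Pi.single i 1) := by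
  generalize hξ : starMat m (om z (l + 1)) *ᵥ η = ξ
  induction j using Nat.strong_induction_on with
  | _ j ih =>
  match j with
  | 0 => simp only [om_zero, prop, Matrix.zero_mulVec, smul_zero, add_zero]
  | 1 => simp only [om_one, prop, Matrix.zero_mulVec, smul_zero, add_zero]
  | j + 2 =>
    rw [om_add_two, ih j (by omega), ih (j + 1) (by omega), om_add_two, prop_add_two, prop_add_two]
    rw [Pi.add_apply, crossPert, Pi.add_apply]
    by_cases hl : j = l
    · subst hl
      rw [Pi.single_eq_same, Pi.single_eq_of_ne (by omega),
        prop_of_lt z (l := k) (j := j + 1) (by omega), prop_of_lt z (l := k) (j := j) (by omega),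
        prop_of_lt z (l := j) (j := j + 1) (by omega),
        prop_of_lt z (l := j) (j := j) (by omega), if_pos rfl, if_neg (by omega)]
      simp only [Matrix.zero_mulVec, smul_zero, add_zero, zero_add, mul_zero, symMat_add,
        Matrix.one_mulVec, Matrix.add_mulVec, ← hξ, starMat_mulVec]
      abel
    · rw [Pi.single_eq_of_ne hl, if_neg hl, zero_add]
      by_cases hk : j = k
      · subst hk
        rw [Pi.single_eq_same, prop_of_lt z (l := j) (j := j + 1) (by omega),
          prop_of_lt z (l := j) (j := j) (by omega), if_pos rfl]
        simp only [Matrix.zero_mulVec, smul_zero, add_zero, zero_add, mul_zero, symMat_add,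
          Matrix.one_mulVec, Matrix.add_mulVec, symMat_smul, Matrix.smul_mulVec,
          symMat_unitCoord_mulVec, if_pos, Matrix.mulVec_add, ← Matrix.mulVec_mulVec]
        have : ∀ c : ℂ, (Pi.single i c : Fin n → ℂ) = c • Pi.single i 1 := by
          intro c; rw [← Pi.single_smul]; simp
        rw [this (om z (j + 1) i), this ((prop z l (j + 1) *ᵥ ξ) i), mul_add, add_smul, mul_smul,
          mul_smul]
        abel
      · rw [Pi.single_eq_of_ne hk, if_neg hk]
        simp only [add_zero, Matrix.mulVec_add, Matrix.mulVec_smul, ← Matrix.mulVec_mulVec,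
          Matrix.add_mulVec, smul_add]
        abel

end Cross

end Recursion

/-! ### Smoothness of matrix operations -/

section Smooth

variable {n : ℕ} {E : Type*} [NormedAddCommGroup E] [NormedSpace ℂ E]

lemma contDiff_mulVec {A : E → Matrix (Fin n) (Fin n) ℂ} {v : E → Fin n → ℂ}
    (hA : ∀ i j, ContDiff ℂ ∞ fun p => A p i j) (hv : ContDiff ℂ ∞ v) :
    ContDiff ℂ ∞ fun p => A p *ᵥ v p :=
  contDiff_pi.2 fun i => by
    simp only [Matrix.mulVec, dotProduct]
    exact ContDiff.sum fun j _ => (hA i j).mul (contDiff_pi.1 hv j)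

lemma contDiff_matrixMul {A B : E → Matrix (Fin n) (Fin n) ℂ}
    (hA : ∀ i j, ContDiff ℂ ∞ fun p => A p i j) (hB : ∀ i j, ContDiff ℂ ∞ fun p => B p i j)
    (i j : Fin n) : ContDiff ℂ ∞ fun p => (A p * B p) i j := by
  simp only [Matrix.mul_apply]
  exact ContDiff.sum fun k _ => (hA i k).mul (hB k j)

lemma contDiff_det {m : ℕ} {A : E → Matrix (Fin m) (Fin m) ℂ}
    (hA : ∀ i j, ContDiff ℂ ∞ fun p => A p i j) : ContDiff ℂ ∞ fun p => (A p).det := by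
  simp only [Matrix.det_apply]
  exact ContDiff.sum fun σ _ => (contDiff_prod fun i _ => hA _ _).const_smul _

lemma contDiff_adjugate {A : E → Matrix (Fin n) (Fin n) ℂ}
    (hA : ∀ i j, ContDiff ℂ ∞ fun p => A p i j) (i j : Fin n) :
    ContDiff ℂ ∞ fun p => (A p).adjugate i j := by
  simp only [Matrix.adjugate_apply]
  refine contDiff_det fun a b => ?_
  by_cases h : a = j
  · simp only [h, Matrix.updateRow_self]
    exact contDiff_const
  · simp only [Matrix.updateRow_ne h]
    exact hA a b

lemma contDiff_starMat (m : Fin n) {v : E → Fin n → ℂ} (hv : ContDiff ℂ ∞ v) (i j : Fin n) :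
    ContDiff ℂ ∞ fun p => starMat m (v p) i j := by
  simp only [starMat, Matrix.of_apply]
  exact contDiff_pi.1 (contDiff_mulVec (A := fun _ => symMat (unitCoord s(m, j)))
    (fun _ _ => contDiff_const) hv) i

end Smooth

/-! ### Configurations as sequences -/

section ToSeq

variable {n K : ℕ}

/-- A configuration, extended by zero to a sequence. -/
def toSeq : Conf n K →ₗ[ℂ] (ℕ → SymCoord n) where
  toFun Z k := if h : k < K then Z ⟨k, h⟩ else 0
  map_add' Z W := by
    funext k
    by_cases h : k < K <;> simp [h]
  map_smul' c Z := by
    funext k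
    by_cases h : k < K <;> simp [h]

lemma toSeq_apply (Z : Conf n K) {k : ℕ} (h : k < K) : toSeq Z k = Z ⟨k, h⟩ := by
  simp [toSeq, h]

lemma toSeq_single {k : ℕ} (h : k < K) (z : SymCoord n) :
    toSeq (Pi.single ⟨k, h⟩ z : Conf n K) = Pi.single k z := by
  funext a
  by_cases ha : a < K
  · rw [toSeq_apply _ ha]
    by_cases hk : a = k
    · subst hk; simp
    · rw [Pi.single_eq_of_ne hk, Pi.single_eq_of_ne (by simpa [Fin.ext_iff] using hk)]
  · rw [Pi.single_eq_of_ne (by omega)]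
    simp [toSeq, ha]

lemma toSeq_proj (Z : Conf n (K + 1)) {k : ℕ} (h : k < K) : toSeq (proj Z) k = toSeq Z k := by
  rw [toSeq_apply _ h, toSeq_apply _ (by omega : k < K + 1)]
  rfl

lemma om_proj (Z : Conf n (K + 1)) {j : ℕ} (h : j ≤ K + 1) :
    om (toSeq (proj Z)) j = om (toSeq Z) j :=
  om_congr fun k hk => toSeq_proj Z (by omega)

lemma contDiff_toSeq (k : ℕ) : ContDiff ℂ ∞ fun Z : Conf n K => toSeq Z k := by
  by_cases h : k < K
  · simp only [toSeq_apply _ h]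
    fun_prop
  · have : (fun Z : Conf n K => toSeq Z k) = fun _ => 0 := by
      funext Z; simp [toSeq, h]
    rw [this]
    exact contDiff_const

lemma contDiff_symMat (k : ℕ) (i j : Fin n) :
    ContDiff ℂ ∞ fun Z : Conf n K => symMat (toSeq Z k) i j :=
  contDiff_pi.1 (contDiff_toSeq k) _

lemma contDiff_om (j : ℕ) : ContDiff ℂ ∞ fun Z : Conf n K => om (toSeq Z) j := by
  induction j using Nat.twoStepInduction with
  | zero => simpa only [om_zero] using contDiff_const
  | one => simpa only [om_one] using contDiff_const
  | more j h1 h2 =>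
    simp only [om_add_two]
    exact h1.add (contDiff_mulVec (contDiff_symMat j) h2)

lemma contDiff_prop (l j : ℕ) (a b : Fin n) :
    ContDiff ℂ ∞ fun Z : Conf n K => prop (toSeq Z) l j a b := by
  induction j using Nat.twoStepInduction generalizing a b with
  | zero => simpa only [prop] using contDiff_const
  | one => simpa only [prop] using contDiff_const
  | more j h1 h2 =>
    simp only [prop_add_two, Matrix.add_apply]
    exact ((h1 a b).add (contDiff_matrixMul (contDiff_symMat j) h2 a b)).add contDiff_const

/-- Parity only decides which half of the vector was updated last. -/
lemma Phi_eq : ∀ (K : ℕ) (Z : Conf n K), Phi n K Z =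
    if Even K then Sum.elim (om (toSeq Z) K) (om (toSeq Z) (K + 1))
    else Sum.elim (om (toSeq Z) (K + 1)) (om (toSeq Z) K)
  | 0, Z => by simp [Phi, om_zero, om_one]
  | K + 1, Z => by
    rw [Phi, Phi_eq K, om_proj Z (by omega), om_proj Z (by omega), om_add_two,
      toSeq_apply Z (Nat.lt_succ_self K), elemMat]
    by_cases h : Even K
    · have h' : Odd (K + 1) := h.add_one
      rw [if_pos h, if_pos h', if_neg (Nat.not_even_iff_odd.2 h'), Matrix.fromBlocks_mulVec]
      congr 1 <;> simp [Fin.last]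
    · have h' : ¬ Odd (K + 1) := by simpa [Nat.odd_add_one] using h
      rw [if_neg h, if_neg h', if_pos (Nat.not_odd_iff_even.1 h'), Matrix.fromBlocks_mulVec]
      congr 1 <;> simp [Fin.last]
      rw [add_comm]

lemma Ptil_eq (Z : Conf n K) : Ptil n K Z = om (toSeq Z) (K + 1) := by
  rw [Ptil, halfProj, Phi_eq]
  by_cases h : Even K
  · rw [if_neg (by simpa [Nat.even_add_one] using h), if_pos h]; rfl
  · rw [if_pos (by simpa [Nat.even_add_one] using h), if_neg h]; rfl

lemma halfProj_Phi (Z : Conf n K) : halfProj K (Phi n K Z) = om (toSeq Z) K := by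
  rw [halfProj, Phi_eq]
  by_cases h : Even K
  · rw [if_pos h, if_pos h]; rfl
  · rw [if_neg h, if_neg h]; rfl

lemma Phi_eq_Phi_iff {Z W : Conf n K} : Phi n K Z = Phi n K W ↔
    om (toSeq Z) (K + 1) = om (toSeq W) (K + 1) ∧ om (toSeq Z) K = om (toSeq W) K := by
  rw [Phi_eq, Phi_eq]
  split_ifs
  · rw [Sum.elim_eq_iff, and_comm]
  · rw [Sum.elim_eq_iff]

lemma contDiff_Phi : ContDiff ℂ ∞ (Phi n K) := by
  have : Phi n K = fun Z => if Even K then Sum.elim (om (toSeq Z) K) (om (toSeq Z) (K + 1))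
    else Sum.elim (om (toSeq Z) (K + 1)) (om (toSeq Z) K) := funext (Phi_eq K)
  rw [this]
  refine contDiff_pi.2 fun a => ?_
  have h1 := fun i => contDiff_pi.1 (contDiff_om (n := n) (K := K) K) i
  have h2 := fun i => contDiff_pi.1 (contDiff_om (n := n) (K := K) (K + 1)) i
  split_ifs <;> cases a <;> simp only [Sum.elim_inl, Sum.elim_inr] <;> first | exact h1 _ | exact h2 _

end ToSeq

/-! ### Adding a block -/

section Extend

variable {n K : ℕ}

/-- The configuration `(Z_1, …, Z_K, S)`. -/
def extend (v : Conf n K) (S : SymCoord n) : Conf n (K + 1) :=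
  Fin.snoc (α := fun _ => SymCoord n) v S

@[simp] lemma proj_extend (v : Conf n K) (S : SymCoord n) : proj (extend v S) = v := by
  funext k
  simp [proj, extend]

@[simp] lemma extend_last (v : Conf n K) (S : SymCoord n) : extend v S (Fin.last K) = S := by
  simp [extend]

@[simp] lemma extend_castSucc (v : Conf n K) (S : SymCoord n) (k : Fin K) :
    extend v S k.castSucc = v k := by
  simp [extend]

@[simp] lemma extend_proj (Z : Conf n (K + 1)) : extend (proj Z) (Z (Fin.last K)) = Z := by
  funext k
  refine Fin.lastCases ?_ (fun k => ?_) k <;> simp [proj]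

lemma conf_ext {Z W : Conf n (K + 1)} (h1 : proj Z = proj W)
    (h2 : Z (Fin.last K) = W (Fin.last K)) : Z = W := by
  rw [← extend_proj Z, ← extend_proj W, h1, h2]

lemma extend_add (v w : Conf n K) (S T : SymCoord n) :
    extend v S + extend w T = extend (v + w) (S + T) :=
  conf_ext (by funext k; simp [proj]) (by simp)

lemma smul_extend (c : ℂ) (v : Conf n K) (S : SymCoord n) :
    c • extend v S = extend (c • v) (c • S) :=
  conf_ext (by funext k; simp [proj]) (by simp)

lemma proj_add (Z W : Conf n (K + 1)) : proj (Z + W) = proj Z + proj W := rfl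

lemma proj_smul (c : ℂ) (Z : Conf n (K + 1)) : proj (c • Z) = c • proj Z := rfl

lemma toSeq_last (Z : Conf n (K + 1)) : toSeq Z K = Z (Fin.last K) :=
  toSeq_apply Z (Nat.lt_succ_self K)

lemma contDiff_proj : ContDiff ℂ ∞ (proj : Conf n (K + 1) → Conf n K) :=
  contDiff_pi.2 fun k => contDiff_apply ℂ (SymCoord n) k.castSucc

lemma contDiff_extend {E : Type*} [NormedAddCommGroup E] [NormedSpace ℂ E] {f : E → Conf n K}
    {g : E → SymCoord n} (hf : ContDiff ℂ ∞ f) (hg : ContDiff ℂ ∞ g) :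
    ContDiff ℂ ∞ fun p => extend (f p) (g p) := by
  refine contDiff_pi.2 fun k => ?_
  refine Fin.lastCases ?_ (fun k => ?_) k
  · simpa using hg
  · simpa using contDiff_pi.1 hf k

lemma hasDerivAt_extend {f : ℂ → Conf n K} {g : ℂ → SymCoord n} {f' : Conf n K} {g' : SymCoord n}
    {t : ℂ} (hf : HasDerivAt f f' t) (hg : HasDerivAt g g' t) :
    HasDerivAt (fun s => extend (f s) (g s)) (extend f' g') t := by
  refine hasDerivAt_pi.2 fun k => ?_
  refine Fin.lastCases ?_ (fun k => ?_) k
  · simpa using hg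
  · simpa using hasDerivAt_pi.1 hf k

lemma lift_apply (X : VField n K) (Z : Conf n (K + 1)) : lift X Z = extend (X (proj Z)) 0 := rfl

/-- The action of a permutation on the first `K` blocks. -/
def liftPerm : Equiv.Perm (Conf n K) →* Equiv.Perm (Conf n (K + 1)) where
  toFun σ :=
    { toFun := fun Z => extend (σ (proj Z)) (Z (Fin.last K))
      invFun := fun Z => extend (σ.symm (proj Z)) (Z (Fin.last K))
      left_inv := fun Z => by simp
      right_inv := fun Z => by simp }
  map_one' := by ext1 Z; simp
  map_mul' σ τ := by ext1 Z; simp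

lemma liftPerm_apply (σ : Equiv.Perm (Conf n K)) (Z : Conf n (K + 1)) :
    liftPerm σ Z = extend (σ (proj Z)) (Z (Fin.last K)) := rfl

lemma liftPerm_symm (σ : Equiv.Perm (Conf n K)) : (liftPerm σ).symm = liftPerm σ.symm := rfl

@[simp] lemma proj_liftPerm (σ : Equiv.Perm (Conf n K)) (Z : Conf n (K + 1)) :
    proj (liftPerm σ Z) = σ (proj Z) := by
  simp [liftPerm_apply]

lemma contDiff_liftPerm {σ : Equiv.Perm (Conf n K)} (h : ContDiff ℂ ∞ σ) :
    ContDiff ℂ ∞ (liftPerm σ) :=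
  contDiff_extend (h.comp contDiff_proj) (contDiff_apply ℂ (SymCoord n) (Fin.last K))

/-- The lifted map is a product with the identity, so differentiating its inverse along a line in
the old directions gives back the old derivative. This is what makes the families nested. -/
lemma lift_pullback {σ : Equiv.Perm (Conf n K)} (hσ : ContDiff ℂ ∞ σ) (hσ' : ContDiff ℂ ∞ σ.symm)
    (X : VField n K) :
    lift (VectorField.pullback ℂ σ X) = VectorField.pullback ℂ (liftPerm σ) (lift X) := by
  funext Z
  have h1 := contDiff_liftPerm hσ
  have h2 : ContDiff ℂ ∞ (liftPerm σ).symm := contDiff_liftPerm hσ'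
  rw [pullback_perm h1 h2, lift_apply, lift_apply, pullback_perm hσ hσ', proj_liftPerm]
  set W := liftPerm σ Z with hW
  have hWp : proj W = σ (proj Z) := by simp [hW]
  set v := X (σ (proj Z))
  have hd : HasDerivAt (fun t : ℂ => W + t • extend v 0) (extend v 0) 0 := by
    simpa using ((hasDerivAt_id (0 : ℂ)).smul_const (extend v 0)).const_add W
  have hd' : HasDerivAt (fun t : ℂ => proj W + t • v) v 0 := by
    simpa using ((hasDerivAt_id (0 : ℂ)).smul_const v).const_add (proj W)
  have e1 := ((h2.differentiable (by simp)) (W + (0 : ℂ) • extend v 0)).hasFDerivAt.comp_hasDerivAt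
    0 hd
  have e2 := ((hσ'.differentiable (by simp)) (proj W + (0 : ℂ) • v)).hasFDerivAt.comp_hasDerivAt
    0 hd'
  have e3 := hasDerivAt_extend e2 (hasDerivAt_const (0 : ℂ) (W (Fin.last K)))
  have e4 : ((liftPerm σ).symm ∘ fun t : ℂ => W + t • extend v 0) =
      fun t : ℂ => extend ((σ.symm ∘ fun t : ℂ => proj W + t • v) t) (W (Fin.last K)) := by
    funext t
    simp [liftPerm_symm, liftPerm_apply, proj_add, proj_smul]
  rw [e4] at e1
  have := e3.unique e1
  rw [zero_smul, zero_smul, add_zero, add_zero, hWp] at this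
  exact this

lemma isFlowMap_lift {X : VField n K} {t : ℂ} {σ : Equiv.Perm (Conf n K)} (h : IsFlowMap X t σ) :
    IsFlowMap (lift X) t (liftPerm σ) := by
  intro Z
  obtain ⟨γ, h0, hγ, ht⟩ := h (proj Z)
  refine ⟨fun s => extend (γ s) (Z (Fin.last K)), by simp [h0], fun s => ?_, ?_⟩
  · simp only [lift_apply, proj_extend]
    exact hasDerivAt_extend (hγ s) (hasDerivAt_const s _)
  · simp only [liftPerm_apply, ht]

lemma isSmoothFlow_lift {X : VField n K} {fl : ℂ → Conf n K → Conf n K} (h : IsSmoothFlow X fl) :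
    IsSmoothFlow (lift X) fun t Z => extend (fl t (proj Z)) (Z (Fin.last K)) where
  zero Z := by simp [h.zero]
  neg t Z := by simp [h.neg]
  smooth t := contDiff_extend ((h.smooth t).comp contDiff_proj)
    (contDiff_apply ℂ (SymCoord n) (Fin.last K))
  curve Z t := by
    simp only [lift_apply, proj_extend]
    exact hasDerivAt_extend (h.curve _ t) (hasDerivAt_const t _)

end Extend

/-! ### The derivatives of the components of `Φ_K` -/

section Derivative

variable {n K : ℕ}

/-- The derivative of `om (toSeq Z) j`. -/
def dom (Z : Conf n K) (j : ℕ) : Conf n K →L[ℂ] (Fin n → ℂ) :=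
  fderiv ℂ (fun W : Conf n K => om (toSeq W) j) Z

lemma hasFDerivAt_om (Z : Conf n K) (j : ℕ) :
    HasFDerivAt (fun W : Conf n K => om (toSeq W) j) (dom Z j) Z :=
  ((contDiff_om j).differentiable (by simp) Z).hasFDerivAt

lemma hasDerivAt_om_line (Z v : Conf n K) (j : ℕ) :
    HasDerivAt (fun t : ℂ => om (toSeq (Z + t • v)) j) (dom Z j v) 0 := by
  have h : HasDerivAt (fun t : ℂ => Z + t • v) v 0 := by
    simpa using ((hasDerivAt_id (0 : ℂ)).smul_const v).const_add Z
  have h2 : HasFDerivAt (fun W : Conf n K => om (toSeq W) j) (dom Z j) (Z + (0 : ℂ) • v) := by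
    simpa using hasFDerivAt_om Z j
  exact h2.comp_hasDerivAt 0 h

lemma hasDerivAt_om_curve {γ : ℂ → Conf n K} {v : Conf n K} {t : ℂ} (h : HasDerivAt γ v t) (j : ℕ) :
    HasDerivAt (fun s : ℂ => om (toSeq (γ s)) j) (dom (γ t) j v) t :=
  (hasFDerivAt_om (γ t) j).comp_hasDerivAt t h

lemma hasDerivAt_mulVec {A : ℂ → Matrix (Fin n) (Fin n) ℂ} {A' : Matrix (Fin n) (Fin n) ℂ}
    {v : ℂ → Fin n → ℂ} {v' : Fin n → ℂ} {t : ℂ}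
    (hA : ∀ i j, HasDerivAt (fun s => A s i j) (A' i j) t) (hv : HasDerivAt v v' t) :
    HasDerivAt (fun s => A s *ᵥ v s) (A' *ᵥ v t + A t *ᵥ v') t := by
  refine hasDerivAt_pi.2 fun i => ?_
  simp only [Matrix.mulVec, dotProduct, Pi.add_apply, ← Finset.sum_add_distrib]
  exact HasDerivAt.fun_sum fun j _ => (hA i j).mul (hasDerivAt_pi.1 hv j)

lemma dom_zero (Z v : Conf n K) : dom Z 0 v = 0 := by
  have := hasDerivAt_om_line Z v 0
  simp only [om_zero] at this
  exact this.unique (hasDerivAt_const _ _)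

lemma dom_one (Z v : Conf n K) : dom Z 1 v = 0 := by
  have := hasDerivAt_om_line Z v 1
  simp only [om_one] at this
  exact this.unique (hasDerivAt_const _ _)

lemma dom_add_two (Z v : Conf n K) (j : ℕ) : dom Z (j + 2) v = dom Z j v +
    (symMat (toSeq v j) *ᵥ om (toSeq Z) (j + 1) + symMat (toSeq Z j) *ᵥ dom Z (j + 1) v) := by
  have h := hasDerivAt_om_line Z v (j + 2)
  simp only [om_add_two] at h
  have h3 := hasDerivAt_mulVec (A := fun t : ℂ => symMat (toSeq (Z + t • v) j))
    (A' := symMat (toSeq v j)) (t := 0) (fun a b => by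
      have : HasDerivAt (fun t : ℂ => symMat (toSeq Z j) a b + t * symMat (toSeq v j) a b)
          (1 * symMat (toSeq v j) a b) 0 :=
        ((hasDerivAt_id (0 : ℂ)).mul_const _).const_add _
      simpa using! this) (hasDerivAt_om_line Z v (j + 1))
  have := h.unique ((hasDerivAt_om_line Z v j).add h3)
  simpa using this

/-- Chain rule: block l first influences `om (l + 2)`, through its product with `om (l + 1)`, and
`prop` carries this change onwards. -/
lemma dom_single (Z : Conf n K) {l : ℕ} (hl : l < K) (S : SymCoord n) (j : ℕ) :
    dom Z j (Pi.single ⟨l, hl⟩ S) =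
      prop (toSeq Z) l j *ᵥ (symMat S *ᵥ om (toSeq Z) (l + 1)) := by
  induction j using Nat.twoStepInduction with
  | zero => rw [dom_zero, prop, Matrix.zero_mulVec]
  | one => rw [dom_one, prop, Matrix.zero_mulVec]
  | more j h1 h2 =>
    rw [dom_add_two, h1, h2, prop_add_two, toSeq_single]
    by_cases h : j = l
    · subst h
      rw [Pi.single_eq_same, if_pos rfl]
      simp only [Matrix.add_mulVec, Matrix.one_mulVec, ← Matrix.mulVec_mulVec]
      abel
    · rw [Pi.single_eq_of_ne h, if_neg h]
      simp only [Matrix.add_mulVec, ← Matrix.mulVec_mulVec, symMat_zero, Matrix.zero_mulVec,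
        zero_add, add_zero]

lemma dom_proj (Z v : Conf n (K + 1)) {j : ℕ} (h : j ≤ K + 1) :
    dom (proj Z) j (proj v) = dom Z j v := by
  have h1 := hasDerivAt_om_line Z v j
  have h2 := hasDerivAt_om_line (proj Z) (proj v) j
  simp only [← proj_smul, ← proj_add, om_proj _ h] at h2
  exact h2.unique h1

lemma fderiv_Ptil_apply (Z v : Conf n K) (i : Fin n) :
    fderiv ℂ (fun W => Ptil n K W i) Z v = dom Z (K + 1) v i := by
  have h : HasFDerivAt (fun W : Conf n K => Ptil n K W i)
      ((ContinuousLinearMap.proj i).comp (dom Z (K + 1))) Z := by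
    simp only [Ptil_eq]
    exact (ContinuousLinearMap.proj (R := ℂ) (φ := fun _ : Fin n => ℂ) i).hasFDerivAt.comp Z
      (hasFDerivAt_om Z (K + 1))
  rw [h.fderiv]
  rfl

lemma fderiv_Ptil_proj_apply (Z v : Conf n (K + 1)) (i : Fin n) :
    fderiv ℂ (fun W : Conf n (K + 1) => Ptil n K (proj W) i) Z v = dom Z (K + 1) v i := by
  have h : HasFDerivAt (fun W : Conf n (K + 1) => Ptil n K (proj W) i)
      ((ContinuousLinearMap.proj i).comp (dom Z (K + 1))) Z := by
    simp only [Ptil_eq, om_proj _ le_rfl]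
    exact (ContinuousLinearMap.proj (R := ℂ) (φ := fun _ : Fin n => ℂ) i).hasFDerivAt.comp Z
      (hasFDerivAt_om Z (K + 1))
  rw [h.fderiv]
  rfl

lemma fderiv_Phi (Z v : Conf n K) : fderiv ℂ (Phi n K) Z v =
    if Even K then Sum.elim (dom Z K v) (dom Z (K + 1) v)
    else Sum.elim (dom Z (K + 1) v) (dom Z K v) := by
  have hd : HasDerivAt (fun t : ℂ => Z + t • v) v 0 := by
    simpa using ((hasDerivAt_id (0 : ℂ)).smul_const v).const_add Z
  have h1 : HasFDerivAt (Phi n K) (fderiv ℂ (Phi n K) Z) (Z + (0 : ℂ) • v) := by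
    simpa using (contDiff_Phi.differentiable (by simp) Z).hasFDerivAt
  have h2 := h1.comp_hasDerivAt 0 hd
  have h3 := hasDerivAt_pi.1 (hasDerivAt_om_line Z v K)
  have h4 := hasDerivAt_pi.1 (hasDerivAt_om_line Z v (K + 1))
  refine h2.unique (hasDerivAt_pi.2 fun a => ?_)
  simp only [Function.comp_def, Phi_eq]
  split_ifs <;> cases a <;> simp only [Sum.elim_inl, Sum.elim_inr] <;>
    first | exact h3 _ | exact h4 _

lemma fderiv_Phi_eq_zero_iff (Z v : Conf n K) :
    fderiv ℂ (Phi n K) Z v = 0 ↔ dom Z (K + 1) v = 0 ∧ dom Z K v = 0 := by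
  have h0 : (0 : Fin n ⊕ Fin n → ℂ) = Sum.elim (0 : Fin n → ℂ) (0 : Fin n → ℂ) := by
    funext a; cases a <;> rfl
  rw [fderiv_Phi, h0]
  split_ifs
  · rw [Sum.elim_eq_iff, and_comm]
  · rw [Sum.elim_eq_iff]

lemma fderiv_Phi_surjective_iff (Z : Conf n K) :
    Function.Surjective (fderiv ℂ (Phi n K) Z) ↔
      ∀ a b, ∃ v, dom Z (K + 1) v = a ∧ dom Z K v = b := by
  constructor
  · intro h a b
    obtain ⟨v, hv⟩ := h (if Even K then Sum.elim b a else Sum.elim a b)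
    refine ⟨v, ?_⟩
    rw [fderiv_Phi] at hv
    split_ifs at hv
    · exact (Sum.elim_eq_iff.1 hv).symm
    · exact Sum.elim_eq_iff.1 hv
  · intro h y
    obtain ⟨v, h1, h2⟩ := h (if Even K then y ∘ Sum.inr else y ∘ Sum.inl)
      (if Even K then y ∘ Sum.inl else y ∘ Sum.inr)
    refine ⟨v, ?_⟩
    rw [fderiv_Phi, h1, h2]
    split_ifs <;> simp

lemma dom_last (Z v : Conf n (K + 1)) : dom Z (K + 2) v = dom (proj Z) K (proj v) +
    (symMat (v (Fin.last K)) *ᵥ om (toSeq (proj Z)) (K + 1)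
      + symMat (Z (Fin.last K)) *ᵥ dom (proj Z) (K + 1) (proj v)) := by
  rw [dom_add_two, toSeq_last, toSeq_last, dom_proj Z v (by omega), dom_proj Z v le_rfl,
    om_proj Z le_rfl]

lemma om_last (Z : Conf n (K + 1)) : om (toSeq Z) (K + 2) = om (toSeq (proj Z)) K +
    symMat (Z (Fin.last K)) *ᵥ om (toSeq (proj Z)) (K + 1) := by
  rw [om_add_two, toSeq_last, om_proj Z (by omega), om_proj Z le_rfl]

end Derivative

/-! ### Principal fields with a smooth flow -/

section Good

variable {n K : ℕ}

lemma lift_mem_principal (hK : 2 ≤ K) {X : VField n K} (hX : X ∈ principal n K) :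
    lift X ∈ principal n (K + 1) := by
  obtain ⟨k, rfl⟩ := Nat.exists_eq_add_of_le' hK
  exact Or.inl (Or.inl ⟨X, hX, rfl⟩)

/-- The principal fields that are smooth, fiber-preserving, and have a smooth flow. -/
def goodFields (n K : ℕ) : Set (VField n K) :=
  {X | X ∈ principal n K ∧ ContDiff ℂ ∞ X ∧ FiberPreserving (Phi n K) X ∧
    ∃ fl, IsSmoothFlow X fl}

/-- The biholomorphic elements of `G_{V_K}` over `Φ_K`. -/
def symGroup (n K : ℕ) : Subgroup (Equiv.Perm (Conf n K)) :=
  preservingGroup (principal n K) (Phi n K)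

lemma differentiable_Phi : Differentiable ℂ (Phi n K) := contDiff_Phi.differentiable (by simp)

lemma fiberPreserving_iff {X : VField n K} : FiberPreserving (Phi n K) X ↔
    ∀ Z, dom Z (K + 1) (X Z) = 0 ∧ dom Z K (X Z) = 0 :=
  forall_congr' fun Z => fderiv_Phi_eq_zero_iff Z _

lemma contDiff_lift {X : VField n K} (hX : ContDiff ℂ ∞ X) : ContDiff ℂ ∞ (lift X) :=
  contDiff_extend (hX.comp contDiff_proj) contDiff_const

lemma fiberPreserving_lift {X : VField n K} (hX : FiberPreserving (Phi n K) X) :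
    FiberPreserving (Phi n (K + 1)) (lift X) := by
  rw [fiberPreserving_iff] at hX ⊢
  intro Z
  rw [show K + 1 + 1 = K + 2 from rfl, dom_last, ← dom_proj Z _ le_rfl, lift_apply, proj_extend,
    extend_last, (hX _).1, (hX _).2]
  simp

lemma lift_mem_goodFields (hK : 2 ≤ K) {X : VField n K} (hX : X ∈ goodFields n K) :
    lift X ∈ goodFields n (K + 1) := by
  obtain ⟨h1, h2, h3, fl, h4⟩ := hX
  exact ⟨lift_mem_principal hK h1, contDiff_lift h2, fiberPreserving_lift h3, _, isSmoothFlow_lift h4⟩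

lemma om_of_mem_symGroup {σ : Equiv.Perm (Conf n K)} (hσ : σ ∈ symGroup n K) (Z : Conf n K) :
    om (toSeq (σ Z)) (K + 1) = om (toSeq Z) (K + 1) ∧ om (toSeq (σ Z)) K = om (toSeq Z) K :=
  Phi_eq_Phi_iff.1 (hσ.2.2.2 Z)

lemma liftPerm_mem_symGroup (hK : 2 ≤ K) {σ : Equiv.Perm (Conf n K)} (hσ : σ ∈ symGroup n K) :
    liftPerm σ ∈ symGroup n (K + 1) := by
  refine ⟨?_, contDiff_liftPerm hσ.2.1, contDiff_liftPerm hσ.2.2.1, fun Z => ?_⟩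
  · have hle : (flowGroup (principal n K)).map liftPerm ≤ flowGroup (principal n (K + 1)) := by
      rw [flowGroup, MonoidHom.map_closure, Subgroup.closure_le]
      rintro _ ⟨σ, ⟨X, hX, t, ht⟩, rfl⟩
      exact Subgroup.subset_closure ⟨lift X, lift_mem_principal hK hX, t, isFlowMap_lift ht⟩
    exact hle ⟨σ, hσ.1, rfl⟩
  · have h := om_of_mem_symGroup hσ (proj Z)
    rw [Phi_eq_Phi_iff, show K + 1 + 1 = K + 2 from rfl, om_last, om_last, ← om_proj Z le_rfl,
      ← om_proj _ le_rfl, proj_liftPerm, h.1, h.2, liftPerm_apply, extend_last]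
    exact ⟨rfl, rfl⟩

lemma perm_mem_symGroup {X : VField n K} {fl : ℂ → Conf n K → Conf n K} (h : IsSmoothFlow X fl)
    (hX : X ∈ goodFields n K) (t : ℂ) : h.perm t ∈ symGroup n K :=
  h.perm_mem hX.1 differentiable_Phi hX.2.2.1 t

/-- The variation of the last block in the field `φ_{x,j}`. -/
def phiBlock (j : Fin n) (P u : Fin n → ℂ) : SymCoord n :=
  (∑ i ∈ Finset.univ.erase j, P i * u i - P j * u j) • unitCoord s(j, j)
    - P j • ∑ i ∈ Finset.univ.erase j, u i • unitCoord s(j, i)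

lemma phiBlock_smul (j : Fin n) (P u : Fin n → ℂ) (c : ℂ) :
    phiBlock j P (c • u) = c • phiBlock j P u := by
  simp only [phiBlock, smul_sub, smul_smul, Pi.smul_apply, smul_eq_mul, Finset.smul_sum]
  congr 2
  · rw [mul_sub, Finset.mul_sum]
    congr 1
    · exact Finset.sum_congr rfl fun i _ => by ring
    · ring
  · funext i
    rw [mul_left_comm]

/-- The reason for the shape of φ: the last block moves so that its action on P cancels the term
P_j² u coming from the earlier blocks. -/
lemma symMat_phiBlock_mulVec (j : Fin n) (P u : Fin n → ℂ) :
    symMat (phiBlock j P u) *ᵥ P = -(P j ^ 2) • u := by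
  have h : ∀ i ∈ Finset.univ.erase j, u i • (symMat (unitCoord s(j, i)) *ᵥ P) =
      (u i * P i) • Pi.single j 1 + (u i * P j) • Pi.single i 1 := by
    intro i hi
    rw [symMat_unitCoord_mulVec, if_neg (Finset.ne_of_mem_erase hi).symm, smul_add]
    congr 1 <;> rw [← Pi.single_smul, ← Pi.single_smul] <;> simp
  rw [phiBlock, symMat_sub, symMat_smul, symMat_smul, symMat_sum, Matrix.sub_mulVec,
    Matrix.smul_mulVec, Matrix.smul_mulVec, Matrix.sum_mulVec]
  simp only [symMat_smul, Matrix.smul_mulVec]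
  rw [Finset.sum_congr rfl h, symMat_unitCoord_mulVec, if_pos rfl]
  funext a
  simp only [Pi.sub_apply, Pi.smul_apply, smul_eq_mul, Finset.sum_apply, Pi.add_apply,
    Pi.single_apply, Finset.sum_add_distrib]
  by_cases ha : a = j
  · subst ha
    have : ∑ i ∈ Finset.univ.erase a, u i * P a * (if a = i then 1 else 0) = 0 :=
      Finset.sum_eq_zero fun i hi => by rw [if_neg (Finset.ne_of_mem_erase hi).symm, mul_zero]
    rw [this]
    simp only [if_true, mul_one, add_zero, mul_comm (u _) (P _)]
    ring
  · simp only [if_neg ha, mul_zero, Finset.sum_const_zero, zero_add, mul_ite, mul_one, zero_sub]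
    rw [Finset.sum_ite_eq, if_pos (Finset.mem_erase.2 ⟨ha, Finset.mem_univ _⟩)]
    ring

lemma contDiff_phiBlock {E : Type*} [NormedAddCommGroup E] [NormedSpace ℂ E] (j : Fin n)
    {P u : E → Fin n → ℂ} (hP : ContDiff ℂ ∞ P) (hu : ContDiff ℂ ∞ u) :
    ContDiff ℂ ∞ fun p => phiBlock j (P p) (u p) := by
  have hP := contDiff_pi.1 hP
  have hu := contDiff_pi.1 hu
  unfold phiBlock
  refine ContDiff.sub (ContDiff.smul (ContDiff.sub (ContDiff.sum fun i _ => (hP i).mul (hu i))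
    ((hP j).mul (hu j))) contDiff_const) ((hP j).smul (ContDiff.sum fun i _ => ?_))
  exact (hu i).smul contDiff_const

lemma newDir_eq (i j : Fin n) : newDir K i j = extend 0 (unitCoord s(i, j)) := by
  refine conf_ext ?_ ?_
  · funext k
    simp [newDir, coordDir, proj]
  · simp [newDir, coordDir]

lemma extend_zero_sum {ι : Type*} (s : Finset ι) (S : ι → SymCoord n) :
    ∑ i ∈ s, extend (0 : Conf n K) (S i) = extend 0 (∑ i ∈ s, S i) := by
  classical
  induction s using Finset.induction_on with
  | empty => exact conf_ext (by funext k; simp [proj]) (by simp)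
  | insert a s ha ih => rw [Finset.sum_insert ha, Finset.sum_insert ha, ih, extend_add, add_zero]

lemma phiField_eq (x : Fin (n + 1) → Fin (K + 1) × Sym2 (Fin n)) (j : Fin n) (Z : Conf n (K + 2)) :
    phiField n K x j Z = extend
      ((om (toSeq (proj Z)) (K + 2) j) ^ 2 • detField n (K + 1) x (proj Z))
      (phiBlock j (om (toSeq (proj Z)) (K + 2))
        (dom (proj Z) (K + 1) (detField n (K + 1) x (proj Z)))) := by
  have hu : uFun n K x (proj Z) = dom (proj Z) (K + 1) (detField n (K + 1) x (proj Z)) :=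
    funext fun i => fderiv_Ptil_proj_apply _ _ i
  simp only [phiField, hu, Ptil_eq, newDir_eq, lift_apply, smul_extend, extend_zero_sum, smul_zero]
  rw [sub_eq_add_neg, ← neg_one_smul ℂ (extend _ _), smul_extend, extend_add, extend_add]
  congr 1
  · simp
  · rw [phiBlock]
    simp only [neg_one_smul, zero_add]
    abel

end Good

/-! ### The flow of `φ_{x,j}` -/

section PhiFlow

variable {n K : ℕ}

/-- `D` is a smooth field with smooth flow `fl` that annihilates `P̃^{K+1}`, and along whose flow the
derivative of `P̃^K` varies exponentially with rate `lam`. -/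
structure Admissible (D : VField n (K + 1)) (fl : ℂ → Conf n (K + 1) → Conf n (K + 1))
    (lam : Conf n (K + 1) → ℂ) : Prop where
  flow : IsSmoothFlow D fl
  smooth : ContDiff ℂ ∞ D
  annihilates : ∀ p, dom p (K + 2) (D p) = 0
  smooth_lam : ContDiff ℂ ∞ lam
  lam_flow : ∀ s p, lam (fl s p) = lam p
  exp_law : ∀ s p, dom (fl s p) (K + 1) (D (fl s p)) =
    Complex.exp (-(lam p * s)) • dom p (K + 1) (D p)

namespace Admissible

variable {D : VField n (K + 1)} {fl : ℂ → Conf n (K + 1) → Conf n (K + 1)}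
  {lam : Conf n (K + 1) → ℂ}

lemma const_smul (h : Admissible D fl lam) (c : ℂ) :
    Admissible (c • D) (fun t => fl (c * t)) (fun p => c * lam p) where
  flow := h.flow.const_smul c
  smooth := contDiff_const.smul h.smooth
  annihilates p := by simp [h.annihilates]
  smooth_lam := contDiff_const.mul h.smooth_lam
  lam_flow s p := by rw [h.lam_flow]
  exp_law s p := by
    simp only [Pi.smul_apply, map_smul, h.exp_law]
    rw [smul_comm, show c * lam p * s = lam p * (c * s) by ring]

/-- The velocity of the vector is e^{-λs} times its initial value, and `s * expQuot (λ * s)` is the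
primitive of the exponential that vanishes at 0. -/
lemma om_flow_of_exp_law (h : Admissible D fl lam) {j : ℕ} {p : Conf n (K + 1)}
    (hj : ∀ s, dom (fl s p) j (D (fl s p)) = Complex.exp (-(lam p * s)) • dom p j (D p)) (s : ℂ) :
    om (toSeq (fl s p)) j = om (toSeq p) j + (s * expQuot (lam p * s)) • dom p j (D p) := by
  have h1 : ∀ s, HasDerivAt (fun s => om (toSeq (fl s p)) j
      - (s * expQuot (lam p * s)) • dom p j (D p)) 0 s := fun s => by
    have e1 := hasDerivAt_om_curve (h.flow.curve p s) j
    rw [hj] at e1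
    have e2 := (hasDerivAt_mul_expQuot (lam p) s).smul_const (dom p j (D p))
    simpa using e1.fun_sub e2
  have h2 := is_const_of_deriv_eq_zero (fun s => (h1 s).differentiableAt) (fun s => (h1 s).deriv) s 0
  simp only [zero_mul, zero_smul, sub_zero, h.flow.zero] at h2
  rw [← h2, sub_add_cancel]

lemma om_top (h : Admissible D fl lam) (s : ℂ) (p : Conf n (K + 1)) :
    om (toSeq (fl s p)) (K + 2) = om (toSeq p) (K + 2) := by
  have := h.om_flow_of_exp_law (j := K + 2) (p := p) (fun s => by simp [h.annihilates]) s
  simpa [h.annihilates] using this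

/-- The flow of `φ_{x,j}` over the flow of `∂_x`. -/
def _root_.SymplecticSpray.phiFlow (D : VField n (K + 1))
    (fl : ℂ → Conf n (K + 1) → Conf n (K + 1)) (lam : Conf n (K + 1) → ℂ) (j : Fin n) (t : ℂ)
    (Z : Conf n (K + 2)) : Conf n (K + 2) :=
  extend (fl ((om (toSeq (proj Z)) (K + 2) j) ^ 2 * t) (proj Z))
    (Z (Fin.last _) + (t * expQuot (lam (proj Z) * (om (toSeq (proj Z)) (K + 2) j) ^ 2 * t)) •
      phiBlock j (om (toSeq (proj Z)) (K + 2)) (dom (proj Z) (K + 1) (D (proj Z))))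

/-- The flow maps `fl t p` depend smoothly on `(t, p)`. -/
def _root_.SymplecticSpray.JointlySmooth (fl : ℂ → Conf n (K + 1) → Conf n (K + 1)) : Prop :=
  ∀ c : Conf n (K + 1) → ℂ, ContDiff ℂ ∞ c → ContDiff ℂ ∞ fun p => fl (c p) p

lemma contDiff_dom_apply {D : VField n K} (hD : ContDiff ℂ ∞ D) (j : ℕ) :
    ContDiff ℂ ∞ fun p => dom p j (D p) := by
  have : ContDiff ℂ ∞ fun p : Conf n K => dom p j := by
    unfold dom
    exact (contDiff_om j).fderiv_right (m := ∞) (by simp)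
  exact this.clm_apply hD

/-- P̃^{K+1} is constant along `fl`, so the factor P_j² merely rescales time by an amount that
depends on the point, whence the need for joint smoothness. Since `phiBlock` is linear in u and u
decays exponentially, the last block is integrated by `expQuot`. -/
lemma isSmoothFlow_phi (h : Admissible D fl lam) (hfl : JointlySmooth fl)
    {x : Fin (n + 1) → Fin (K + 1) × Sym2 (Fin n)} (hx : detField n (K + 1) x = D) (j : Fin n) :
    IsSmoothFlow (phiField n K x j) (phiFlow D fl lam j) where
  zero Z := by
    simp [phiFlow, h.flow.zero]
  neg t Z := by
    simp only [phiFlow, proj_extend, extend_last, h.om_top, h.lam_flow, h.exp_law]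
    refine conf_ext ?_ ?_
    · rw [proj_extend, mul_neg, h.flow.neg]
    · rw [extend_last, phiBlock_smul, smul_smul, add_assoc, ← add_smul, mul_neg]
      set c := lam (proj Z) * om (toSeq (proj Z)) (K + 2) j ^ 2 * t with hc
      rw [show lam (proj Z) * (om (toSeq (proj Z)) (K + 2) j ^ 2 * t) = c by rw [hc]; ring,
        neg_mul, neg_mul, mul_assoc, expQuot_neg, add_neg_cancel, zero_smul, add_zero]
  smooth t := by
    have hP : ContDiff ℂ ∞ fun Z : Conf n (K + 2) => om (toSeq (proj Z)) (K + 2) :=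
      (contDiff_om (K + 2)).comp contDiff_proj
    have hPj := contDiff_pi.1 hP j
    have hl : ContDiff ℂ ∞ fun Z : Conf n (K + 2) => lam (proj Z) := h.smooth_lam.comp contDiff_proj
    have hu : ContDiff ℂ ∞ fun Z : Conf n (K + 2) => dom (proj Z) (K + 1) (D (proj Z)) :=
      (contDiff_dom_apply h.smooth (K + 1)).comp contDiff_proj
    refine contDiff_extend ?_ (ContDiff.add (contDiff_apply ℂ (SymCoord n) (Fin.last (K + 1)))
      (ContDiff.smul (contDiff_const.mul (contDiff_expQuot.comp
        ((hl.mul (hPj.pow 2)).mul contDiff_const))) (contDiff_phiBlock j hP hu)))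
    have hc : ContDiff ℂ ∞ fun p : Conf n (K + 1) => om (toSeq p) (K + 2) j ^ 2 * t :=
      ((contDiff_pi.1 (contDiff_om (K + 2)) j).pow 2).mul contDiff_const
    exact (hfl _ hc).comp contDiff_proj
  curve Z t := by
    rw [phiField_eq, hx]
    simp only [phiFlow, proj_extend, h.om_top, h.exp_law]
    set c := om (toSeq (proj Z)) (K + 2) j ^ 2 with hc
    refine hasDerivAt_extend ?_ ?_
    · have := (h.flow.curve (proj Z) (c * t)).scomp t ((hasDerivAt_id t).const_mul c)
      simpa [Function.comp_def] using this
    · rw [phiBlock_smul, ← mul_assoc]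
      exact ((hasDerivAt_mul_expQuot (lam (proj Z) * c) t).smul_const _).const_add _

lemma phiField_mem_goodFields {K : ℕ} {D : VField n (K + 2)}
    {fl : ℂ → Conf n (K + 2) → Conf n (K + 2)} {lam : Conf n (K + 2) → ℂ}
    (h : Admissible D fl lam) (hfl : JointlySmooth fl)
    {x : Fin (n + 1) → Fin (K + 2) × Sym2 (Fin n)} (hx : detField n (K + 2) x = D)
    (hxt : x ∈ tuples n (K + 2)) (j : Fin n) :
    phiField n (K + 1) x j ∈ goodFields n (K + 3) := by
  refine ⟨Or.inl (Or.inr ⟨x, ⟨hxt, hx ▸ h.flow.complete⟩, j, rfl⟩), ?_, ?_,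
    _, h.isSmoothFlow_phi hfl hx j⟩
  · have : phiField n (K + 1) x j = fun Z => extend
        ((om (toSeq (proj Z)) (K + 3) j) ^ 2 • D (proj Z))
        (phiBlock j (om (toSeq (proj Z)) (K + 3)) (dom (proj Z) (K + 2) (D (proj Z)))) := by
      funext Z
      rw [phiField_eq, hx]
    rw [this]
    have hP : ContDiff ℂ ∞ fun Z : Conf n (K + 3) => om (toSeq (proj Z)) (K + 3) :=
      (contDiff_om (K + 3)).comp contDiff_proj
    exact contDiff_extend (((contDiff_pi.1 hP j).pow 2).smul (h.smooth.comp contDiff_proj))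
      (contDiff_phiBlock j hP ((contDiff_dom_apply h.smooth (K + 2)).comp contDiff_proj))
  · rw [fiberPreserving_iff]
    intro Z
    have h1 : dom (proj Z) (K + 3) (proj (phiField n (K + 1) x j Z)) = 0 := by
      rw [phiField_eq, hx, proj_extend, map_smul, h.annihilates, smul_zero]
    refine ⟨?_, by rw [← dom_proj Z _ le_rfl, h1]⟩
    -- The term with the unmoved last block is gone by `h1`; what remains is P_j² u from the earlier
    -- blocks and -P_j² u from `phiBlock`.
    rw [show K + 3 + 1 = (K + 2) + 2 from rfl, dom_last, h1, Matrix.mulVec_zero, add_zero,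
      phiField_eq, hx, proj_extend, extend_last, symMat_phiBlock_mulVec, map_smul, neg_smul]
    exact add_neg_cancel _

end Admissible

end PhiFlow

/-! ### Determinantal fields -/

section Det

variable {n K : ℕ}

lemma coordDir_apply (a : Fin K × Sym2 (Fin n)) (k : Fin K) (s : Sym2 (Fin n)) :
    (coordDir a : Conf n K) k s = if a = (k, s) then 1 else 0 := by
  obtain ⟨b, c⟩ := a
  by_cases h : b = k
  · subst h
    by_cases hc : c = s
    · subst hc; simp [coordDir]
    · simp [coordDir, hc, Ne.symm hc]
  · simp [coordDir, h, Ne.symm h]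

lemma detField_cons (x₀ : Fin K × Sym2 (Fin n)) (y : Fin n → Fin K × Sym2 (Fin n)) (Z : Conf n K)
    {J : Matrix (Fin n) (Fin n) ℂ} {h : Fin n → ℂ}
    (hJ : ∀ i r, J i r = dom Z (K + 1) (coordDir (y r)) i)
    (hh : h = dom Z (K + 1) (coordDir x₀)) :
    detField n K (Fin.cons x₀ y) Z =
      J.det • coordDir x₀ - ∑ r, (J.adjugate *ᵥ h) r • coordDir (y r) := by
  funext k s
  have hrow : (fun (i : Fin n) (r : Fin (n + 1)) =>
      fderiv ℂ (fun W => Ptil n K W i) Z (coordDir ((Fin.cons x₀ y : Fin (n + 1) → _) r))) =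
      fun i => Matrix.vecCons (h i) (J i) := by
    funext i r
    rw [fderiv_Ptil_apply]
    refine Fin.cases ?_ (fun r => ?_) r
    · simp [hh]
    · simp [hJ]
  simp only [detField]
  rw [hrow, det_bordered]
  simp [coordDir_apply, mul_comm]

lemma detField_comp_perm (x : Fin (n + 1) → Fin K × Sym2 (Fin n)) (σ : Equiv.Perm (Fin (n + 1))) :
    detField n K (x ∘ σ) = ((Equiv.Perm.sign σ : ℤ) : ℂ) • detField n K x := by
  funext Z k s
  simp only [detField, Pi.smul_apply, smul_eq_mul, Function.comp_apply]
  rw [← Matrix.det_permute']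
  congr 1
  ext i r
  refine Fin.cases ?_ (fun i => ?_) i <;> simp

/-- In `CrossData` the diagonal variable belongs to the later block, so a monotone tuple lists it
last, while the bordered expansion wants it first. The constant is the sign of the rotation. -/
lemma exists_detField_snoc (x₀ : Fin K × Sym2 (Fin n)) (y : Fin n → Fin K × Sym2 (Fin n)) :
    ∃ ε : ℂ, ε ≠ 0 ∧ detField n K (Fin.snoc (α := fun _ => Fin K × Sym2 (Fin n)) y x₀) =
      ε • detField n K (Fin.cons x₀ y) := by
  refine ⟨((Equiv.Perm.sign (finRotate (n + 1)) : ℤ) : ℂ), by simp, ?_⟩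
  rw [← detField_comp_perm, Fin.snoc_eq_cons_rotate]
  rfl

end Det

/-! ### The field of one diagonal variable and a row of variables of an earlier block -/

section CrossField

variable {n K : ℕ}

/-- The data of a row `m` of block `l` and a diagonal entry `i` of a later block `k`. -/
structure CrossData (n K : ℕ) where
  l : ℕ
  k : ℕ
  hlk : l < k
  hk : k < K
  m : Fin n
  i : Fin n

namespace CrossData

variable (c : CrossData n K) (p : Conf n K)

lemma hl : c.l < K := c.hlk.trans c.hk

/-- The diagonal variable. -/
def diagVar : Fin K × Sym2 (Fin n) := (⟨c.k, c.hk⟩, s(c.i, c.i))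

/-- The variables of the row. -/
def rowVar (r : Fin n) : Fin K × Sym2 (Fin n) := (⟨c.l, c.hl⟩, s(c.m, r))

/-- The tuple, with the diagonal variable last. -/
def tuple : Fin (n + 1) → Fin K × Sym2 (Fin n) :=
  Fin.snoc (α := fun _ => Fin K × Sym2 (Fin n)) c.rowVar c.diagVar

lemma tuple_mem : c.tuple ∈ tuples n K := by
  have hne : ∀ r, c.rowVar r ≠ c.diagVar := fun r h => by
    have := congrArg (fun a => (a.1 : ℕ)) h
    simp only [rowVar, diagVar] at this
    exact c.hlk.ne this
  refine ⟨?_, ?_⟩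
  · rw [tuple, Fin.snoc_injective_iff]
    refine ⟨fun r r' h => ?_, fun ⟨r, hr⟩ => hne r hr⟩
    have := congrArg Prod.snd h
    simp only [rowVar] at this
    exact Sym2.congr_right.1 this
  · intro a b hab
    revert hab
    refine Fin.lastCases ?_ (fun b => ?_) b
    · intro _
      refine Fin.lastCases ?_ (fun a => ?_) a
      · exact le_rfl
      · simp only [tuple, Fin.snoc_castSucc, Fin.snoc_last]
        exact c.hlk.le
    · refine Fin.lastCases ?_ (fun a => ?_) a
      · intro h
        exact absurd h (not_le.2 (Fin.castSucc_lt_last b))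
      · intro _
        simp only [tuple, Fin.snoc_castSucc]
        exact le_rfl

/-- The derivative of `S ↦ S v` along the row, `v` being the vector that block `l` acts on. -/
def star : Matrix (Fin n) (Fin n) ℂ := starMat c.m (om (toSeq p) (c.l + 1))

/-- The Jacobian of `P̃^K` with respect to the row. -/
def jac : Matrix (Fin n) (Fin n) ℂ := prop (toSeq p) c.l (K + 1) * c.star p

/-- The factor of the diagonal variable in `P̃^K`, as a vector. -/
def diagVec : Fin n → ℂ := prop (toSeq p) c.k (K + 1) *ᵥ Pi.single c.i 1

/-- The entry of the vector that the diagonal variable multiplies. -/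
def coef : ℂ := om (toSeq p) (c.k + 1) c.i

/-- The derivative of `coef` along the row. -/
def coefRow : Fin n → ℂ := (prop (toSeq p) c.l (c.k + 1) * c.star p) c.i

/-- The direction of the row component of the field. -/
def dir : Fin n → ℂ := (c.jac p).adjugate *ᵥ c.diagVec p

/-- The rate of growth along the flow. -/
def rate : ℂ := c.coefRow p ⬝ᵥ c.dir p

/-- The vector with diagonal component `s` and row components `η`. -/
def vec (s : ℂ) (η : Fin n → ℂ) : Conf n K :=
  Pi.single ⟨c.l, c.hl⟩ (∑ r, η r • unitCoord s(c.m, r)) +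
    Pi.single ⟨c.k, c.hk⟩ (s • unitCoord s(c.i, c.i))

/-- The field, with the sign for which the diagonal variable comes first. -/
def field : VField n K := fun p => c.vec (c.jac p).det (-(c.coef p) • c.dir p)

lemma toSeq_vec (s : ℂ) (η : Fin n → ℂ) :
    toSeq (c.vec s η) = crossPert c.l c.k c.m c.i s η := by
  rw [vec, map_add, toSeq_single, toSeq_single, crossPert]

lemma vec_eq_coordDir (s : ℂ) (η : Fin n → ℂ) :
    c.vec s η = s • coordDir c.diagVar + ∑ r, η r • coordDir (c.rowVar r) := by
  rw [vec, add_comm]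
  congr 1
  · simp only [coordDir, diagVar, unitCoord, ← Pi.single_smul]
  · simp only [coordDir, ← Pi.single_smul, rowVar]
    exact map_sum (LinearMap.single ℂ (fun _ : Fin K => SymCoord n) (⟨c.l, c.hl⟩ : Fin K)) _ _

lemma detField_cons_eq : detField n K (Fin.cons c.diagVar c.rowVar) = c.field := by
  funext p
  rw [detField_cons (J := c.jac p) (h := c.coef p • c.diagVec p), field, vec_eq_coordDir,
    sub_eq_add_neg, ← Finset.sum_neg_distrib]
  · congr 1
    refine Finset.sum_congr rfl fun r _ => ?_
    rw [Matrix.mulVec_smul, dir, ← neg_smul]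
    simp
  · intro i r
    have := congrFun (dom_single p c.hl (unitCoord s(c.m, r)) (K + 1)) i
    exact this.symm
  · have := dom_single p c.hk (unitCoord s(c.i, c.i)) (K + 1)
    rw [symMat_unitCoord_mulVec, if_pos rfl] at this
    refine Eq.trans ?_ this.symm
    rw [diagVec, coef, ← Matrix.mulVec_smul, ← Pi.single_smul]
    simp

/-! ### Behavior of the ingredients of the field under the perturbation -/

section Shift

variable (s : ℂ) (η : Fin n → ℂ)

lemma star_shift : c.star (p + c.vec s η) = c.star p := by
  have := c.hlk
  rw [star, star, map_add, toSeq_vec, om_add_crossPert c.hlk, prop_of_lt _ (l := c.l) (by omega),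
    prop_of_lt _ (l := c.k) (by omega)]
  simp only [Matrix.zero_mulVec, smul_zero, add_zero]

lemma diagVec_shift : c.diagVec (p + c.vec s η) = c.diagVec p := by
  rw [diagVec, diagVec, map_add, toSeq_vec, prop_add_crossPert_right c.hlk]

lemma coef_shift : c.coef (p + c.vec s η) = c.coef p + c.coefRow p ⬝ᵥ η := by
  rw [coef, coef, map_add, toSeq_vec, om_add_crossPert c.hlk,
    prop_of_lt _ (l := c.k) (by omega), Matrix.mulVec_mulVec]
  simp [coefRow, Matrix.mulVec, star]

lemma coefRow_shift : c.coefRow (p + c.vec s η) = c.coefRow p := by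
  rw [coefRow, coefRow, star_shift, map_add, toSeq_vec, prop_add_crossPert_left c.hlk,
    prop_of_lt _ (l := c.k) (by omega), Matrix.zero_mulVec, Matrix.zero_vecMulVec, smul_zero,
    add_zero]

lemma coefRow_eq : c.coefRow p = prop (toSeq p) c.l (c.k + 1) c.i ᵥ* c.star p := by
  rw [coefRow, Matrix.mul_apply_eq_vecMul]

lemma jac_shift : c.jac (p + c.vec s η) = c.jac p +
    Matrix.vecMulVec (c.diagVec p) (s • c.coefRow p) := by
  rw [jac, jac, star_shift, map_add, toSeq_vec, prop_add_crossPert_left c.hlk, add_mul,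
    Matrix.smul_mul, Matrix.vecMulVec_mul, ← coefRow_eq, diagVec, Matrix.vecMulVec_smul]

/-- The Jacobian changes by a rank one matrix with column `diagVec`, which the adjugate applied to
`diagVec` does not notice. -/
lemma dir_shift : c.dir (p + c.vec s η) = c.dir p := by
  rw [dir, jac_shift, diagVec_shift, adjugate_add_vecMulVec_mulVec, dir]

lemma rate_shift : c.rate (p + c.vec s η) = c.rate p := by
  rw [rate, dir_shift, coefRow_shift, rate]

lemma det_jac_shift : (c.jac (p + c.vec s η)).det = (c.jac p).det + s * c.rate p := by
  rw [jac_shift, det_add_vecMulVec, smul_dotProduct, smul_eq_mul, rate, dir]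

end Shift

/-- The derivative of `om · j` along the field, up to the factor `coef`. -/
def disp (j : ℕ) : Fin n → ℂ :=
  (c.jac p).det • (prop (toSeq p) c.k j *ᵥ Pi.single c.i 1)
    - prop (toSeq p) c.l j *ᵥ (c.star p *ᵥ c.dir p)

lemma dom_vec (s : ℂ) (η : Fin n → ℂ) (j : ℕ) : dom p j (c.vec s η) =
    prop (toSeq p) c.l j *ᵥ (c.star p *ᵥ η) +
      (s * c.coef p) • (prop (toSeq p) c.k j *ᵥ Pi.single c.i 1) := by
  rw [vec, map_add, dom_single, dom_single, star, starMat_mulVec]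
  congr 1
  rw [symMat_smul, Matrix.smul_mulVec, symMat_unitCoord_mulVec, if_pos rfl, mul_smul,
    Matrix.mulVec_smul, ← Matrix.mulVec_smul, ← Matrix.mulVec_smul, ← Matrix.mulVec_smul,
    ← Pi.single_smul (f := fun _ : Fin n => ℂ) c.i (c.coef p)]
  simp [coef]

lemma dom_field (j : ℕ) : dom p j (c.field p) = c.coef p • c.disp p j := by
  rw [field, dom_vec, disp, Matrix.mulVec_smul, Matrix.mulVec_smul, smul_sub, smul_smul, neg_smul,
    mul_comm]
  abel

/-- Cramer's rule: the row components are chosen to compensate the effect of the diagonal variable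
on P̃^K. -/
lemma disp_top : c.disp p (K + 1) = 0 := by
  have h : c.jac p *ᵥ c.dir p = (c.jac p).det • c.diagVec p := by
    rw [dir, Matrix.mulVec_mulVec, Matrix.mul_adjugate, Matrix.smul_mulVec, Matrix.one_mulVec]
  rw [disp, Matrix.mulVec_mulVec, ← jac, h, diagVec, sub_self]

/-- The determinant grows by s times the rate, and the rank one change of the propagation from block
l, applied to the row direction, produces exactly the same multiple of the diagonal column; the two
cancel. -/
lemma disp_shift (s : ℂ) (η : Fin n → ℂ) (j : ℕ) : c.disp (p + c.vec s η) j = c.disp p j := by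
  have h : prop (toSeq p) c.l (c.k + 1) c.i ⬝ᵥ (c.star p *ᵥ c.dir p) = c.rate p := by
    rw [Matrix.dotProduct_mulVec, ← coefRow_eq, rate]
  rw [disp, disp, det_jac_shift, dir_shift, star_shift, map_add, toSeq_vec,
    prop_add_crossPert_left c.hlk, prop_add_crossPert_right c.hlk, Matrix.add_mulVec,
    Matrix.smul_mulVec, Matrix.vecMulVec_mulVec, h]
  simp only [add_smul, op_smul_eq_smul, smul_smul]
  abel

/-- The flow of the field. -/
def fl (t : ℂ) (p : Conf n K) : Conf n K :=
  p + c.vec ((c.jac p).det * (t * expQuot (-c.rate p * t)))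
    (-(c.coef p * (t * expQuot (c.rate p * t))) • c.dir p)

lemma vec_add (s s' : ℂ) (η η' : Fin n → ℂ) :
    c.vec s η + c.vec s' η' = c.vec (s + s') (η + η') := by
  simp only [vec_eq_coordDir, add_smul, Pi.add_apply, Finset.sum_add_distrib]
  abel

lemma coef_fl (t : ℂ) : c.coef (c.fl t p) = c.coef p * Complex.exp (-(c.rate p * t)) := by
  rw [fl, coef_shift, dotProduct_smul, ← rate, smul_eq_mul]
  linear_combination -c.coef p * mul_expQuot (c.rate p * t)

lemma det_jac_fl (t : ℂ) : (c.jac (c.fl t p)).det = (c.jac p).det * Complex.exp (c.rate p * t) := by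
  have := mul_expQuot (-c.rate p * t)
  rw [neg_mul, neg_neg] at this
  rw [fl, det_jac_shift, neg_mul]
  linear_combination -(c.jac p).det * this

lemma contDiff_star (a b : Fin n) : ContDiff ℂ ∞ fun p => c.star p a b :=
  contDiff_starMat c.m (contDiff_om _) a b

lemma contDiff_jac (a b : Fin n) : ContDiff ℂ ∞ fun p => c.jac p a b :=
  contDiff_matrixMul (contDiff_prop _ _) c.contDiff_star a b

lemma contDiff_coef : ContDiff ℂ ∞ c.coef := contDiff_pi.1 (contDiff_om _) _

lemma contDiff_dir : ContDiff ℂ ∞ c.dir :=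
  contDiff_mulVec (contDiff_adjugate c.contDiff_jac)
    (contDiff_mulVec (contDiff_prop _ _) contDiff_const)

lemma contDiff_rate : ContDiff ℂ ∞ c.rate := by
  unfold rate dotProduct
  refine ContDiff.sum fun r _ => ContDiff.mul ?_ (contDiff_pi.1 c.contDiff_dir r)
  exact contDiff_matrixMul (contDiff_prop _ _) c.contDiff_star c.i r

lemma contDiff_vec {s : Conf n K → ℂ} {η : Conf n K → Fin n → ℂ} (hs : ContDiff ℂ ∞ s)
    (hη : ContDiff ℂ ∞ η) : ContDiff ℂ ∞ fun p => c.vec (s p) (η p) := by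
  simp only [vec_eq_coordDir]
  exact (hs.smul contDiff_const).add
    (ContDiff.sum fun r _ => (contDiff_pi.1 hη r).smul contDiff_const)

lemma contDiff_field : ContDiff ℂ ∞ c.field :=
  c.contDiff_vec (contDiff_det c.contDiff_jac) (c.contDiff_coef.neg.smul c.contDiff_dir)

lemma contDiff_fl {t : Conf n K → ℂ} (ht : ContDiff ℂ ∞ t) :
    ContDiff ℂ ∞ fun p => c.fl (t p) p :=
  contDiff_id.add (c.contDiff_vec
    ((contDiff_det c.contDiff_jac).mul (ht.mul (contDiff_expQuot.comp
      (c.contDiff_rate.neg.mul ht))))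
    ((c.contDiff_coef.mul (ht.mul (contDiff_expQuot.comp (c.contDiff_rate.mul ht)))).neg.smul
      c.contDiff_dir))

/-- With `dir` and `rate` constant, the system reduces to the scalar equations coef' = -rate · coef
and det' = rate · det. Their exponential solutions integrate to the two `expQuot` terms of `fl`. -/
lemma isSmoothFlow : IsSmoothFlow c.field c.fl where
  zero p := by simp [fl, vec]
  neg t p := by
    have hr : c.rate (c.fl t p) = c.rate p := c.rate_shift _ _ _
    have hd : c.dir (c.fl t p) = c.dir p := c.dir_shift _ _ _
    rw [fl, det_jac_fl, coef_fl, hr, hd, fl, add_assoc, vec_add, ← add_smul]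
    have h1 : (c.jac p).det * (t * expQuot (-c.rate p * t)) +
        (c.jac p).det * Complex.exp (c.rate p * t) * (-t * expQuot (-c.rate p * -t)) = 0 := by
      have := expQuot_neg (-(c.rate p * t))
      rw [neg_neg] at this
      rw [neg_mul_neg, neg_mul (c.rate p)]
      linear_combination -(c.jac p).det * t * this
    have h2 : -(c.coef p * (t * expQuot (c.rate p * t))) +
        -(c.coef p * Complex.exp (-(c.rate p * t)) * (-t * expQuot (c.rate p * -t))) = 0 := by
      have := expQuot_neg (c.rate p * t)
      rw [mul_neg]
      linear_combination c.coef p * t * this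
    rw [h1, h2]
    simp [vec]
  smooth t := c.contDiff_fl contDiff_const
  curve p t := by
    have hd : c.dir (c.fl t p) = c.dir p := c.dir_shift _ _ _
    rw [field, hd, det_jac_fl, coef_fl]
    simp only [fl, vec_eq_coordDir, Pi.smul_apply, smul_eq_mul]
    have h1 := (hasDerivAt_mul_expQuot (-c.rate p) t).const_mul (c.jac p).det
    rw [neg_mul, neg_neg] at h1
    have h2 := ((hasDerivAt_mul_expQuot (c.rate p) t).const_mul (c.coef p)).fun_neg
    exact ((h1.smul_const _).add (HasDerivAt.fun_sum fun r _ =>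
      (h2.mul_const (c.dir p r)).smul_const (coordDir (c.rowVar r)))).const_add p

end CrossData

lemma CrossData.exp_law (c : CrossData n K) (s : ℂ) (p : Conf n K) (j : ℕ) :
    dom (c.fl s p) j (c.field (c.fl s p)) =
      Complex.exp (-(c.rate p * s)) • dom p j (c.field p) := by
  rw [c.dom_field, c.dom_field, c.coef_fl, mul_comm, mul_smul]
  congr 2
  exact c.disp_shift _ _ _ _

lemma CrossData.admissible (c : CrossData n (K + 1)) : Admissible c.field c.fl c.rate where
  flow := c.isSmoothFlow
  smooth := c.contDiff_field
  annihilates p := by rw [c.dom_field, c.disp_top, smul_zero]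
  smooth_lam := c.contDiff_rate
  lam_flow _ _ := c.rate_shift _ _ _
  exp_law s p := c.exp_law s p _

end CrossField

/-! ### The flow maps of the fields `φ_{x,j}` -/

section Moves

variable {n K : ℕ}

lemma proj_phiFlow (D : VField n (K + 1)) (fl : ℂ → Conf n (K + 1) → Conf n (K + 1))
    (lam : Conf n (K + 1) → ℂ) (j : Fin n) (t : ℂ) (Z : Conf n (K + 2)) :
    proj (phiFlow D fl lam j t Z) = fl (om (toSeq (proj Z)) (K + 2) j ^ 2 * t) (proj Z) := by
  rw [phiFlow, proj_extend]

/-- The finite list consists of the flow maps of φ_{x,j} for all j at the times 1 and i. At a given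
point one takes j with P_j ≠ 0 and the time at which `expQuot` does not vanish. -/
lemma Admissible.exists_moves {D : VField n (K + 2)}
    {fl : ℂ → Conf n (K + 2) → Conf n (K + 2)} {lam : Conf n (K + 2) → ℂ}
    (h : Admissible D fl lam) (hfl : JointlySmooth fl)
    {x : Fin (n + 1) → Fin (K + 2) × Sym2 (Fin n)} {ε : ℂ} (hε : ε ≠ 0)
    (hx : detField n (K + 2) x = ε • D) (hxt : x ∈ tuples n (K + 2)) :
    ∃ F : Set (Equiv.Perm (Conf n (K + 3))), F.Finite ∧ F ⊆ symGroup n (K + 3) ∧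
      ∀ Z, om (toSeq Z) (K + 3) ≠ 0 → ∃ σ ∈ F, ∃ s, s * expQuot (lam (proj Z) * s) ≠ 0 ∧
        proj (σ Z) = fl s (proj Z) := by
  have h' := h.const_smul ε
  have hfl' : JointlySmooth fun t => fl (ε * t) := fun c hc => hfl _ (contDiff_const.mul hc)
  let g : Fin n × Bool → Equiv.Perm (Conf n (K + 3)) := fun a =>
    (h'.isSmoothFlow_phi hfl' hx a.1).perm (if a.2 then 1 else Complex.I)
  refine ⟨Set.range g, Set.finite_range g, ?_, fun Z hZ => ?_⟩
  · rintro _ ⟨a, rfl⟩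
    exact perm_mem_symGroup _ (h'.phiField_mem_goodFields hfl' hx hxt a.1) _
  · obtain ⟨j, hj⟩ := Function.ne_iff.1 hZ
    rw [← om_proj Z (by omega)] at hj
    set a := om (toSeq (proj Z)) (K + 3) j with ha
    have hc : ε * a ^ 2 ≠ 0 := mul_ne_zero hε (pow_ne_zero _ hj)
    have key : ∀ b : Bool, ∀ t : ℂ, t = (if b then 1 else Complex.I) → t ≠ 0 →
        expQuot (lam (proj Z) * (ε * a ^ 2) * t) ≠ 0 →
        ∃ σ ∈ Set.range g, ∃ s, s * expQuot (lam (proj Z) * s) ≠ 0 ∧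
          proj (σ Z) = fl s (proj Z) := by
      intro b t hbt ht hE
      refine ⟨g (j, b), ⟨_, rfl⟩, ε * (a ^ 2 * t), ?_, ?_⟩
      · have h1 : ε * (a ^ 2 * t) = ε * a ^ 2 * t := by ring
        have h2 : lam (proj Z) * (ε * a ^ 2 * t) = lam (proj Z) * (ε * a ^ 2) * t := by ring
        rw [h1, h2]
        exact mul_ne_zero (mul_ne_zero hc ht) hE
      · have h3 := proj_phiFlow (ε • D) (fun t => fl (ε * t)) (fun p => ε * lam p) j t Z
        rw [hbt] at h3 ⊢
        exact h3
    rcases expQuot_ne_zero_or (lam (proj Z) * (ε * a ^ 2)) with hE | hE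
    · exact key true 1 rfl one_ne_zero (by simpa using hE)
    · exact key false Complex.I rfl Complex.I_ne_zero hE

/-- The interior chain vectors are displaced along `disp`, by a nonzero amount as soon as the
coefficient is nonzero. The coefficient itself is only multiplied by an exponential, so it cannot
become zero on the way. -/
lemma CrossData.exists_moves (c : CrossData n (K + 2)) :
    ∃ F : Set (Equiv.Perm (Conf n (K + 3))), F.Finite ∧ F ⊆ symGroup n (K + 3) ∧
      ∀ Z, om (toSeq Z) (K + 3) ≠ 0 → ∃ σ ∈ F, ∃ τ : ℂ, τ ≠ 0 ∧
        (∀ j, j ≤ K + 3 → om (toSeq (σ Z)) j = om (toSeq Z) j +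
          (τ * om (toSeq Z) (c.k + 1) c.i) • c.disp (proj Z) j) ∧
        ∃ e : ℂ, e ≠ 0 ∧ om (toSeq (σ Z)) (c.k + 1) c.i = e * om (toSeq Z) (c.k + 1) c.i := by
  obtain ⟨ε, hε, hx⟩ := exists_detField_snoc c.diagVar c.rowVar
  rw [c.detField_cons_eq] at hx
  obtain ⟨F, hF, hFs, h⟩ := c.admissible.exists_moves (fun t ht => c.contDiff_fl ht) hε hx c.tuple_mem
  refine ⟨F, hF, hFs, fun Z hZ => ?_⟩
  obtain ⟨σ, hσ, s, hs, hp⟩ := h Z hZ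
  have hk := c.hk
  refine ⟨σ, hσ, _, hs, fun j hj => ?_, Complex.exp (-(c.rate (proj Z) * s)), Complex.exp_ne_zero _, ?_⟩
  · rw [← om_proj (σ Z) hj, hp,
      c.admissible.om_flow_of_exp_law (j := j) (fun s => c.exp_law s (proj Z) j), c.dom_field,
      om_proj Z hj, smul_smul, CrossData.coef, om_proj Z (by omega)]
  · have := c.coef_fl (proj Z) s
    rw [CrossData.coef, CrossData.coef, ← hp, om_proj _ (by omega), om_proj _ (by omega)] at this
    rw [this, mul_comm]

lemma CrossData.phi_mem_goodFields (c : CrossData n (K + 2)) (j : Fin n) :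
    ∃ X ∈ goodFields n (K + 3), ∃ ε : ℂ, ε ≠ 0 ∧ ∀ Z, X Z = extend
      ((om (toSeq Z) (K + 3) j) ^ 2 • ε • c.field (proj Z))
      (phiBlock j (om (toSeq Z) (K + 3)) (dom (proj Z) (K + 2) (ε • c.field (proj Z)))) := by
  obtain ⟨ε, hε, hx⟩ := exists_detField_snoc c.diagVar c.rowVar
  rw [c.detField_cons_eq] at hx
  refine ⟨_, (c.admissible.const_smul ε).phiField_mem_goodFields
    (fun t ht => c.contDiff_fl (contDiff_const.mul ht)) hx c.tuple_mem j, ε, hε, fun Z => ?_⟩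
  rw [phiField_eq]
  erw [hx]
  rw [om_proj Z (by omega)]
  rfl

end Moves

/-! ### The field of one variable of a block and a row of variables of the next block -/

section StarField

variable {n K : ℕ}

/-- A variable of the last block but one, whose direction has no component along `m`, and the row
`m` of the last block. -/
structure StarData (n K : ℕ) where
  k : ℕ
  hk : n = k + 2
  m : Fin n
  s₀ : Sym2 (Fin n)
  orth : ∀ p : Conf n (K + 2), (symMat (unitCoord s₀) *ᵥ om (toSeq p) (K + 1)) m = 0

namespace StarData

variable (c : StarData n K) (p : Conf n (K + 2))

/-- The counterpart of the diagonal variable of `CrossData`; here it need not be diagonal. -/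
def diagVar : Fin (K + 2) × Sym2 (Fin n) := (⟨K, by omega⟩, c.s₀)

def rowVar (r : Fin n) : Fin (K + 2) × Sym2 (Fin n) := (⟨K + 1, by omega⟩, s(c.m, r))

lemma tuple_mem : (Fin.cons c.diagVar c.rowVar : Fin (n + 1) → _) ∈ tuples n (K + 2) := by
  have hne : ∀ r, c.rowVar r ≠ c.diagVar := fun r h => by
    have := congrArg (fun a => (a.1 : ℕ)) h
    simp [rowVar, diagVar] at this
  refine ⟨?_, ?_⟩
  · rw [Fin.cons_injective_iff]
    refine ⟨fun ⟨r, hr⟩ => hne r hr, fun r r' h => ?_⟩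
    have := congrArg Prod.snd h
    simp only [rowVar] at this
    exact Sym2.congr_right.1 this
  · intro a b hab
    revert hab
    refine Fin.cases ?_ (fun a => ?_) a
    · refine Fin.cases ?_ (fun b => ?_) b
      · exact fun _ => le_rfl
      · intro _
        simp only [Fin.cons_zero, Fin.cons_succ]
        exact Nat.le_succ K
    · refine Fin.cases ?_ (fun b => ?_) b
      · intro h
        exact absurd h (not_le.2 (Fin.succ_pos a))
      · intro _
        simp only [Fin.cons_succ]
        exact le_rfl

/-- The direction in which the first variable moves `P̃^{K+1}`. -/
def del : Fin n → ℂ := symMat (unitCoord c.s₀) *ᵥ om (toSeq p) (K + 1)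

def zet : Fin n → ℂ := symMat (toSeq p (K + 1)) *ᵥ c.del p

/-- The entry of the vector that the row variables multiply. -/
def piv : ℂ := om (toSeq p) (K + 2) c.m

def jac : Matrix (Fin n) (Fin n) ℂ := starMat c.m (om (toSeq p) (K + 2))

/-- The row components of the field, up to sign. -/
def dir : Fin n → ℂ := (c.jac p).adjugate *ᵥ c.zet p

/-- The acceleration along the flow. -/
def acc : ℂ := c.piv p ^ (2 * c.k + 2) * (c.del p ⬝ᵥ c.zet p)

def vec (s : ℂ) (η : Fin n → ℂ) : Conf n (K + 2) :=
  s • coordDir c.diagVar + ∑ r, η r • coordDir (c.rowVar r)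

def field : VField n (K + 2) := fun p => c.vec (c.piv p ^ n) (-(c.dir p))

/-- Along the flow `piv` and `acc` are constant and `dir` changes at constant speed along e_m, so
the motion is quadratic in t. -/
def fl (t : ℂ) (p : Conf n (K + 2)) : Conf n (K + 2) :=
  p + c.vec (c.piv p ^ n * t) (-(t • c.dir p) + (t ^ 2 * c.acc p) • Pi.single c.m 1)

lemma vec_eq_single (s : ℂ) (η : Fin n → ℂ) : c.vec s η =
    Pi.single ⟨K, by omega⟩ (s • unitCoord c.s₀) +
      Pi.single ⟨K + 1, by omega⟩ (∑ r, η r • unitCoord s(c.m, r)) := by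
  rw [vec]
  congr 1
  · simp only [coordDir, diagVar, unitCoord, ← Pi.single_smul]
  · simp only [coordDir, ← Pi.single_smul, rowVar]
    exact (map_sum (LinearMap.single ℂ (fun _ : Fin (K + 2) => SymCoord n)
      (⟨K + 1, by omega⟩ : Fin (K + 2))) _ _).symm

lemma vec_add (s s' : ℂ) (η η' : Fin n → ℂ) :
    c.vec s η + c.vec s' η' = c.vec (s + s') (η + η') := by
  simp only [vec, add_smul, Pi.add_apply, Finset.sum_add_distrib]
  abel

lemma toSeq_vec_of_lt (s : ℂ) (η : Fin n → ℂ) {j : ℕ} (hj : j < K) : toSeq (c.vec s η) j = 0 := by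
  rw [vec_eq_single, map_add, toSeq_single, toSeq_single, Pi.add_apply,
    Pi.single_eq_of_ne (by omega), Pi.single_eq_of_ne (by omega), add_zero]

lemma toSeq_vec_fst (s : ℂ) (η : Fin n → ℂ) : toSeq (c.vec s η) K = s • unitCoord c.s₀ := by
  rw [vec_eq_single, map_add, toSeq_single, toSeq_single, Pi.add_apply, Pi.single_eq_same,
    Pi.single_eq_of_ne (by omega), add_zero]

lemma toSeq_vec_snd (s : ℂ) (η : Fin n → ℂ) :
    toSeq (c.vec s η) (K + 1) = ∑ r, η r • unitCoord s(c.m, r) := by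
  rw [vec_eq_single, map_add, toSeq_single, toSeq_single, Pi.add_apply, Pi.single_eq_same,
    Pi.single_eq_of_ne (by omega), zero_add]

lemma detField_cons_eq : detField n (K + 2) (Fin.cons c.diagVar c.rowVar) = c.field := by
  funext p
  rw [detField_cons (J := c.jac p) (h := c.zet p), field, vec, jac, det_starMat, ← piv, dir,
    sub_eq_add_neg, ← Finset.sum_neg_distrib]
  · congr 1
    refine Finset.sum_congr rfl fun r _ => ?_
    rw [← neg_smul, jac]
    rfl
  · intro i r
    have := congrFun (dom_single p (by omega : K + 1 < K + 2) (unitCoord s(c.m, r)) (K + 3)) i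
    rw [show K + 3 = K + 1 + 2 from rfl, prop_self, Matrix.one_mulVec] at this
    exact this.symm
  · have := dom_single p (by omega : K < K + 2) (unitCoord c.s₀) (K + 3)
    rw [prop_add_three] at this
    exact this.symm

/-! ### Behavior of the ingredients of the field under a move of the variable and the row -/

section Shift

variable (s : ℂ) (η : Fin n → ℂ)

lemma om_shift {j : ℕ} (hj : j ≤ K + 1) :
    om (toSeq (p + c.vec s η)) j = om (toSeq p) j :=
  om_congr fun k hk => by rw [map_add, Pi.add_apply, c.toSeq_vec_of_lt s η (by omega), add_zero]

lemma del_shift : c.del (p + c.vec s η) = c.del p := by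
  rw [del, del, c.om_shift _ _ _ le_rfl]

lemma om_shift_succ :
    om (toSeq (p + c.vec s η)) (K + 2) = om (toSeq p) (K + 2) + s • c.del p := by
  rw [om_add_two, om_add_two, c.om_shift _ _ _ (by omega), c.om_shift _ _ _ le_rfl, map_add,
    Pi.add_apply, toSeq_vec_fst, symMat_add, Matrix.add_mulVec, symMat_smul, Matrix.smul_mulVec,
    add_assoc, ← del]

lemma piv_shift : c.piv (p + c.vec s η) = c.piv p := by
  have : c.del p c.m = 0 := c.orth p
  rw [piv, om_shift_succ, Pi.add_apply, Pi.smul_apply, this, smul_zero, add_zero, piv]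

lemma zet_shift : c.zet (p + c.vec s η) = c.zet p + (c.del p ⬝ᵥ η) • Pi.single c.m 1 := by
  have : c.del p c.m = 0 := c.orth p
  rw [zet, zet, del_shift, map_add, Pi.add_apply, toSeq_vec_snd, symMat_add, Matrix.add_mulVec,
    ← starMat_mulVec, starMat_eq, this, zero_smul, zero_smul, zero_add, sub_zero,
    Matrix.vecMulVec_mulVec, op_smul_eq_smul]

/-- `zet` changes only along e_m, to which `del` is orthogonal by `orth`. -/
lemma acc_shift : c.acc (p + c.vec s η) = c.acc p := by
  have : c.del p c.m = 0 := c.orth p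
  rw [acc, acc, del_shift, zet_shift, piv_shift, dotProduct_add, dotProduct_smul,
    dotProduct_single, this]
  simp

lemma dir_shift : c.dir (p + c.vec s η) = c.dir p + (c.piv p ^ (c.k + 1) * (c.del p ⬝ᵥ η)
    - s * c.piv p ^ c.k * (c.del p ⬝ᵥ c.zet p)) • Pi.single c.m 1 := by
  have hd : c.del p c.m = 0 := c.orth p
  have hp : om (toSeq (p + c.vec s η)) (K + 2) c.m = c.piv p := c.piv_shift p s η
  rw [dir, dir, jac, jac, adjugate_starMat c.hk, adjugate_starMat c.hk, hp, om_shift_succ,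
    zet_shift, ← piv]
  simp only [Matrix.smul_mulVec, Matrix.sub_mulVec, Matrix.one_mulVec, Matrix.vecMulVec_mulVec,
    op_smul_eq_smul, Matrix.mulVec_add, Matrix.mulVec_smul, sub_dotProduct, add_dotProduct,
    smul_dotProduct, single_dotProduct, dotProduct_single,
    Pi.add_apply, Pi.sub_apply, Pi.smul_apply, smul_eq_mul, Pi.single_eq_same, hd]
  funext i
  simp only [Pi.add_apply, Pi.sub_apply, Pi.smul_apply, smul_eq_mul]
  simp only [piv]
  ring

end Shift

lemma del_dotProduct_dir : c.del p ⬝ᵥ c.dir p = c.piv p ^ (c.k + 1) * (c.del p ⬝ᵥ c.zet p) := by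
  have hd : c.del p c.m = 0 := c.orth p
  rw [dir, jac, adjugate_starMat c.hk, ← piv, Matrix.smul_mulVec, Matrix.sub_mulVec,
    Matrix.smul_mulVec, Matrix.one_mulVec, Matrix.vecMulVec_mulVec, op_smul_eq_smul,
    dotProduct_smul, dotProduct_sub, dotProduct_smul, dotProduct_smul, dotProduct_single, hd]
  simp only [smul_eq_mul]
  ring

lemma piv_fl (t : ℂ) : c.piv (c.fl t p) = c.piv p := c.piv_shift _ _ _

lemma acc_fl (t : ℂ) : c.acc (c.fl t p) = c.acc p := c.acc_shift _ _ _

lemma dir_fl (t : ℂ) : c.dir (c.fl t p) = c.dir p - (2 * t * c.acc p) • Pi.single c.m 1 := by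
  have hd : c.del p c.m = 0 := c.orth p
  rw [fl, dir_shift, dotProduct_add, dotProduct_neg, dotProduct_smul, dotProduct_smul,
    dotProduct_single, hd, del_dotProduct_dir, acc, sub_eq_add_neg (c.dir p)]
  congr 1
  rw [← neg_smul _ (Pi.single c.m 1 : Fin n → ℂ)]
  congr 1
  have : c.piv p ^ n = c.piv p ^ (c.k + 2) := congrArg (c.piv p ^ ·) c.hk
  rw [this]
  simp only [smul_eq_mul]
  ring

lemma contDiff_del : ContDiff ℂ ∞ c.del :=
  contDiff_mulVec (A := fun _ => symMat (unitCoord c.s₀)) (fun _ _ => contDiff_const) (contDiff_om _)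

lemma contDiff_zet : ContDiff ℂ ∞ c.zet :=
  contDiff_mulVec (contDiff_symMat _) c.contDiff_del

lemma contDiff_piv : ContDiff ℂ ∞ c.piv := contDiff_pi.1 (contDiff_om _) _

lemma contDiff_dir : ContDiff ℂ ∞ c.dir :=
  contDiff_mulVec (contDiff_adjugate (contDiff_starMat c.m (contDiff_om _))) c.contDiff_zet

lemma contDiff_acc : ContDiff ℂ ∞ c.acc := by
  unfold acc dotProduct
  exact (c.contDiff_piv.pow _).mul (ContDiff.sum fun r _ =>
    (contDiff_pi.1 c.contDiff_del r).mul (contDiff_pi.1 c.contDiff_zet r))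

lemma contDiff_vec {s : Conf n (K + 2) → ℂ} {η : Conf n (K + 2) → Fin n → ℂ}
    (hs : ContDiff ℂ ∞ s) (hη : ContDiff ℂ ∞ η) : ContDiff ℂ ∞ fun p => c.vec (s p) (η p) :=
  (hs.smul contDiff_const).add
    (ContDiff.sum fun r _ => (contDiff_pi.1 hη r).smul contDiff_const)

lemma contDiff_field : ContDiff ℂ ∞ c.field :=
  c.contDiff_vec (c.contDiff_piv.pow _) c.contDiff_dir.neg

lemma contDiff_fl {t : Conf n (K + 2) → ℂ} (ht : ContDiff ℂ ∞ t) :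
    ContDiff ℂ ∞ fun p => c.fl (t p) p :=
  contDiff_id.add (c.contDiff_vec ((c.contDiff_piv.pow _).mul ht)
    ((ht.smul c.contDiff_dir).neg.add (((ht.pow 2).mul c.contDiff_acc).smul contDiff_const)))

lemma isSmoothFlow : IsSmoothFlow c.field c.fl where
  zero p := by simp [fl, vec]
  neg t p := by
    rw [fl, dir_fl, piv_fl, acc_fl, fl, add_assoc, vec_add]
    have h1 : c.piv p ^ n * t + c.piv p ^ n * -t = 0 := by ring
    have h2 : -(t • c.dir p) + (t ^ 2 * c.acc p) • (Pi.single c.m 1 : Fin n → ℂ) +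
        (-(-t • (c.dir p - (2 * t * c.acc p) • Pi.single c.m 1)) +
          ((-t) ^ 2 * c.acc p) • Pi.single c.m 1) = 0 := by
      funext i
      simp only [Pi.add_apply, Pi.neg_apply, Pi.sub_apply, Pi.smul_apply, smul_eq_mul,
        Pi.zero_apply]
      ring
    rw [h1, h2]
    simp [vec]
  smooth t := c.contDiff_fl contDiff_const
  curve p t := by
    rw [field, dir_fl, piv_fl]
    simp only [fl, vec]
    refine HasDerivAt.const_add p (HasDerivAt.add ?_ (HasDerivAt.fun_sum fun r _ => ?_))
    · have := (hasDerivAt_id t).const_mul (c.piv p ^ n)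
      rw [mul_one] at this
      exact this.smul_const _
    · refine HasDerivAt.smul_const ?_ _
      simp only [Pi.add_apply, Pi.neg_apply, Pi.sub_apply, Pi.smul_apply, smul_eq_mul]
      have h1 := ((hasDerivAt_id t).mul_const (c.dir p r)).fun_neg
      have h2 := (((hasDerivAt_pow 2 t).mul_const (c.acc p)).mul_const
        ((Pi.single c.m 1 : Fin n → ℂ) r))
      refine (h1.add h2).congr_deriv ?_
      push_cast
      ring

lemma dom_vec {s : ℂ} {η : Fin n → ℂ} (j : ℕ) : dom p j (c.vec s η) =
    s • (prop (toSeq p) K j *ᵥ c.del p) + prop (toSeq p) (K + 1) j *ᵥ (c.jac p *ᵥ η) := by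
  rw [vec_eq_single, map_add, dom_single, dom_single, jac, starMat_mulVec, symMat_smul,
    Matrix.smul_mulVec, Matrix.mulVec_smul, del]

lemma dom_field : dom p (K + 2) (c.field p) = c.piv p ^ n • c.del p := by
  rw [field, dom_vec, prop_self, prop_of_lt _ (by omega), Matrix.one_mulVec, Matrix.zero_mulVec,
    add_zero]

lemma dom_field_top : dom p (K + 3) (c.field p) = 0 := by
  have h : c.jac p *ᵥ c.dir p = c.piv p ^ n • c.zet p := by
    rw [dir, Matrix.mulVec_mulVec, Matrix.mul_adjugate, Matrix.smul_mulVec, Matrix.one_mulVec, jac,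
      det_starMat, piv]
  rw [field, dom_vec, prop_add_three, show K + 3 = K + 1 + 2 from rfl, prop_self,
    Matrix.one_mulVec, Matrix.mulVec_neg, h, zet, add_neg_cancel]

lemma del_fl (t : ℂ) : c.del (c.fl t p) = c.del p := c.del_shift _ _ _

lemma admissible : Admissible c.field c.fl fun _ => 0 where
  flow := c.isSmoothFlow
  smooth := c.contDiff_field
  annihilates p := c.dom_field_top p
  smooth_lam := contDiff_const
  lam_flow _ _ := rfl
  exp_law s p := by rw [dom_field, dom_field, piv_fl, del_fl]; simp

/-- Here the rate is zero, so the velocity of `om (K + 2)` is constant. The move adds a multiple of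
a chosen vector to it and leaves all earlier vectors of the chain fixed. -/
lemma exists_moves :
    ∃ F : Set (Equiv.Perm (Conf n (K + 3))), F.Finite ∧ F ⊆ symGroup n (K + 3) ∧
      ∀ Z, om (toSeq Z) (K + 3) ≠ 0 → ∃ σ ∈ F, ∃ τ : ℂ, τ ≠ 0 ∧
        (∀ j, j ≤ K + 1 → om (toSeq (σ Z)) j = om (toSeq Z) j) ∧
        om (toSeq (σ Z)) (K + 2) = om (toSeq Z) (K + 2) +
          (τ * om (toSeq Z) (K + 2) c.m ^ n) •
            (symMat (unitCoord c.s₀) *ᵥ om (toSeq Z) (K + 1)) := by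
  obtain ⟨F, hF, hFs, h⟩ := c.admissible.exists_moves (fun t ht => c.contDiff_fl ht) one_ne_zero
    (by rw [c.detField_cons_eq, one_smul]) c.tuple_mem
  refine ⟨F, hF, hFs, fun Z hZ => ?_⟩
  obtain ⟨σ, hσ, s, hs, hp⟩ := h Z hZ
  have e0 : expQuot (0 * s) = 1 := by rw [zero_mul, expQuot_zero]
  refine ⟨σ, hσ, s, left_ne_zero_of_mul hs, fun j hj => ?_, ?_⟩
  · rw [← om_proj (σ Z) (by omega), hp, fl, om_shift _ _ _ _ hj, om_proj Z (by omega)]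
  · rw [← om_proj (σ Z) (by omega), hp, fl, om_shift_succ, om_proj Z (by omega), piv, del,
      om_proj Z (by omega), om_proj Z (by omega), mul_comm]

lemma phi_mem_goodFields (j : Fin n) :
    ∃ X ∈ goodFields n (K + 3), ∀ Z, X Z = extend
      ((om (toSeq Z) (K + 3) j) ^ 2 • c.field (proj Z))
      (phiBlock j (om (toSeq Z) (K + 3)) (dom (proj Z) (K + 2) (c.field (proj Z)))) := by
  refine ⟨_, c.admissible.phiField_mem_goodFields
    (fun t ht => c.contDiff_fl ht) c.detField_cons_eq c.tuple_mem j, fun Z => ?_⟩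
  rw [phiField_eq]
  erw [c.detField_cons_eq]
  rw [om_proj Z (by omega)]

end StarData

end StarField

/-! ### The fields `γ_{rs,j}` -/

section Gamma

variable {n K : ℕ}

/-- The variation of the last block in the field `γ_{rs,j}`. -/
def gammaBlock (r s j : Fin n) (P : Fin n → ℂ) : SymCoord n :=
  P j ^ 2 • unitCoord s(r, s) + (1 / (1 + if r = s then (1 : ℂ) else 0)) •
    ((2 * P r * P s) • unitCoord s(j, j) - (P r * P j) • unitCoord s(j, s)
      - (P s * P j) • unitCoord s(j, r))

/-- The variation is a symmetrized product of two vectors orthogonal to P, which explains why it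
annihilates P; the prefactor compensates the doubling when r = s. -/
lemma symMat_gammaBlock {r s j : Fin n} (hr : r ≠ j) (hs : s ≠ j) (P : Fin n → ℂ) :
    symMat (gammaBlock r s j P) = (1 / (1 + if r = s then (1 : ℂ) else 0)) •
      (Matrix.vecMulVec (orthVec P j r) (orthVec P j s)
        + Matrix.vecMulVec (orthVec P j s) (orthVec P j r)) := by
  have hE : ∀ a b : Fin n, Matrix.vecMulVec (Pi.single a (1 : ℂ)) (Pi.single b 1) =
      Matrix.single a b 1 := by
    intro a b
    ext c d
    simp only [Matrix.vecMulVec_apply, Matrix.single_apply, Pi.single_apply]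
    by_cases hc : c = a <;> by_cases hd : d = b <;>
      simp [hc, hd, eq_comm (a := a) (b := c), eq_comm (a := b) (b := d)]
  simp only [gammaBlock, symMat_add, symMat_sub, symMat_smul, symMat_unitCoord, if_neg hr.symm,
    if_neg hs.symm, if_true, orthVec, Matrix.sub_vecMulVec, Matrix.vecMulVec_sub,
    Matrix.smul_vecMulVec, Matrix.vecMulVec_smul, hE]
  by_cases hrs : r = s
  · subst hrs
    rw [if_pos rfl, if_pos rfl]
    module
  · rw [if_neg hrs, if_neg hrs]
    module

lemma symMat_gammaBlock_self {r j : Fin n} (hr : r ≠ j) (P : Fin n → ℂ) :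
    symMat (gammaBlock r r j P) = Matrix.vecMulVec (orthVec P j r) (orthVec P j r) := by
  rw [symMat_gammaBlock hr hr, if_pos rfl]
  module

lemma symMat_gammaBlock_mulVec {r s j : Fin n} (hr : r ≠ j) (hs : s ≠ j) (P : Fin n → ℂ) :
    symMat (gammaBlock r s j P) *ᵥ P = 0 := by
  rw [symMat_gammaBlock hr hs, Matrix.smul_mulVec, Matrix.add_mulVec, Matrix.vecMulVec_mulVec,
    Matrix.vecMulVec_mulVec, orthVec_dotProduct, orthVec_dotProduct]
  simp

/-- A symmetric matrix that annihilates `P` is a combination of the matrices of the `γ_{rs,j}`. -/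
lemma smul_eq_sum_gammaBlock (j : Fin n) (P : Fin n → ℂ) {z : SymCoord n}
    (hz : symMat z *ᵥ P = 0) : P j ^ 2 • z =
      ∑ r ∈ Finset.univ.erase j, ∑ s ∈ Finset.univ.erase j,
      (z s(r, s) * ((1 + if r = s then (1 : ℂ) else 0) / 2)) • gammaBlock r s j P := by
  apply symMat_injective
  rw [symMat_smul, symMat_sum]
  have hterm : ∀ r ∈ Finset.univ.erase j, symMat (∑ s ∈ Finset.univ.erase j,
      (z s(r, s) * ((1 + if r = s then (1 : ℂ) else 0) / 2)) • gammaBlock r s j P) =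
      ∑ s, (z s(r, s) / 2) • (Matrix.vecMulVec (orthVec P j r) (orthVec P j s)
        + Matrix.vecMulVec (orthVec P j s) (orthVec P j r)) := by
    intro r hr
    rw [symMat_sum, ← Finset.sum_erase (a := j) Finset.univ (by simp [orthVec])]
    refine Finset.sum_congr rfl fun s hs => ?_
    rw [symMat_smul, symMat_gammaBlock (Finset.ne_of_mem_erase hr) (Finset.ne_of_mem_erase hs),
      smul_smul]
    congr 1
    split_ifs
    · norm_num; ring
    · norm_num; ring
  rw [Finset.sum_congr rfl hterm, Finset.sum_erase (a := j) Finset.univ (by simp [orthVec])]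
  -- The columns of R are the vectors `orthVec P j r`. Since z annihilates P, R acts on z from the
  -- left, and its transpose from the right, as the scalar P_j; expanding R z Rᵀ gives the asserted
  -- sum.
  set R : Matrix (Fin n) (Fin n) ℂ := P j • 1 - Matrix.vecMulVec (Pi.single j 1) P with hR
  have hcol : ∀ a r, R a r = orthVec P j r a := by
    intro a r
    simp [hR, orthVec, Matrix.one_apply, Pi.single_apply, Matrix.vecMulVec_apply, mul_comm]
  have h1 : R * symMat z = P j • symMat z := by
    rw [hR, sub_mul, Matrix.smul_mul, Matrix.one_mul, Matrix.vecMulVec_mul,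
      ← Matrix.mulVec_transpose, (symMat_isSymm z).eq, hz]
    simp
  have h2 : symMat z * Rᵀ = P j • symMat z := by
    have := congrArg Matrix.transpose h1
    rwa [Matrix.transpose_mul, Matrix.transpose_smul, (symMat_isSymm z).eq] at this
  have h3 : R * symMat z * Rᵀ = P j ^ 2 • symMat z := by
    rw [h1, Matrix.smul_mul, h2, smul_smul, sq]
  have h4 : ∀ a b, (R * symMat z * Rᵀ) a b =
      ∑ r, ∑ s, z s(r, s) * (orthVec P j r a * orthVec P j s b) := by
    intro a b
    rw [Matrix.mul_assoc, Matrix.mul_apply]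
    refine Finset.sum_congr rfl fun r _ => ?_
    rw [Matrix.mul_apply, Finset.mul_sum]
    refine Finset.sum_congr rfl fun s _ => ?_
    rw [Matrix.transpose_apply, hcol, hcol, symMat_apply]
    ring
  have h5 : ∀ a b, ∑ r, ∑ s, z s(r, s) * (orthVec P j s a * orthVec P j r b) =
      ∑ r, ∑ s, z s(r, s) * (orthVec P j r a * orthVec P j s b) := by
    intro a b
    rw [Finset.sum_comm]
    simp only [Sym2.eq_swap]
  rw [← h3]
  ext a b
  rw [h4, Matrix.sum_apply]
  simp only [Matrix.sum_apply, Matrix.smul_apply, Matrix.add_apply, Matrix.vecMulVec_apply,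
    smul_eq_mul]
  have h6 : ∑ r, ∑ s, z s(r, s) / 2 *
      (orthVec P j r a * orthVec P j s b + orthVec P j s a * orthVec P j r b) =
      (1 / 2) * (∑ r, ∑ s, z s(r, s) * (orthVec P j r a * orthVec P j s b) +
        ∑ r, ∑ s, z s(r, s) * (orthVec P j s a * orthVec P j r b)) := by
    simp only [← Finset.sum_add_distrib, Finset.mul_sum]
    exact Finset.sum_congr rfl fun r _ => Finset.sum_congr rfl fun s _ => by ring
  rw [h6, h5]
  ring

lemma gammaBlock_swap (r s j : Fin n) (P : Fin n → ℂ) : gammaBlock r s j P = gammaBlock s r j P := by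
  by_cases h : r = s
  · rw [h]
  · rw [gammaBlock, gammaBlock, if_neg h, if_neg (Ne.symm h), Sym2.eq_swap (a := r) (b := s)]
    module

lemma extend_zero_sub (S T : SymCoord n) :
    (extend 0 S : Conf n (K + 1)) - extend 0 T = extend 0 (S - T) := by
  rw [sub_eq_iff_eq_add, extend_add, add_zero, sub_add_cancel]

lemma gammaField_eq (r s j : Fin n) (Z : Conf n (K + 1)) :
    gammaField n K r s j Z = extend 0 (gammaBlock r s j (om (toSeq Z) (K + 1))) := by
  rw [gammaField]
  simp only [Ptil_eq, om_proj Z le_rfl, newDir_eq, smul_extend, smul_zero,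
    extend_zero_sub, extend_add, add_zero, gammaBlock]

lemma gammaFields_subset (K : ℕ) : gammaFields n (K + 1) ⊆ principal n (K + 2) := by
  cases K with
  | zero => exact Set.subset_union_right
  | succ K => exact Set.subset_union_right

lemma contDiff_gammaBlock {E : Type*} [NormedAddCommGroup E] [NormedSpace ℂ E] (r s j : Fin n)
    {P : E → Fin n → ℂ} (hP : ContDiff ℂ ∞ P) : ContDiff ℂ ∞ fun p => gammaBlock r s j (P p) := by
  have hP := contDiff_pi.1 hP
  unfold gammaBlock
  have h : ∀ {f : E → ℂ} (t : Sym2 (Fin n)), ContDiff ℂ ∞ f →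
      ContDiff ℂ ∞ fun p => f p • unitCoord t := fun t hf => hf.smul contDiff_const
  exact (h _ ((hP j).pow 2)).add (((h _ ((contDiff_const.mul (hP r)).mul (hP s))).sub
    (h _ ((hP r).mul (hP j)))).sub (h _ ((hP s).mul (hP j))) |>.const_smul _)

/-- The coefficients depend only on the blocks before the last and only the last block moves, so
integral curves are straight lines. -/
lemma isSmoothFlow_gammaField (r s j : Fin n) :
    IsSmoothFlow (gammaField n K r s j) fun t p => p + t • gammaField n K r s j p := by
  refine .of_straight ?_ fun t p => ?_
  · rw [funext (gammaField_eq r s j)]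
    exact contDiff_extend contDiff_const (contDiff_gammaBlock r s j (contDiff_om _))
  · rw [gammaField_eq, gammaField_eq, ← om_proj _ le_rfl, proj_add, proj_smul, proj_extend,
      smul_zero, add_zero, om_proj _ le_rfl]

lemma gammaField_mem_goodFields {r s j : Fin n} (hrs : r ≤ s) (hr : r ≠ j) (hs : s ≠ j) :
    gammaField n (K + 1) r s j ∈ goodFields n (K + 2) := by
  refine ⟨gammaFields_subset K ⟨r, s, j, hrs, hr, hs, rfl⟩, ?_, ?_, _,
    isSmoothFlow_gammaField r s j⟩
  · rw [funext (gammaField_eq r s j)]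
    exact contDiff_extend contDiff_const (contDiff_gammaBlock r s j (contDiff_om _))
  · rw [fiberPreserving_iff]
    intro Z
    rw [gammaField_eq, ← dom_proj Z _ le_rfl, show K + 2 + 1 = K + 1 + 2 from rfl, dom_last,
      proj_extend, extend_last, om_proj Z le_rfl, symMat_gammaBlock_mulVec hr hs]
    simp

lemma extend_zero_mem_span {Z : Conf n (K + 2)} (hZ : om (toSeq Z) (K + 2) ≠ 0) {z : SymCoord n}
    (hz : symMat z *ᵥ om (toSeq Z) (K + 2) = 0) :
    (extend 0 z : Conf n (K + 2)) ∈ Submodule.span ℂ {v | ∃ X ∈ goodFields n (K + 2), v = X Z} := by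
  obtain ⟨j, hj⟩ := Function.ne_iff.1 hZ
  have h := smul_eq_sum_gammaBlock j _ hz
  set P := om (toSeq Z) (K + 2) with hP
  have hg : ∀ r s, r ≠ j → s ≠ j → (extend 0 (gammaBlock r s j P) : Conf n (K + 2)) ∈
      Submodule.span ℂ {v | ∃ X ∈ goodFields n (K + 2), v = X Z} := by
    intro r s hr hs
    rcases le_total r s with hrs | hrs
    · exact Submodule.subset_span ⟨_, gammaField_mem_goodFields hrs hr hs, (gammaField_eq r s j Z).symm⟩
    · rw [gammaBlock_swap]
      exact Submodule.subset_span ⟨_, gammaField_mem_goodFields hrs hs hr, (gammaField_eq s r j Z).symm⟩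
  have h2 : P j ^ 2 • (extend 0 z : Conf n (K + 2)) ∈
      Submodule.span ℂ {v | ∃ X ∈ goodFields n (K + 2), v = X Z} := by
    rw [smul_extend, smul_zero, h, ← extend_zero_sum]
    refine Submodule.sum_mem _ fun r hr => ?_
    rw [← extend_zero_sum]
    refine Submodule.sum_mem _ fun s hs => ?_
    have := Submodule.smul_mem _
      (z s(r, s) * ((1 + if r = s then (1 : ℂ) else 0) / 2))
      (hg r s (Finset.ne_of_mem_erase hr) (Finset.ne_of_mem_erase hs))
    rwa [smul_extend, smul_zero] at this
  exact (Submodule.smul_mem_iff _ (pow_ne_zero 2 hj)).1 h2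

end Gamma

/-! ### The base fields -/

section Base

variable {n : ℕ}

lemma baseField_eq (r s j : Fin n) : (fun Z : Conf n 2 => (Ptil n 1 (proj Z) j) ^ 2 •
    (coordDir ((0 : Fin 2), s(r, s)) : Conf n 2)) =
    fun Z => (om (toSeq Z) 2 j) ^ 2 • Pi.single (⟨0, by omega⟩ : Fin 2) (unitCoord s(r, s)) := by
  funext Z
  rw [Ptil_eq, om_proj Z le_rfl]
  rfl

lemma symMat_unitCoord_mulVec_eLast {r s : Fin n} (hr : (r : ℕ) + 1 < n) (hs : (s : ℕ) + 1 < n) :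
    symMat (unitCoord s(r, s)) *ᵥ eLast n = 0 := by
  have h1 : eLast n r = 0 := if_neg hr.ne
  have h2 : eLast n s = 0 := if_neg hs.ne
  rw [symMat_unitCoord_mulVec, h1, h2]
  simp

/-- The chain sees Z_1 only through Z_1 e_n, which does not involve the variable z_{1,rs} with r, s
< n. -/
lemma baseField_mem_goodFields {r s : Fin n} (j : Fin n) (hrs : r ≤ s) (hs : (s : ℕ) + 1 < n) :
    (fun Z : Conf n 2 => (om (toSeq Z) 2 j) ^ 2 • Pi.single (⟨0, by omega⟩ : Fin 2) (unitCoord s(r, s))) ∈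
      goodFields n 2 := by
  have h0 := symMat_unitCoord_mulVec_eLast (r := r) (s := s)
    (lt_of_le_of_lt (Nat.succ_le_succ hrs) hs) hs
  have hsm : ContDiff ℂ ∞ (fun Z : Conf n 2 => (om (toSeq Z) 2 j) ^ 2 •
      (Pi.single (⟨0, by omega⟩ : Fin 2) (unitCoord s(r, s)) : Conf n 2)) :=
    ((contDiff_pi.1 (contDiff_om 2) j).pow 2).smul contDiff_const
  refine ⟨Or.inl ⟨r, s, j, hrs, hs, (baseField_eq r s j).symm⟩, hsm, ?_, _,
    .of_straight hsm fun t p => ?_⟩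
  · rw [fiberPreserving_iff]
    intro Z
    constructor <;>
    · rw [map_smul, dom_single, om_one, h0, Matrix.mulVec_zero, smul_zero]
  · have : om (toSeq (p + t • (om (toSeq p) 2 j) ^ 2 •
        (Pi.single (⟨0, by omega⟩ : Fin 2) (unitCoord s(r, s)) : Conf n 2))) 2 = om (toSeq p) 2 := by
      rw [om_add_two, om_add_two, om_zero, om_zero, om_one, om_one, map_add, map_smul, map_smul,
        toSeq_single, Pi.add_apply, Pi.smul_apply, Pi.smul_apply, Pi.single_eq_same, symMat_add,
        symMat_smul, symMat_smul, Matrix.add_mulVec, Matrix.smul_mulVec, Matrix.smul_mulVec, h0]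
      simp
    rw [this]

lemma eq_sum_unitCoord {z : SymCoord n} : z = ∑ s, z s • unitCoord s := by
  funext a
  simp [unitCoord, Finset.sum_apply, Pi.single_apply]

/-- The principal fields of `V_2` span the kernel. -/
lemma mem_span_goodFields_two {Z : Conf n 2} (hZ : om (toSeq Z) 2 ≠ 0) {v : Conf n 2}
    (hv3 : dom Z 3 v = 0) (hv2 : dom Z 2 v = 0) :
    v ∈ Submodule.span ℂ {v | ∃ X ∈ goodFields n 2, v = X Z} := by
  obtain ⟨j, hj⟩ := Function.ne_iff.1 hZ
  set S := Submodule.span ℂ {v | ∃ X ∈ goodFields n 2, v = X Z} with hS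
  have h0 : symMat (toSeq v 0) *ᵥ eLast n = 0 := by
    rw [dom_add_two, dom_zero, dom_one, om_one] at hv2
    simpa using hv2
  have hz : ∀ s : Sym2 (Fin n),
      (Pi.single (⟨0, by omega⟩ : Fin 2) (toSeq v 0 s • unitCoord s) : Conf n 2) ∈ S := by
    intro s
    induction s using Sym2.ind with
    | _ a b =>
    wlog hab : a ≤ b generalizing a b
    · rw [Sym2.eq_swap]
      exact this b a (le_of_not_ge hab)
    by_cases hb : (b : ℕ) + 1 < n
    · have h2 : (om (toSeq Z) 2 j) ^ 2 •
          (Pi.single (⟨0, by omega⟩ : Fin 2) (unitCoord s(a, b)) : Conf n 2) ∈ S :=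
        Submodule.subset_span ⟨_, baseField_mem_goodFields j hab hb, rfl⟩
      have h3 := (Submodule.smul_mem_iff _ (pow_ne_zero 2 hj)).1 h2
      have h4 := S.smul_mem (toSeq v 0 s(a, b)) h3
      rwa [← Pi.single_smul] at h4
    -- The remaining variables lie in the last column, and there the components of v vanish because
    -- the first block of v kills e_n.
    · have hbn : (b : ℕ) + 1 = n := by omega
      have h5 : eLast n = Pi.single b 1 := by
        funext i
        rw [eLast, Pi.single_apply]
        congr 1
        rw [Fin.ext_iff, eq_iff_iff]
        omega
      have h6 := congrFun h0 a
      rw [h5, Matrix.mulVec_single_one, Matrix.col_apply, symMat_apply] at h6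
      rw [h6]
      simp
  have h1 : (Pi.single (⟨0, by omega⟩ : Fin 2) (toSeq v 0) : Conf n 2) ∈ S := by
    have h2 := Submodule.sum_mem S fun s (_ : s ∈ Finset.univ) => hz s
    have h3 := map_sum (LinearMap.single ℂ (fun _ : Fin 2 => SymCoord n) (⟨0, by omega⟩ : Fin 2))
      (fun s => toSeq v 0 s • unitCoord s) Finset.univ
    rw [← eq_sum_unitCoord] at h3
    simp only [LinearMap.single_apply] at h3
    rw [h3]
    exact h2
  have h2 : v = Pi.single (⟨0, by omega⟩ : Fin 2) (toSeq v 0) + extend 0 (toSeq v 1) := by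
    funext k
    fin_cases k
    · have : (extend 0 (toSeq v 1) : Conf n 2) 0 = 0 := extend_castSucc 0 _ (0 : Fin 1)
      simp [this]
      rw [toSeq_apply v (by omega : 0 < 2)]; rfl
    · have : (extend 0 (toSeq v 1) : Conf n 2) 1 = toSeq v 1 := extend_last 0 _
      simp [this]
      rw [toSeq_apply v (by omega : 1 < 2)]; rfl
  rw [h2]
  refine S.add_mem h1 (extend_zero_mem_span hZ ?_)
  rw [dom_add_two, hv2, dom_one] at hv3
  simpa using hv3

end Base

/-! ### Flow maps of the fields `γ_{rr,i}` of an earlier block -/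

section GammaMove

variable {n : ℕ}

/-- Block k₀ enters the chain only through its product with `om (k₀ + 1)`. -/
lemma om_eq_of_shift {z z' : ℕ → SymCoord n} {k₀ : ℕ} (hk : ∀ k, k ≠ k₀ → z' k = z k)
    (h0 : symMat (z' k₀) *ᵥ om z (k₀ + 1) = symMat (z k₀) *ᵥ om z (k₀ + 1)) (j : ℕ) :
    om z' j = om z j := by
  induction j using Nat.twoStepInduction with
  | zero => rw [om_zero, om_zero]
  | one => rw [om_one, om_one]
  | more j h1 h2 =>
    rw [om_add_two, om_add_two, h1, h2]
    by_cases hj : j = k₀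
    · rw [hj, h0]
    · rw [hk j hj]

lemma toSeq_of_le {K : ℕ} (Z : Conf n K) {k : ℕ} (h : K ≤ k) : toSeq Z k = 0 := by
  simp [toSeq, not_lt.2 h]

lemma toSeq_liftPerm_of_lt {K : ℕ} (σ : Equiv.Perm (Conf n K)) (Z : Conf n (K + 1)) {k : ℕ}
    (hk : k < K) : toSeq (liftPerm σ Z) k = toSeq (σ (proj Z)) k := by
  rw [← toSeq_proj _ hk, proj_liftPerm]

lemma toSeq_liftPerm_of_le {K : ℕ} (σ : Equiv.Perm (Conf n K)) (Z : Conf n (K + 1)) {k : ℕ}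
    (hk : K ≤ k) : toSeq (liftPerm σ Z) k = toSeq Z k := by
  rcases hk.eq_or_lt with rfl | hk
  · rw [toSeq_last, toSeq_last, liftPerm_apply, extend_last]
  · rw [toSeq_of_le _ hk, toSeq_of_le _ hk]

/-- When block k + 1 is the last one this is the time-one map of γ_{rr,i}; for more blocks it is
lifted. -/
lemma exists_gamma_perm {κ k : ℕ} (hκ : k + 2 ≤ κ) {i r : Fin n} (hr : r ≠ i) :
    ∃ σ ∈ symGroup n κ, ∀ Z, (∀ l, l ≠ k + 1 → toSeq (σ Z) l = toSeq Z l) ∧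
      toSeq (σ Z) (k + 1) = toSeq Z (k + 1) + gammaBlock r r i (om (toSeq Z) (k + 2)) := by
  induction κ, hκ using Nat.le_induction with
  | base =>
    refine ⟨_, perm_mem_symGroup (isSmoothFlow_gammaField r r i)
      (gammaField_mem_goodFields le_rfl hr hr) 1, fun Z => ?_⟩
    have h : (isSmoothFlow_gammaField (n := n) (K := k + 1) r r i).perm 1 Z =
        Z + (1 : ℂ) • gammaField n (k + 1) r r i Z := rfl
    rw [h, one_smul, gammaField_eq, map_add]
    refine ⟨fun l hl => ?_, ?_⟩
    · rw [Pi.add_apply]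
      rcases lt_or_gt_of_ne hl with hl | hl
      · rw [← toSeq_proj (extend _ _) hl, proj_extend, map_zero, Pi.zero_apply, add_zero]
      · rw [toSeq_of_le (extend _ _) hl, add_zero]
    · rw [Pi.add_apply, toSeq_last (extend _ _), extend_last]
  | succ κ hκ ih =>
    obtain ⟨σ, hσ, h⟩ := ih
    refine ⟨liftPerm σ, liftPerm_mem_symGroup (by omega) hσ, fun Z => ⟨fun l hl => ?_, ?_⟩⟩
    · by_cases hl' : l < κ
      · rw [toSeq_liftPerm_of_lt _ _ hl', (h _).1 l hl, toSeq_proj _ hl']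
      · rw [toSeq_liftPerm_of_le _ _ (by omega)]
    · rw [toSeq_liftPerm_of_lt _ _ (by omega), (h _).2, toSeq_proj _ (by omega), om_proj _ (by omega)]

/-- A flow map of a field `γ_{rr,i}` that moves only block `k + 1`. -/
lemma exists_gamma_move {κ k : ℕ} (hκ : k + 2 ≤ κ) {i r : Fin n} (hr : r ≠ i) :
    ∃ σ ∈ symGroup n κ, ∀ Z, (∀ l, l ≠ k + 1 → toSeq (σ Z) l = toSeq Z l) ∧
      (∀ j, om (toSeq (σ Z)) j = om (toSeq Z) j) ∧
      symMat (toSeq (σ Z) (k + 1)) = symMat (toSeq Z (k + 1)) +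
        Matrix.vecMulVec (orthVec (om (toSeq Z) (k + 2)) i r)
          (orthVec (om (toSeq Z) (k + 2)) i r) := by
  obtain ⟨σ, hσ, h⟩ := exists_gamma_perm hκ hr
  refine ⟨σ, hσ, fun Z => ⟨(h Z).1, om_eq_of_shift (h Z).1 ?_, ?_⟩⟩
  · rw [(h Z).2, symMat_add, Matrix.add_mulVec, symMat_gammaBlock_mulVec hr hr, add_zero]
  · rw [(h Z).2, symMat_add, symMat_gammaBlock_self hr]

end GammaMove

/-! ### Moving a set into another one by finitely many symmetries -/

section Reach

variable {n K : ℕ}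

/-- Finitely many elements of `G_{V_K}` over `Φ_K` suffice to move each point of `S` into `T`. -/
def Reach (S T : Set (Conf n K)) : Prop :=
  ∃ F : Set (Equiv.Perm (Conf n K)), F.Finite ∧ F ⊆ symGroup n K ∧ ∀ Z ∈ S, ∃ σ ∈ F, σ Z ∈ T

namespace Reach

lemma of_subset {S T : Set (Conf n K)} (h : S ⊆ T) : Reach S T :=
  ⟨{1}, Set.finite_singleton 1, by simp, fun Z hZ => ⟨1, rfl, h hZ⟩⟩

lemma trans {S T U : Set (Conf n K)} (h1 : Reach S T) (h2 : Reach T U) : Reach S U := by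
  obtain ⟨F, hF, hFs, hST⟩ := h1
  obtain ⟨G, hG, hGs, hTU⟩ := h2
  refine ⟨Set.image2 (fun τ σ => τ * σ) G F, hG.image2 _ hF, ?_, fun Z hZ => ?_⟩
  · rintro _ ⟨τ, hτ, σ, hσ, rfl⟩
    exact (symGroup n K).mul_mem (hGs hτ) (hFs hσ)
  · obtain ⟨σ, hσ, hσZ⟩ := hST Z hZ
    obtain ⟨τ, hτ, hτZ⟩ := hTU _ hσZ
    exact ⟨τ * σ, ⟨τ, hτ, σ, hσ, rfl⟩, hτZ⟩

lemma mono {S S' T T' : Set (Conf n K)} (h : Reach S T) (hS : S' ⊆ S) (hT : T ⊆ T') :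
    Reach S' T' :=
  ((of_subset hS).trans h).trans (of_subset hT)

lemma iUnion {ι : Type*} [Finite ι] {S : ι → Set (Conf n K)} {T : Set (Conf n K)}
    (h : ∀ i, Reach (S i) T) : Reach (⋃ i, S i) T := by
  choose F hF hFs hST using h
  refine ⟨⋃ i, F i, Set.finite_iUnion hF, Set.iUnion_subset hFs, fun Z hZ => ?_⟩
  obtain ⟨i, hi⟩ := Set.mem_iUnion.1 hZ
  obtain ⟨σ, hσ, h⟩ := hST i Z hi
  exact ⟨σ, Set.mem_iUnion.2 ⟨i, hσ⟩, h⟩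

lemma union {S S' T : Set (Conf n K)} (h : Reach S T) (h' : Reach S' T) : Reach (S ∪ S') T := by
  rw [Set.union_eq_iUnion]
  exact iUnion (Bool.rec h' h)

lemma by_cases {S T : Set (Conf n K)} (A : Set (Conf n K)) (h : Reach (S ∩ A) T)
    (h' : Reach (S \ A) T) : Reach S T := by
  have := h.union h'
  rwa [Set.inter_union_sdiff] at this

lemma exists_index {ι : Type*} [Finite ι] {S : ι → Set (Conf n K)} {S' T : Set (Conf n K)}
    (h : ∀ i, Reach (S i) T) (hS : ∀ Z ∈ S', ∃ i, Z ∈ S i) : Reach S' T :=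
  (iUnion h).mono (fun Z hZ => Set.mem_iUnion.2 (hS Z hZ)) le_rfl

/-- The endpoints of the chain are preserved. -/
lemma inter_ends {S T : Set (Conf n K)} (h : Reach S T) (C : (Fin n → ℂ) → (Fin n → ℂ) → Prop) :
    Reach (S ∩ {Z | C (om (toSeq Z) K) (om (toSeq Z) (K + 1))})
      (T ∩ {Z | C (om (toSeq Z) K) (om (toSeq Z) (K + 1))}) := by
  obtain ⟨F, hF, hFs, hST⟩ := h
  refine ⟨F, hF, hFs, fun Z ⟨hZ, hC⟩ => ?_⟩
  obtain ⟨σ, hσ, hT⟩ := hST Z hZ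
  have := om_of_mem_symGroup (hFs hσ) Z
  refine ⟨σ, hσ, hT, ?_⟩
  rw [Set.mem_ofPred_eq, this.1, this.2]
  exact hC

lemma lift {S T : Set (Conf n K)} (hK : 2 ≤ K) (h : Reach S T)
    (C : (Fin n → ℂ) → (Fin n → ℂ) → (Fin n → ℂ) → Prop) :
    Reach ({Z : Conf n (K + 1) | proj Z ∈ S ∧
        C (om (toSeq Z) K) (om (toSeq Z) (K + 1)) (om (toSeq Z) (K + 2))})
      ({Z : Conf n (K + 1) | proj Z ∈ T ∧
        C (om (toSeq Z) K) (om (toSeq Z) (K + 1)) (om (toSeq Z) (K + 2))}) := by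
  obtain ⟨F, hF, hFs, hST⟩ := h
  refine ⟨liftPerm '' F, hF.image _, ?_, fun Z ⟨hZ, hC⟩ => ?_⟩
  · rintro _ ⟨σ, hσ, rfl⟩
    exact liftPerm_mem_symGroup hK (hFs hσ)
  · obtain ⟨σ, hσ, hT⟩ := hST _ hZ
    refine ⟨liftPerm σ, ⟨σ, hσ, rfl⟩, by rwa [proj_liftPerm], ?_⟩
    have h1 := om_of_mem_symGroup (hFs hσ) (proj Z)
    have h2 := om_of_mem_symGroup (liftPerm_mem_symGroup hK (hFs hσ)) Z
    rw [om_proj _ le_rfl, om_proj _ (by omega), ← proj_liftPerm, om_proj _ le_rfl,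
      om_proj _ (by omega)] at h1
    rw [h1.2, h1.1, show K + 2 = K + 1 + 1 from rfl, h2.1]
    exact hC

/-- A space of vectors with vanishing entry `i` can be made trivial one coordinate at a time. -/
lemma of_kernel {C : Set (Conf n K)} (Ker : Conf n K → Set (Fin n → ℂ)) {i : Fin n}
    (hi : ∀ Z, ∀ y ∈ Ker Z, y i = 0)
    (hmove : ∀ r, r ≠ i → ∃ σ ∈ symGroup n K, ∀ Z ∈ C, σ Z ∈ C ∧
      ∀ y ∈ Ker Z, y r ≠ 0 → ∀ y' ∈ Ker (σ Z), y' r = 0 ∧ y' ∈ Ker Z) :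
    Reach C {Z | Z ∈ C ∧ ∀ y ∈ Ker Z, y = 0} := by
  have key : ∀ s : Finset (Fin n), Reach C {Z | Z ∈ C ∧ ∀ y ∈ Ker Z, ∀ r ∈ s, y r = 0} := by
    intro s
    induction s using Finset.induction_on with
    | empty => exact of_subset fun Z hZ => ⟨hZ, by simp⟩
    | insert r s hr ih =>
      refine ih.trans ?_
      by_cases hri : r = i
      · subst hri
        refine of_subset fun Z hZ => ⟨hZ.1, fun y hy r' hr' => ?_⟩
        rcases Finset.mem_insert.1 hr' with rfl | hr'
        · exact hi Z y hy
        · exact hZ.2 y hy r' hr'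
      · obtain ⟨σ, hσ, h⟩ := hmove r hri
        -- If coordinate r already vanishes on the space nothing is done; otherwise σ makes it
        -- vanish, and the new space lies in the old one, so coordinates already treated stay zero.
        refine ⟨{1, σ}, Set.toFinite _, ?_, fun Z hZ => ?_⟩
        · rintro _ (rfl | rfl)
          exacts [(symGroup n K).one_mem, hσ]
        · by_cases hy : ∃ y ∈ Ker Z, y r ≠ 0
          · obtain ⟨y, hy, hyr⟩ := hy
            obtain ⟨h1, h2⟩ := h Z hZ.1
            refine ⟨σ, Or.inr rfl, h1, fun y' hy' r' hr' => ?_⟩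
            obtain ⟨h3, h4⟩ := h2 y hy hyr y' hy'
            rcases Finset.mem_insert.1 hr' with rfl | hr'
            · exact h3
            · exact hZ.2 y' h4 r' hr'
          · push Not at hy
            refine ⟨1, Or.inl rfl, hZ.1, fun y' hy' r' hr' => ?_⟩
            rcases Finset.mem_insert.1 hr' with rfl | hr'
            · exact hy y' hy'
            · exact hZ.2 y' hy' r' hr'
  exact (key Finset.univ).mono le_rfl fun Z hZ =>
    ⟨hZ.1, fun y hy => funext fun r => hZ.2 y hy r (Finset.mem_univ r)⟩

/-- The moves in block `k + 1` make the adjugate of `1 + Z_{k+1} Z_l` nonzero. -/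
lemma adjugate_one_add_mul {k l : ℕ} (hκ : k + 2 ≤ K) (hl : l ≠ k + 1) (i : Fin n)
    (C : (ℕ → Fin n → ℂ) → Prop) :
    Reach {Z : Conf n K | C (om (toSeq Z)) ∧ om (toSeq Z) (k + 2) i ≠ 0}
      {Z : Conf n K | (C (om (toSeq Z)) ∧ om (toSeq Z) (k + 2) i ≠ 0) ∧
        (1 + symMat (toSeq Z (k + 1)) * symMat (toSeq Z l)).adjugate *ᵥ Pi.single i 1 ≠ 0} := by
  refine (of_kernel (fun Z => {y | y i = 0 ∧
    y ᵥ* (1 + symMat (toSeq Z (k + 1)) * symMat (toSeq Z l)) = 0}) (i := i)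
    (fun Z y hy => hy.1) fun r hr => ?_).mono le_rfl
    fun Z hZ => ⟨hZ.1, adjugate_mulVec_single_ne_zero fun y h1 h2 => hZ.2 y ⟨h1, h2⟩⟩
  obtain ⟨σ, hσ, h⟩ := exists_gamma_move hκ hr
  refine ⟨σ, hσ, fun Z hZ => ?_⟩
  obtain ⟨h1, h2, h3⟩ := h Z
  refine ⟨by rw [Set.mem_ofPred_eq, funext h2]; exact hZ, fun y hy hyr y' hy' => ?_⟩
  have hy'' := hy'.2
  rw [h3, h1 l hl] at hy''
  obtain ⟨h4, h5⟩ := kernel_one_add_mul_shift (symMat_isSymm _) (symMat_isSymm _) hZ.2 hy.1 hy.2 hyr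
    hy'.1 hy''
  exact ⟨h4, hy'.1, h5⟩

/-- The moves in block `k + 1` make a principal minor of `Z_{k+1}` nonzero. -/
lemma adjugate_apply_self {k : ℕ} (hκ : k + 2 ≤ K) (i : Fin n) (C : (ℕ → Fin n → ℂ) → Prop) :
    Reach {Z : Conf n K | C (om (toSeq Z)) ∧ om (toSeq Z) (k + 2) i ≠ 0}
      {Z : Conf n K | (C (om (toSeq Z)) ∧ om (toSeq Z) (k + 2) i ≠ 0) ∧
        (symMat (toSeq Z (k + 1))).adjugate i i ≠ 0} := by
  refine (of_kernel (fun Z => {y | y i = 0 ∧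
    ∀ s, s ≠ i → (symMat (toSeq Z (k + 1)) *ᵥ y) s = 0}) (i := i)
    (fun Z y hy => hy.1) fun r hr => ?_).mono le_rfl
    fun Z hZ => ⟨hZ.1, adjugate_apply_self_ne_zero fun y h1 h2 => hZ.2 y ⟨h1, h2⟩⟩
  obtain ⟨σ, hσ, h⟩ := exists_gamma_move hκ hr
  refine ⟨σ, hσ, fun Z hZ => ?_⟩
  obtain ⟨h1, h2, h3⟩ := h Z
  refine ⟨by rw [Set.mem_ofPred_eq, funext h2]; exact hZ, fun y hy hyr y' hy' => ?_⟩
  have hy'' := hy'.2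
  rw [h3] at hy''
  obtain ⟨h4, h5⟩ := kernel_shift (symMat_isSymm _) hZ.2 hy.1 hy.2 hyr hy'.1 hy''
  exact ⟨h4, hy'.1, h5⟩

end Reach

end Reach

/-! ### Reaching points with nonvanishing chain -/

section Chain

variable {n : ℕ}

/-- The product of `star` with its adjugate is the scalar v_m^n, which removes the row structure;
the rest is the right-hand side of `adjugate_one_add_mul` applied to e_i. -/
lemma CrossData.disp_add_three {p : ℕ} (c : CrossData n (p + 3)) (hl : c.l = p) (hk : c.k = p + 1)
    (Z : Conf n (p + 3)) : c.disp Z (p + 3) = om (toSeq Z) (p + 1) c.m ^ n •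
      ((1 + symMat (toSeq Z (p + 1)) * symMat (toSeq Z (p + 2))).adjugate *ᵥ Pi.single c.i 1) := by
  have hs : (c.star Z).det = om (toSeq Z) (p + 1) c.m ^ n := by rw [star, det_starMat, hl]
  have hj : c.jac Z = (1 + symMat (toSeq Z (p + 2)) * symMat (toSeq Z (p + 1))) * c.star Z := by
    rw [jac, hl, show p + 3 + 1 = p + 4 from rfl, prop_add_four]
  have hd : c.diagVec Z = symMat (toSeq Z (p + 2)) *ᵥ Pi.single c.i 1 := by
    rw [diagVec, hk, show p + 3 + 1 = p + 1 + 3 from rfl, prop_add_three]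
  have h1 : c.star Z *ᵥ c.dir Z = om (toSeq Z) (p + 1) c.m ^ n •
      ((1 + symMat (toSeq Z (p + 2)) * symMat (toSeq Z (p + 1))).adjugate *ᵥ c.diagVec Z) := by
    rw [dir, hj, Matrix.adjugate_mul_distrib, Matrix.mulVec_mulVec, ← Matrix.mul_assoc,
      Matrix.mul_adjugate, Matrix.smul_mul, Matrix.one_mul, Matrix.smul_mulVec, hs]
  have hp : prop (toSeq Z) (p + 1) (p + 3) = 1 := prop_self _ _
  rw [disp, h1, hj, Matrix.det_mul, hs, hl, hk, hp, prop_add_three,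
    SymplecticSpray.adjugate_one_add_mul (symMat (toSeq Z (p + 1))) (symMat (toSeq Z (p + 2))), hd,
    Matrix.one_mulVec, Matrix.sub_mulVec, Matrix.smul_mulVec, Matrix.one_mulVec,
    Matrix.mulVec_smul, mul_comm, mul_smul, smul_sub, Matrix.mulVec_mulVec, Matrix.mulVec_mulVec,
    Matrix.mul_assoc]

lemma CrossData.disp_add_two {p : ℕ} (c : CrossData n (p + 3)) (hl : c.l = p) (hk : c.k = p + 2)
    (Z : Conf n (p + 3)) : c.disp Z (p + 2) = -(om (toSeq Z) (p + 1) c.m ^ n) •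
      ((1 + symMat (toSeq Z (p + 2)) * symMat (toSeq Z (p + 1))).adjugate *ᵥ Pi.single c.i 1) := by
  have hs : (c.star Z).det = om (toSeq Z) (p + 1) c.m ^ n := by rw [star, det_starMat, hl]
  have hj : c.jac Z = (1 + symMat (toSeq Z (p + 2)) * symMat (toSeq Z (p + 1))) * c.star Z := by
    rw [jac, hl, show p + 3 + 1 = p + 4 from rfl, prop_add_four]
  have hd : c.diagVec Z = Pi.single c.i 1 := by
    rw [diagVec, hk, show p + 3 + 1 = p + 2 + 2 from rfl, prop_self, Matrix.one_mulVec]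
  have h1 : c.star Z *ᵥ c.dir Z = om (toSeq Z) (p + 1) c.m ^ n •
      ((1 + symMat (toSeq Z (p + 2)) * symMat (toSeq Z (p + 1))).adjugate *ᵥ c.diagVec Z) := by
    rw [dir, hj, Matrix.adjugate_mul_distrib, Matrix.mulVec_mulVec, ← Matrix.mul_assoc,
      Matrix.mul_adjugate, Matrix.smul_mul, Matrix.one_mul, Matrix.smul_mulVec, hs]
  rw [disp, h1, hl, hk, prop_self, prop_of_lt _ (by omega), hd, Matrix.zero_mulVec, smul_zero,
    zero_sub, Matrix.one_mulVec, neg_smul]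

lemma om_ne_zero_of_eq_zero {z : ℕ → SymCoord n} {q : ℕ} (h1 : om z (q + 1) = 0)
    (h2 : om z (q + 2) ≠ 0) : om z q ≠ 0 := by
  rw [om_add_two, h1] at h2
  simpa using h2

/-- Some vector of the chain of the same parity as `q`, up to `q`, is nonzero. -/
def Alive (z : ℕ → SymCoord n) (q : ℕ) : Prop := ∃ i j, i + 2 * j = q ∧ om z i ≠ 0

lemma Alive.of_om_eq_zero {z : ℕ → SymCoord n} {q : ℕ} (h : Alive z (q + 2)) (h0 : om z (q + 2) = 0) :
    Alive z q := by
  obtain ⟨i, j, hij, hi⟩ := h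
  cases j with
  | zero => exact absurd (by rw [show i = q + 2 by omega]; exact h0) hi
  | succ j => exact ⟨i, j, by omega, hi⟩

lemma Alive.not_zero {z : ℕ → SymCoord n} (h : Alive z 0) : False := by
  obtain ⟨i, j, hij, hi⟩ := h
  exact hi (by rw [show i = 0 by omega, om_zero])

lemma Alive.om_one_ne_zero {z : ℕ → SymCoord n} (h : Alive z 1) : om z 1 ≠ 0 := by
  obtain ⟨i, j, hij, hi⟩ := h
  rwa [show i = 1 by omega] at hi

lemma alive_congr {z z' : ℕ → SymCoord n} {q : ℕ} (h : ∀ j ≤ q, om z j = om z' j) :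
    Alive z q ↔ Alive z' q := by
  constructor
  · rintro ⟨i, j, hij, hi⟩
    exact ⟨i, j, hij, by rwa [← h i (by omega)]⟩
  · rintro ⟨i, j, hij, hi⟩
    exact ⟨i, j, hij, by rwa [h i (by omega)]⟩

/-- `om (p + 3)` = 0 forces `om (p + 2)` = `om (p + 4)` ≠ 0, which provides a nonzero coefficient.
After the γ moves have made the adjugate column nonzero, a `CrossData` move displaces `om (p + 3)`
away from zero. -/
lemma reach_ne_zero_of_ne_zero (p : ℕ) :
    Reach {Z : Conf n (p + 4) | om (toSeq Z) (p + 4) ≠ 0 ∧ om (toSeq Z) (p + 3) = 0 ∧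
        om (toSeq Z) (p + 1) ≠ 0}
      {Z | om (toSeq Z) (p + 3) ≠ 0} := by
  refine Reach.exists_index (ι := Fin n × Fin n) (S := fun a =>
    {Z | (om (toSeq Z) (p + 4) ≠ 0 ∧ om (toSeq Z) (p + 3) = 0 ∧ om (toSeq Z) (p + 1) a.2 ≠ 0) ∧
      om (toSeq Z) (p + 2) a.1 ≠ 0}) (fun ⟨i, m⟩ => ?_) ?_
  · refine (Reach.adjugate_one_add_mul (k := p) (l := p + 2) (by omega) (by omega) i
      (fun w => w (p + 4) ≠ 0 ∧ w (p + 3) = 0 ∧ w (p + 1) m ≠ 0)).trans ?_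
    obtain ⟨F, hF, hFs, h⟩ := CrossData.exists_moves (n := n) (K := p + 1)
      { l := p, k := p + 1, hlk := by omega, hk := by omega, m := m, i := i }
    refine ⟨F, hF, hFs, fun Z ⟨⟨⟨h4, h3, h1⟩, h2⟩, ha⟩ => ?_⟩
    obtain ⟨σ, hσ, τ, hτ, hom, -⟩ := h Z h4
    refine ⟨σ, hσ, ?_⟩
    rw [Set.mem_ofPred_eq, hom _ (by omega), h3, zero_add,
      CrossData.disp_add_three _ rfl rfl, om_proj _ (by omega), toSeq_proj _ (by omega),
      toSeq_proj _ (by omega), smul_smul]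
    exact smul_ne_zero (mul_ne_zero (mul_ne_zero hτ h2) (pow_ne_zero _ h1)) ha
  · rintro Z ⟨h4, h3, h1⟩
    have h2 : om (toSeq Z) (p + 2) ≠ 0 := om_ne_zero_of_eq_zero h3 h4
    obtain ⟨i, hi⟩ := Function.ne_iff.1 h2
    obtain ⟨m, hm⟩ := Function.ne_iff.1 h1
    exact ⟨(i, m), ⟨h4, h3, hm⟩, hi⟩

/-- A point of an alive chain can be moved to make the last vector but one nonzero. -/
lemma reach_ne_zero : ∀ q : ℕ,
    Reach {Z : Conf n (q + 1) | om (toSeq Z) (q + 1) ≠ 0 ∧ om (toSeq Z) q = 0 ∧ Alive (toSeq Z) q}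
      {Z | om (toSeq Z) q ≠ 0}
  | 0 => Reach.of_subset fun _ hZ => hZ.2.2.not_zero.elim
  | 1 => Reach.of_subset fun _ hZ => hZ.2.2.om_one_ne_zero
  | 2 => Reach.of_subset fun _ hZ => (hZ.2.2.of_om_eq_zero hZ.2.1).not_zero.elim
  | p + 3 => by
    refine Reach.by_cases {Z | om (toSeq Z) (p + 1) = 0} ?_
      ((reach_ne_zero_of_ne_zero p).mono (fun Z hZ => ⟨hZ.1.1, hZ.1.2.1, hZ.2⟩) le_rfl)
    -- When `om (p + 1)` also vanishes, the chain without its last two blocks satisfies the same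
    -- hypotheses, because `om (p + 2)` is nonzero. Its moves are lifted twice and keep the ends of
    -- the longer chain.
    have h1 := ((reach_ne_zero (p + 1)).lift (by omega)
      (fun _ b c => b = 0 ∧ c ≠ 0)).lift (by omega) (fun _ _ _ => True)
    refine (h1.mono ?_ ?_).trans (reach_ne_zero_of_ne_zero p)
    · rintro Z ⟨⟨h4, h3, hal⟩, h1⟩
      have h2 : om (toSeq Z) (p + 2) ≠ 0 := om_ne_zero_of_eq_zero h3 h4
      have e : ∀ j ≤ p + 2, om (toSeq (proj (proj Z))) j = om (toSeq Z) j := fun j hj => by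
        rw [om_proj _ (by omega), om_proj _ (by omega)]
      refine ⟨⟨⟨?_, ?_, ?_⟩, ?_, ?_⟩, trivial⟩
      · rwa [e _ (by omega)]
      · rw [e _ (by omega)]; exact h1
      · exact (alive_congr fun j hj => e j (by omega)).2 (hal.of_om_eq_zero h3)
      · rw [om_proj _ (by omega)]; exact h3
      · rw [om_proj _ (by omega)]; exact h4
    · rintro Z ⟨⟨h1, h3, h4⟩, -⟩
      rw [om_proj _ (by omega)] at h3 h4
      simp only [Set.mem_ofPred_eq] at h1
      rw [om_proj _ (by omega), om_proj _ (by omega)] at h1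
      exact ⟨h4, h3, h1⟩

/-- The last three vectors of the chain can be made nonzero. -/
lemma reach_ne_zero_two (p : ℕ) :
    Reach {Z : Conf n (p + 4) | om (toSeq Z) (p + 4) ≠ 0 ∧ om (toSeq Z) (p + 3) ≠ 0}
      {Z | om (toSeq Z) (p + 4) ≠ 0 ∧ om (toSeq Z) (p + 3) ≠ 0 ∧ om (toSeq Z) (p + 2) ≠ 0} := by
  refine Reach.by_cases {Z | om (toSeq Z) (p + 2) ≠ 0}
    (Reach.of_subset fun Z hZ => ⟨hZ.1.1, hZ.1.2, hZ.2⟩) ?_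
  refine Reach.exists_index (ι := Fin n × Fin n) (S := fun a =>
    {Z | (om (toSeq Z) (p + 4) ≠ 0 ∧ om (toSeq Z) (p + 2) = 0 ∧ om (toSeq Z) (p + 1) a.2 ≠ 0) ∧
      om (toSeq Z) (p + 3) a.1 ≠ 0}) (fun ⟨i, m⟩ => ?_) ?_
  · refine (Reach.adjugate_one_add_mul (k := p + 1) (l := p + 1) (by omega) (by omega) i
      (fun w => w (p + 4) ≠ 0 ∧ w (p + 2) = 0 ∧ w (p + 1) m ≠ 0)).trans ?_
    obtain ⟨F, hF, hFs, h⟩ := CrossData.exists_moves (n := n) (K := p + 1)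
      { l := p, k := p + 2, hlk := by omega, hk := by omega, m := m, i := i }
    refine ⟨F, hF, hFs, fun Z ⟨⟨⟨h4, h2, h1⟩, h3⟩, ha⟩ => ?_⟩
    obtain ⟨σ, hσ, τ, hτ, hom, e, he, hei⟩ := h Z h4
    refine ⟨σ, hσ, ?_, ?_, ?_⟩
    · rw [(om_of_mem_symGroup (hFs hσ) Z).2]; exact h4
    -- Entry i of `om (p + 3)` is the coefficient of the move, hence only multiplied by a nonzero
    -- factor.
    · refine fun h0 => mul_ne_zero he h3 ?_
      rw [← hei]
      exact congrFun h0 i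
    · rw [hom _ (by omega), h2, zero_add,
        CrossData.disp_add_two _ rfl rfl, om_proj _ (by omega), toSeq_proj _ (by omega),
        toSeq_proj _ (by omega), smul_smul]
      exact smul_ne_zero (mul_ne_zero (mul_ne_zero hτ h3) (neg_ne_zero.2 (pow_ne_zero _ h1))) ha
  · rintro Z ⟨⟨h4, h3⟩, h2⟩
    have h2 : om (toSeq Z) (p + 2) = 0 := not_not.1 h2
    have h1 : om (toSeq Z) (p + 1) ≠ 0 := om_ne_zero_of_eq_zero h2 h3
    obtain ⟨i, hi⟩ := Function.ne_iff.1 h3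
    obtain ⟨m, hm⟩ := Function.ne_iff.1 h1
    exact ⟨(i, m), ⟨h4, h2, hm⟩, hi⟩

end Chain

/-! ### Reaching points at which the principal fields span -/

section Spread

variable {n : ℕ}

/-- The field data for the variable `z_{l r}`, where `l` and `r` differ from `m`. -/
def StarData.ofPair (K : ℕ) {k : ℕ} (hk : n = k + 2) {m l r : Fin n} (hl : l ≠ m) (hr : r ≠ m) :
    StarData n K where
  k := k
  hk := hk
  m := m
  s₀ := s(l, r)
  orth p := by
    rw [symMat_unitCoord_mulVec]
    split_ifs
    · rw [Pi.single_eq_of_ne hl.symm]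
    · rw [Pi.add_apply, Pi.single_eq_of_ne hl.symm, Pi.single_eq_of_ne hr.symm, add_zero]

lemma eLast_eq {a : Fin n} (ha : (a : ℕ) + 1 = n) : eLast n = Pi.single a 1 := by
  funext i
  rw [eLast, Pi.single_apply]
  congr 1
  rw [Fin.ext_iff, eq_iff_iff]
  omega

lemma symMat_unitCoord_mulVec_last {a : Fin n} (ha : (a : ℕ) + 1 = n) (l : Fin n) :
    symMat (unitCoord s(l, a)) *ᵥ eLast n = Pi.single l 1 := by
  rw [eLast_eq ha, symMat_unitCoord_mulVec]
  by_cases h : l = a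
  · rw [if_pos h, h, Pi.single_eq_same]
  · rw [if_neg h, Pi.single_eq_same, Pi.single_eq_of_ne h, Pi.single_zero, add_zero]

/-- The field data for the variable `z_{l n}` of the first block, where `l` differs from `m`. -/
def StarData.base {k : ℕ} (hk : n = k + 2) {m l a : Fin n} (ha : (a : ℕ) + 1 = n) (hl : l ≠ m) :
    StarData n 0 where
  k := k
  hk := hk
  m := m
  s₀ := s(l, a)
  orth p := by
    rw [om_one, symMat_unitCoord_mulVec_last ha, Pi.single_eq_of_ne hl.symm]

/-- Some entry `j` of `om (q + 1)` is nonzero, and `om q` is not proportional to `e_j`. -/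
def Spread (z : ℕ → SymCoord n) (q : ℕ) : Prop :=
  ∃ j, om z (q + 1) j ≠ 0 ∧ ∀ l, l ≠ j → ∃ r, r ≠ j ∧ om z q r ≠ 0

/-- For n = 1 the second condition of `Spread` is vacuous, so failure also yields an index l ≠ j;
this is what ensures n ≥ 2 for `StarData`. -/
lemma exists_of_not_spread {z : ℕ → SymCoord n} {q : ℕ} (h : ¬ Spread z q)
    (h1 : om z (q + 1) ≠ 0) (h0 : om z q ≠ 0) :
    ∃ j l, l ≠ j ∧ om z (q + 1) j ≠ 0 ∧ om z q j ≠ 0 ∧ ∀ r, r ≠ j → om z q r = 0 := by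
  obtain ⟨j, hj⟩ := Function.ne_iff.1 h1
  rw [Spread] at h
  push Not at h
  obtain ⟨l, hl, hr⟩ := h j hj
  refine ⟨j, l, hl, hj, fun h2 => h0 (funext fun r => ?_), hr⟩
  by_cases hrj : r = j
  · rw [hrj, h2]; rfl
  · exact hr r hrj

lemma exists_eq_add_two {j l : Fin n} (h : l ≠ j) : ∃ k, n = k + 2 := by
  have := Fin.val_ne_of_ne h
  exact ⟨n - 2, by omega⟩

/-- If Z_1 e_n is a multiple of e_j, moving the variable z_{1,ln} adds a nonzero multiple of e_l to
it, while the end vector `om 3` is preserved. -/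
lemma reach_spread_base : Reach {Z : Conf n 3 | om (toSeq Z) 3 ≠ 0 ∧ om (toSeq Z) 2 ≠ 0}
    {Z | Spread (toSeq Z) 2 ∧ om (toSeq Z) 2 ≠ 0} := by
  refine Reach.by_cases {Z | Spread (toSeq Z) 2} (Reach.of_subset fun Z hZ => ⟨hZ.2, hZ.1.2⟩) ?_
  refine Reach.exists_index (ι := Fin n × Fin n) (S := fun a => {Z | a.2 ≠ a.1 ∧
    om (toSeq Z) 3 a.1 ≠ 0 ∧ om (toSeq Z) 2 a.1 ≠ 0 ∧ ∀ r, r ≠ a.1 → om (toSeq Z) 2 r = 0})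
    (fun ⟨j, l⟩ => ?_) ?_
  · by_cases hl : l = j
    · exact Reach.of_subset fun Z hZ => (hZ.1 hl).elim
    obtain ⟨k, hk⟩ := exists_eq_add_two hl
    obtain ⟨F, hF, hFs, h⟩ :=
      (StarData.base hk (a := ⟨n - 1, by omega⟩) (by simp only; omega) hl).exists_moves
    refine ⟨F, hF, hFs, fun Z ⟨_, h3, h2, h0⟩ => ?_⟩
    obtain ⟨σ, hσ, τ, hτ, -, hom⟩ := h Z (Function.ne_iff.2 ⟨j, h3⟩)
    have hl' : om (toSeq (σ Z)) 2 l ≠ 0 := by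
      rw [show (2 : ℕ) = 0 + 2 from rfl, hom]
      simp only [StarData.base, zero_add, om_one]
      rw [symMat_unitCoord_mulVec_last (by simp only; omega), Pi.add_apply, h0 l hl, zero_add,
        Pi.smul_apply, Pi.single_eq_same, smul_eq_mul, mul_one]
      exact mul_ne_zero hτ (pow_ne_zero _ h2)
    refine ⟨σ, hσ, ⟨j, ?_, fun _ _ => ⟨l, hl, hl'⟩⟩, fun h0 => hl' (congrFun h0 l)⟩
    rw [show 2 + 1 = 3 from rfl, (om_of_mem_symGroup (hFs hσ) Z).2]
    exact h3
  · rintro Z ⟨⟨h3, h2⟩, hS⟩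
    obtain ⟨j, l, h⟩ := exists_of_not_spread hS h3 h2
    exact ⟨(j, l), h⟩

/-- The induction hypothesis spreads the preceding vector `om (p + 2)`. If `om (p + 3)` is then
still a multiple of e_j, some entry r ≠ j of `om (p + 2)` is nonzero, and moving the diagonal
variable rr of the block acting on it creates an entry r in `om (p + 3)`. -/
lemma reach_spread : ∀ p : ℕ,
    Reach {Z : Conf n (p + 3) | om (toSeq Z) (p + 3) ≠ 0 ∧ om (toSeq Z) (p + 2) ≠ 0}
      {Z | Spread (toSeq Z) (p + 2) ∧ om (toSeq Z) (p + 2) ≠ 0}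
  | 0 => reach_spread_base
  | p + 1 => by
    refine (reach_ne_zero_two p).trans ?_
    have h1 : Reach {Z : Conf n (p + 4) | om (toSeq Z) (p + 4) ≠ 0 ∧ om (toSeq Z) (p + 3) ≠ 0 ∧
        om (toSeq Z) (p + 2) ≠ 0} {Z : Conf n (p + 4) | Spread (toSeq Z) (p + 2) ∧
          om (toSeq Z) (p + 4) ≠ 0 ∧ om (toSeq Z) (p + 3) ≠ 0} := by
      refine ((reach_spread p).lift (by omega) (fun a b _ => b ≠ 0 ∧ a ≠ 0)).mono ?_ ?_
      · rintro Z ⟨h4, h3, h2⟩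
        refine ⟨⟨?_, ?_⟩, h4, h3⟩
        · rwa [om_proj _ (by omega)]
        · rwa [om_proj _ (by omega)]
      · rintro Z ⟨⟨h1, -⟩, h4, h3⟩
        rw [Spread, om_proj _ (by omega), om_proj _ (by omega)] at h1
        exact ⟨h1, h4, h3⟩
    refine h1.trans ?_
    refine Reach.by_cases {Z | Spread (toSeq Z) (p + 3)}
      (Reach.of_subset fun Z hZ => ⟨hZ.2, hZ.1.2.2⟩) ?_
    refine Reach.exists_index (ι := Fin n × Fin n) (S := fun a => {Z | a.2 ≠ a.1 ∧
      om (toSeq Z) (p + 4) a.1 ≠ 0 ∧ om (toSeq Z) (p + 3) a.1 ≠ 0 ∧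
      (∀ r, r ≠ a.1 → om (toSeq Z) (p + 3) r = 0) ∧ om (toSeq Z) (p + 2) a.2 ≠ 0})
      (fun ⟨j, l⟩ => ?_) ?_
    · by_cases hl : l = j
      · exact Reach.of_subset fun Z hZ => (hZ.1 hl).elim
      obtain ⟨k, hk⟩ := exists_eq_add_two hl
      obtain ⟨F, hF, hFs, h⟩ := (StarData.ofPair (p + 1) hk hl hl).exists_moves
      refine ⟨F, hF, hFs, fun Z ⟨_, h4, h3, h0, h2⟩ => ?_⟩
      obtain ⟨σ, hσ, τ, hτ, -, hom⟩ := h Z (Function.ne_iff.2 ⟨j, h4⟩)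
      have hl' : om (toSeq (σ Z)) (p + 3) l ≠ 0 := by
        have e : om (toSeq (σ Z)) (p + 3) l = om (toSeq Z) (p + 3) l +
            (τ * om (toSeq Z) (p + 3) j ^ n) * om (toSeq Z) (p + 2) l := by
          refine (congrFun hom l).trans ?_
          rw [Pi.add_apply, Pi.smul_apply, StarData.ofPair, symMat_unitCoord_mulVec, if_pos rfl,
            Pi.single_eq_same, smul_eq_mul]
        rw [e, h0 l hl, zero_add]
        exact mul_ne_zero (mul_ne_zero hτ (pow_ne_zero _ h3)) h2
      refine ⟨σ, hσ, ⟨j, ?_, fun _ _ => ⟨l, hl, hl'⟩⟩, fun h0 => hl' (congrFun h0 l)⟩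
      have := (om_of_mem_symGroup (hFs hσ) Z).2
      exact fun h0 => h4 ((congrFun this j).symm.trans h0)
    · rintro Z ⟨⟨⟨j', h3', hb⟩, h4, h3⟩, hS⟩
      obtain ⟨j, l, hl, h5, h6, h7⟩ := exists_of_not_spread hS h4 h3
      -- Entry j' of `om (p + 3)` is nonzero, but this vector is a multiple of e_j.
      obtain rfl : j' = j := by
        by_contra hne
        exact h3' (h7 j' hne)
      obtain ⟨r, hr, hr'⟩ := hb l hl
      exact ⟨(j', r), hr, h5, h6, h7, hr'⟩

/-- The points at which the lifted and principal fields of `Q_{p+3}` are shown to span. -/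
def goodSet (n p : ℕ) : Set (Conf n (p + 3)) :=
  {Z | om (toSeq Z) (p + 3) ≠ 0 ∧ om (toSeq Z) (p + 1) ≠ 0 ∧ ∃ j,
    (p = 0 ∨ ∀ l, l ≠ j → ∃ r, r ≠ j ∧ om (toSeq Z) (p + 1) r ≠ 0) ∧
    om (toSeq Z) (p + 2) j ≠ 0 ∧ (symMat (toSeq Z (p + 1))).adjugate j j ≠ 0}

/-- The minor is treated last because the γ moves keep the whole chain, and with it the conditions
already obtained. For p = 0 no spreading is needed: `om 1` = e_n, and `StarData.base` is available.
-/
lemma reach_goodSet (p : ℕ) :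
    Reach {Z : Conf n (p + 3) | om (toSeq Z) (p + 3) ≠ 0 ∧ Alive (toSeq Z) (p + 2)} (goodSet n p) := by
  have h1 : Reach {Z : Conf n (p + 3) | om (toSeq Z) (p + 3) ≠ 0 ∧ Alive (toSeq Z) (p + 2)}
      {Z | om (toSeq Z) (p + 3) ≠ 0 ∧ om (toSeq Z) (p + 2) ≠ 0} := by
    refine Reach.by_cases {Z | om (toSeq Z) (p + 2) = 0} ?_
      (Reach.of_subset fun Z hZ => ⟨hZ.1.1, hZ.2⟩)
    exact ((reach_ne_zero (p + 2)).inter_ends fun a _ => a ≠ 0).mono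
      (fun Z hZ => ⟨⟨hZ.1.1, hZ.2, hZ.1.2⟩, hZ.1.1⟩) fun Z hZ => ⟨hZ.2, hZ.1⟩
  have h2 : Reach {Z : Conf n (p + 3) | om (toSeq Z) (p + 3) ≠ 0 ∧ om (toSeq Z) (p + 2) ≠ 0}
      {Z | (om (toSeq Z) (p + 3) ≠ 0 ∧ om (toSeq Z) (p + 1) ≠ 0) ∧ ∃ j,
        (p = 0 ∨ ∀ l, l ≠ j → ∃ r, r ≠ j ∧ om (toSeq Z) (p + 1) r ≠ 0) ∧
        om (toSeq Z) (p + 2) j ≠ 0} := by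
    cases p with
    | zero =>
      refine Reach.of_subset fun Z hZ => ⟨⟨hZ.1, fun h => hZ.2 ?_⟩, ?_⟩
      · rw [om_add_two, om_zero, h, Matrix.mulVec_zero, add_zero]
      · obtain ⟨j, hj⟩ := Function.ne_iff.1 hZ.2
        exact ⟨j, Or.inl rfl, hj⟩
    | succ p =>
      refine (reach_ne_zero_two p).trans ?_
      refine ((reach_spread p).lift (by omega) (fun _ b _ => b ≠ 0)).mono ?_ ?_
      · rintro Z ⟨h4, h3, h2⟩
        refine ⟨⟨?_, ?_⟩, h4⟩
        · rwa [om_proj _ (by omega)]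
        · rwa [om_proj _ (by omega)]
      · rintro Z ⟨⟨⟨j, hj, hs⟩, h2⟩, h4⟩
        rw [om_proj _ (by omega)] at h2 hs hj
        exact ⟨⟨h4, h2⟩, j, Or.inr hs, hj⟩
  refine (h1.trans h2).trans ?_
  refine Reach.exists_index (ι := Fin n) (S := fun j => {Z : Conf n (p + 3) |
    ((om (toSeq Z) (p + 3) ≠ 0 ∧ om (toSeq Z) (p + 1) ≠ 0) ∧
      (p = 0 ∨ ∀ l, l ≠ j → ∃ r, r ≠ j ∧ om (toSeq Z) (p + 1) r ≠ 0)) ∧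
        om (toSeq Z) (p + 2) j ≠ 0}) (fun j => ?_) fun Z ⟨h, j, h', hj⟩ => ⟨j, ⟨h, h'⟩, hj⟩
  exact (Reach.adjugate_apply_self (k := p) (by omega) j
    (fun w => (w (p + 3) ≠ 0 ∧ w (p + 1) ≠ 0) ∧
      (p = 0 ∨ ∀ l, l ≠ j → ∃ r, r ≠ j ∧ w (p + 1) r ≠ 0))).mono le_rfl
    fun Z ⟨⟨⟨⟨h3, h1⟩, h⟩, h2⟩, ha⟩ => ⟨h3, h1, j, h, h2, ha⟩

end Spread

/-! ### The set `W_K` in terms of the chain -/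

section W

variable {n K : ℕ}

lemma eLast_ne_zero (hn : 1 ≤ n) : eLast n ≠ 0 := by
  refine Function.ne_iff.2 ⟨⟨n - 1, by omega⟩, ?_⟩
  rw [eLast, if_pos (by simp only; omega)]
  exact one_ne_zero

/-- For odd q the vector `om 1` = e_n is a witness. For even q, if all even vectors vanished, the
odd ones would equal e_n, and each relevant Z_{2i-1} e_n would be the vanishing vector `om (2i)`. -/
lemma alive_of_mem_WSet (hn : 1 ≤ n) {q : ℕ} {Z : Conf n (q + 1)} (hZ : Z ∈ WSet n (q + 1)) :
    Alive (toSeq Z) q := by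
  rcases Nat.even_or_odd q with hq | hq
  · by_contra hal
    have h0 : ∀ i, Even i → i ≤ q → om (toSeq Z) i = 0 := fun i hi hiq => by
      by_contra h
      obtain ⟨a, ha⟩ := hi
      obtain ⟨b, hb⟩ := hq
      exact hal ⟨i, b - a, by omega, h⟩
    have h1 : ∀ i, 2 * i ≤ q → om (toSeq Z) (2 * i + 1) = eLast n := by
      intro i
      induction i with
      | zero => exact fun _ => om_one _
      | succ i ih =>
        intro hi
        rw [show 2 * (i + 1) + 1 = 2 * i + 1 + 2 by ring, om_add_two, ih (by omega),
          show 2 * i + 1 + 1 = 2 * (i + 1) by ring, h0 _ (even_two_mul _) hi, Matrix.mulVec_zero,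
          add_zero]
    obtain ⟨⟨k, hk⟩, hke, hkK, hne⟩ := hZ
    simp only at hke hkK
    have hkq : k + 2 ≤ q := by
      obtain ⟨a, ha⟩ := hke
      obtain ⟨b, hb⟩ := hq
      omega
    obtain ⟨a, ha⟩ := hke
    have h2 := h0 (k + 2) (Even.add (show Even k from ⟨a, ha⟩) even_two) hkq
    rw [om_add_two, h0 k ⟨a, ha⟩ (by omega), zero_add, show k + 1 = 2 * a + 1 by omega,
      h1 a (by omega), toSeq_apply _ hk] at h2
    exact hne h2
  · obtain ⟨j, rfl⟩ := hq
    exact ⟨1, j, by ring, by rw [om_one]; exact eLast_ne_zero hn⟩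

lemma om_of_not_mem_WSet {Z : Conf n K} (hZ : Z ∉ WSet n K) (i : ℕ) :
    (2 * i ≤ K → om (toSeq Z) (2 * i) = 0) ∧
      (2 * i ≤ K → om (toSeq Z) (2 * i + 1) = eLast n) := by
  induction i with
  | zero => exact ⟨fun _ => om_zero _, fun _ => om_one _⟩
  | succ i ih =>
    have h1 : 2 * (i + 1) ≤ K → om (toSeq Z) (2 * (i + 1)) = 0 := by
      intro hi
      rw [show 2 * (i + 1) = 2 * i + 2 by ring, om_add_two, ih.1 (by omega), ih.2 (by omega),
        zero_add]
      by_contra hne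
      refine hZ ⟨⟨2 * i, by omega⟩, even_two_mul i, by simp only; omega, ?_⟩
      rwa [toSeq_apply Z (by omega)] at hne
    refine ⟨h1, fun hi => ?_⟩
    rw [show 2 * (i + 1) + 1 = 2 * i + 1 + 2 by ring, om_add_two, ih.2 (by omega),
      show 2 * i + 1 + 1 = 2 * (i + 1) by ring, h1 hi, Matrix.mulVec_zero, add_zero]

/-- Outside W the vectors with even index vanish, and one of q, q + 1 is even. -/
lemma mem_WSet_of_ne_zero {q : ℕ} {Z : Conf n (q + 1)} (h0 : om (toSeq Z) q ≠ 0)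
    (h1 : om (toSeq Z) (q + 1) ≠ 0) : Z ∈ WSet n (q + 1) := by
  by_contra h
  rcases Nat.even_or_odd' q with ⟨i, hi | hi⟩
  · refine h0 ?_
    have := (om_of_not_mem_WSet h i).1 (by omega)
    rwa [← hi] at this
  · refine h1 ?_
    have := (om_of_not_mem_WSet h (i + 1)).1 (by omega)
    rwa [show 2 * (i + 1) = q + 1 by omega] at this

end W

/-! ### Submersion -/

section Submersion

variable {n K : ℕ}

/-- Row m of S alone suffices when w_m ≠ 0, since its matrix `starMat` has determinant w_m^n. -/
lemma exists_symMat_mulVec {w : Fin n → ℂ} (hw : w ≠ 0) (u : Fin n → ℂ) :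
    ∃ S, symMat S *ᵥ w = u := by
  obtain ⟨m, hm⟩ := Function.ne_iff.1 hw
  have hdet : IsUnit (starMat m w).det := by
    rw [det_starMat]
    exact (pow_ne_zero _ hm).isUnit
  refine ⟨_, (starMat_mulVec m w ((starMat m w)⁻¹ *ᵥ u)).symm.trans ?_⟩
  rw [Matrix.mulVec_mulVec, Matrix.mul_nonsing_inv _ hdet, Matrix.one_mulVec]

lemma surjective_of_ne_zero {Z : Conf n (K + 2)} (h1 : om (toSeq Z) (K + 1) ≠ 0)
    (h2 : om (toSeq Z) (K + 2) ≠ 0) : Function.Surjective (fderiv ℂ (Phi n (K + 2)) Z) := by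
  rw [fderiv_Phi_surjective_iff]
  intro a b
  obtain ⟨T, hT⟩ := exists_symMat_mulVec h1 b
  obtain ⟨S, hS⟩ := exists_symMat_mulVec h2 (a - symMat (toSeq Z (K + 1)) *ᵥ b)
  refine ⟨Pi.single ⟨K, by omega⟩ T + Pi.single ⟨K + 1, by omega⟩ S, ?_, ?_⟩
  · rw [map_add, dom_single, dom_single, show K + 2 + 1 = K + 1 + 2 from rfl, prop_self,
      show K + 1 + 2 = K + 3 from rfl, prop_add_three, hT, Matrix.one_mulVec, hS, add_sub_cancel]
  · rw [map_add, dom_single, dom_single, prop_self, prop_of_lt _ (by omega), Matrix.one_mulVec,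
      Matrix.zero_mulVec, add_zero, hT]

/-- An added block composes `Phi` with an invertible shear, so surjectivity persists. If the
truncated configuration is not in W, the nonvanishing occurs in the last but one block: two
consecutive chain vectors are then e_n and Z e_n ≠ 0, and the last two blocks alone give
surjectivity. -/
lemma surjective_of_mem_WSet (hn : 1 ≤ n) : ∀ {K : ℕ} {Z : Conf n (K + 1)}, Z ∈ WSet n (K + 1) →
    Function.Surjective (fderiv ℂ (Phi n (K + 1)) Z)
  | 0, Z, ⟨k, _, hk, _⟩ => by omega
  | K + 1, Z, hZ => by
    by_cases h : proj Z ∈ WSet n (K + 1)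
    · have ih := (fderiv_Phi_surjective_iff _).1 (surjective_of_mem_WSet hn h)
      rw [fderiv_Phi_surjective_iff]
      intro a b
      obtain ⟨v, hv1, hv0⟩ := ih b (a - symMat (Z (Fin.last (K + 1))) *ᵥ b)
      refine ⟨extend v 0, ?_, ?_⟩
      · rw [show K + 1 + 1 + 1 = K + 1 + 2 from rfl, dom_last, proj_extend, extend_last, hv1, hv0]
        simp
      · rw [← dom_proj _ _ le_rfl, proj_extend, hv1]
    · obtain ⟨⟨k, hk⟩, hke, hkK, hne⟩ := hZ
      simp only at hke hkK
      have hkK' : k = K := by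
        by_contra hkne
        exact h ⟨⟨k, by omega⟩, hke, by simp only; omega, hne⟩
      subst hkK'
      obtain ⟨i, hi⟩ := hke
      have hom := om_of_not_mem_WSet h i
      have h0 : om (toSeq Z) k = 0 := by
        have := hom.1 (by omega)
        rwa [show 2 * i = k by omega, om_proj Z (by omega)] at this
      have h1 : om (toSeq Z) (k + 1) = eLast n := by
        have := hom.2 (by omega)
        rwa [show 2 * i = k by omega, om_proj Z (by omega)] at this
      refine surjective_of_ne_zero (by rw [h1]; exact eLast_ne_zero hn) ?_
      rw [om_add_two, h0, h1, zero_add, toSeq_apply _ hk]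
      exact hne

end Submersion

/-! ### The spanning property on the good set -/

section Spanning

variable {n p : ℕ}

lemma CrossData.disp_last {p : ℕ} (c : CrossData n (p + 2)) (hl : c.l = p) (hk : c.k = p + 1)
    (Z : Conf n (p + 2)) : c.disp Z (p + 2) = -(om (toSeq Z) (p + 1) c.m ^ n) •
      ((symMat (toSeq Z (p + 1))).adjugate *ᵥ Pi.single c.i 1) := by
  have hs : (c.star Z).det = om (toSeq Z) (p + 1) c.m ^ n := by rw [star, det_starMat, hl]
  have hj : c.jac Z = symMat (toSeq Z (p + 1)) * c.star Z := by
    rw [jac, hl, show p + 2 + 1 = p + 3 from rfl, prop_add_three]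
  have hd : c.diagVec Z = Pi.single c.i 1 := by
    rw [diagVec, hk, show p + 2 + 1 = p + 1 + 2 from rfl, prop_self, Matrix.one_mulVec]
  have h1 : c.star Z *ᵥ c.dir Z = om (toSeq Z) (p + 1) c.m ^ n •
      ((symMat (toSeq Z (p + 1))).adjugate *ᵥ c.diagVec Z) := by
    rw [dir, hj, Matrix.adjugate_mul_distrib, Matrix.mulVec_mulVec, ← Matrix.mul_assoc,
      Matrix.mul_adjugate, Matrix.smul_mul, Matrix.one_mul, Matrix.smul_mulVec, hs]
  rw [disp, h1, hl, hk, prop_self, prop_of_lt _ (by omega), hd, Matrix.zero_mulVec, smul_zero,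
    zero_sub, Matrix.one_mulVec, neg_smul]

/-- A submodule of `ℂ^n` that contains `e_l` for `l ≠ j` and a vector with nonzero entry `j`. -/
lemma submodule_eq_top {V : Submodule ℂ (Fin n → ℂ)} {j : Fin n}
    (h : ∀ l, l ≠ j → (Pi.single l 1 : Fin n → ℂ) ∈ V) {w : Fin n → ℂ} (hw : w ∈ V) (hj : w j ≠ 0)
    (u : Fin n → ℂ) : u ∈ V := by
  have hsum : ∀ u : Fin n → ℂ, u j = 0 → u ∈ V := fun u hu => by
    rw [pi_eq_sum_univ' u]
    refine Submodule.sum_mem _ fun l _ => ?_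
    by_cases hl : l = j
    · rw [hl, hu, zero_smul]
      exact V.zero_mem
    · refine V.smul_mem _ ?_
      have := h l hl
      convert this using 1
  have h1 := V.add_mem (hsum (u - (u j / w j) • w) (by simp [hj])) (V.smul_mem (u j / w j) hw)
  rwa [sub_add_cancel] at h1

/-- V collects the effects on `om (p + 2)` of tangent vectors already in the span. Once V is all of
ℂ^n, the given vector can be corrected so as to fix `om (p + 2)` as well; the corrected vector
splits into a lifted tangent vector and a change of the last block killing `om (p + 3)`. -/
lemma mem_span_of_mem_goodSet {Z : Conf n (p + 3)} (hZ : Z ∈ goodSet n p) {A : Set (VField n (p + 2))}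
    (hA : ∀ v, fderiv ℂ (Phi n (p + 2)) (proj Z) v = 0 →
      v ∈ Submodule.span ℂ {v | ∃ X ∈ A, v = X (proj Z)})
    {v : Conf n (p + 3)} (hv : fderiv ℂ (Phi n (p + 3)) Z v = 0) :
    v ∈ Submodule.span ℂ {v | ∃ X ∈ goodFields n (p + 3) ∪ lift '' A, v = X Z} := by
  obtain ⟨h3, h1, j, hs, h2, ha⟩ := hZ
  set S := Submodule.span ℂ {v | ∃ X ∈ goodFields n (p + 3) ∪ lift '' A, v = X Z} with hS
  have hgood : Submodule.span ℂ {v | ∃ X ∈ goodFields n (p + 3), v = X Z} ≤ S :=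
    Submodule.span_mono fun v ⟨X, hX, h⟩ => ⟨X, Or.inl hX, h⟩
  obtain ⟨i, hi⟩ := Function.ne_iff.1 h3
  have hi2 : om (toSeq Z) (p + 3) i ^ 2 ≠ 0 := pow_ne_zero 2 hi
  set V : Submodule ℂ (Fin n → ℂ) := (S ⊓ LinearMap.ker (fderiv ℂ (Phi n (p + 3)) Z).toLinearMap).map
    (dom Z (p + 2)).toLinearMap with hV
  have hmem : ∀ X ∈ goodFields n (p + 3), ∀ D T, X Z = extend (om (toSeq Z) (p + 3) i ^ 2 • D) T →
      dom (proj Z) (p + 2) D ∈ V := by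
    intro X hX D T hD
    refine (Submodule.smul_mem_iff _ hi2).1 ?_
    refine ⟨X Z, ⟨Submodule.subset_span ⟨X, Or.inl hX, rfl⟩, hX.2.2.1 Z⟩, ?_⟩
    change dom Z (p + 2) (X Z) = _
    rw [← dom_proj Z _ (by omega), hD, proj_extend, map_smul]
  have hstar : ∀ c : StarData n p, c.m = j →
      symMat (unitCoord c.s₀) *ᵥ om (toSeq Z) (p + 1) ∈ V := by
    intro c hc
    obtain ⟨X, hX, hXZ⟩ := c.phi_mem_goodFields i
    have := hmem X hX _ _ (hXZ Z)
    rw [c.dom_field, StarData.piv, StarData.del, om_proj _ (by omega), om_proj _ (by omega), hc] at this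
    exact (Submodule.smul_mem_iff _ (pow_ne_zero n h2)).1 this
  -- This column has nonzero entry j by the minor condition, and so supplies the one direction that
  -- the `StarData` fields with m = j miss.
  have hcross : (symMat (toSeq Z (p + 1))).adjugate *ᵥ Pi.single j 1 ∈ V := by
    obtain ⟨m, hm⟩ := Function.ne_iff.1 h1
    let c : CrossData n (p + 2) :=
      { l := p, k := p + 1, hlk := by omega, hk := by omega, m := m, i := j }
    obtain ⟨X, hX, ε, hε, hXZ⟩ := c.phi_mem_goodFields i
    have := hmem X hX _ _ (hXZ Z)
    have e : c.coef (proj Z) = om (toSeq Z) (p + 2) j := 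
      congrFun (om_proj Z (j := p + 2) (by omega)) j
    rw [map_smul, c.dom_field, c.disp_last rfl rfl, e, om_proj _ (by omega),
      toSeq_proj _ (by omega)] at this
    exact (Submodule.smul_mem_iff _ (neg_ne_zero.2 (pow_ne_zero n hm))).1
      ((Submodule.smul_mem_iff _ h2).1 ((Submodule.smul_mem_iff _ hε).1 this))
  have hsingle : ∀ l, l ≠ j → (Pi.single l 1 : Fin n → ℂ) ∈ V := by
    intro l hl
    obtain ⟨k, hk⟩ := exists_eq_add_two hl
    rcases hs with rfl | hs
    · have ha : ((⟨n - 1, by omega⟩ : Fin n) : ℕ) + 1 = n := by simp only; omega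
      have := hstar (StarData.base hk ha hl) rfl
      rw [show om (toSeq Z) (0 + 1) = eLast n from om_one _] at this
      have h := symMat_unitCoord_mulVec_last ha l
      exact h ▸ this
    · obtain ⟨r, hr, hbr⟩ := hs l hl
      have hrV : (Pi.single r 1 : Fin n → ℂ) ∈ V := by
        have := hstar (StarData.ofPair p hk hr hr) rfl
        rw [StarData.ofPair, symMat_unitCoord_mulVec, if_pos rfl] at this
        refine (Submodule.smul_mem_iff _ hbr).1 ?_
        rwa [← Pi.single_smul, smul_eq_mul, mul_one]
      by_cases hlr : l = r
      · rwa [hlr]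
      -- The variable lr gives b_r e_l + b_l e_r with b the vector `om (p + 1)`; since e_r is known
      -- to lie in V and b_r ≠ 0, this yields e_l.
      · have := hstar (StarData.ofPair p hk hl hr) rfl
        rw [StarData.ofPair, symMat_unitCoord_mulVec, if_neg hlr] at this
        refine (Submodule.smul_mem_iff _ hbr).1 ?_
        have h4 := V.sub_mem this (V.smul_mem (om (toSeq Z) (p + 1) l) hrV)
        rw [← Pi.single_smul, smul_eq_mul, mul_one, add_sub_cancel_right] at h4
        rwa [← Pi.single_smul, smul_eq_mul, mul_one]
  have hu := submodule_eq_top hsingle hcross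
    (by rwa [Matrix.mulVec_single_one, Matrix.col_apply]) (dom Z (p + 2) v)
  obtain ⟨w, ⟨hwS, hwk⟩, hwu⟩ := hu
  have hwk : fderiv ℂ (Phi n (p + 3)) Z w = 0 := hwk
  have hwu : dom Z (p + 2) w = dom Z (p + 2) v := hwu
  have hd : fderiv ℂ (Phi n (p + 3)) Z (v - w) = 0 := by rw [map_sub, hv, hwk, sub_zero]
  rw [fderiv_Phi_eq_zero_iff] at hd
  have hd0 : dom Z (p + 2) (v - w) = 0 := by rw [map_sub, hwu, sub_self]
  have hpr := hA (proj (v - w)) (by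
    rw [fderiv_Phi_eq_zero_iff, dom_proj _ _ (by omega), dom_proj _ _ (by omega)]
    exact ⟨hd.2, hd0⟩)
  have hlift : (extend (proj (v - w)) 0 : Conf n (p + 3)) ∈ S := by
    let f : Conf n (p + 2) →ₗ[ℂ] Conf n (p + 3) :=
      { toFun := fun v => extend v 0
        map_add' := fun v w => by rw [extend_add, add_zero]
        map_smul' := fun c v => by rw [RingHom.id_apply, smul_extend, smul_zero] }
    have : Submodule.span ℂ {v | ∃ X ∈ A, v = X (proj Z)} ≤ S.comap f := by
      rw [Submodule.span_le]
      rintro _ ⟨X, hX, rfl⟩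
      exact Submodule.subset_span ⟨lift X, Or.inr ⟨X, hX, rfl⟩, rfl⟩
    exact this hpr
  have hrest : (extend 0 ((v - w) (Fin.last _)) : Conf n (p + 3)) ∈ S := by
    refine hgood (extend_zero_mem_span h3 ?_)
    have h4 := hd.1
    have hd2 : dom Z (p + 2 + 1) (v - w) = 0 := hd.2
    rw [dom_add_two, hd0, hd2, Matrix.mulVec_zero, add_zero,
      zero_add, toSeq_last] at h4
    exact h4
  have hsum : v = w + (extend (proj (v - w)) 0 + extend 0 ((v - w) (Fin.last _))) := by
    rw [extend_add, add_zero, zero_add, extend_proj, add_sub_cancel]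
  rw [hsum]
  exact S.add_mem hwS (S.add_mem hlift hrest)

end Spanning

/-! ### The finite sets of fields -/

section Assembly

variable {n K : ℕ}

lemma finite_gammaFields : (gammaFields n K).Finite := by
  refine (Set.finite_range fun a : Fin n × Fin n × Fin n =>
    gammaField n K a.1 a.2.1 a.2.2).subset ?_
  rintro _ ⟨r, s, j, -, -, -, rfl⟩
  exact ⟨(r, s, j), rfl⟩

lemma finite_principal : ∀ K, (principal n K).Finite
  | 0 => Set.finite_empty
  | 1 => Set.finite_empty
  | 2 => by
    refine Set.Finite.union ?_ finite_gammaFields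
    refine (Set.finite_range fun a : Fin n × Fin n × Fin n => fun Z : Conf n 2 =>
      (Ptil n 1 (proj Z) a.2.2) ^ 2 • coordDir ((0 : Fin 2), s(a.1, a.2.1))).subset ?_
    rintro _ ⟨r, s, j, -, -, rfl⟩
    exact ⟨(r, s, j), rfl⟩
  | K + 3 => by
    refine (((finite_principal (K + 2)).image lift).union ?_).union finite_gammaFields
    refine (Set.finite_range fun a : (Fin (n + 1) → Fin (K + 2) × Sym2 (Fin n)) × Fin n =>
      phiField n (K + 1) a.1 a.2).subset ?_
    rintro _ ⟨x, -, j, rfl⟩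
    exact ⟨(x, j), rfl⟩

/-- The pullbacks of the good principal fields by the elements of `F`. -/
def pulledFields (F : Set (Equiv.Perm (Conf n K))) : Set (VField n K) :=
  Set.image2 (fun σ X => VectorField.pullback ℂ (σ : Equiv.Perm (Conf n K)) X) F (goodFields n K)

/-- A finite set of symmetries whose pulled back fields span on the generic fibers. -/
def IsSpanning (F : Set (Equiv.Perm (Conf n K))) : Prop :=
  F.Finite ∧ F ⊆ symGroup n K ∧ ∀ Z ∈ WSet n K, om (toSeq Z) K ≠ 0 →
    ∀ v, fderiv ℂ (Phi n K) Z v = 0 → v ∈ Submodule.span ℂ {v | ∃ X ∈ pulledFields F, v = X Z}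

lemma IsSpanning.two : IsSpanning ({1} : Set (Equiv.Perm (Conf n 2))) := by
  refine ⟨Set.finite_singleton 1, by simp, fun Z _ hZ v hv => ?_⟩
  rw [fderiv_Phi_eq_zero_iff] at hv
  refine Submodule.span_mono ?_ (mem_span_goodFields_two hZ hv.1 hv.2)
  rintro _ ⟨X, hX, rfl⟩
  exact ⟨X, ⟨1, rfl, X, hX, pullback_one X⟩, rfl⟩

lemma IsSpanning.succ (hn : 1 ≤ n) {p : ℕ} {F : Set (Equiv.Perm (Conf n (p + 2)))}
    (hF : IsSpanning F) :
    ∃ F' : Set (Equiv.Perm (Conf n (p + 3))), IsSpanning F' ∧ liftPerm '' F ⊆ F' := by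
  obtain ⟨hfin, hsub, hspan⟩ := hF
  obtain ⟨G, hGfin, hGsub, hG⟩ := reach_goodSet (n := n) p
  have hLsub : liftPerm '' F ⊆ (symGroup n (p + 3) : Set _) := by
    rintro _ ⟨τ, hτ, rfl⟩
    exact liftPerm_mem_symGroup (by omega) (hsub hτ)
  -- Moves in G pull back the principal fields from the good point, the products pull back the
  -- lifted fields of the preceding stage, and the lifts of F are included only to make the families
  -- nested.
  refine ⟨liftPerm '' F ∪ (G ∪ Set.image2 (fun τ σ => liftPerm τ * σ) F G),
    ⟨(hfin.image _).union (hGfin.union (hfin.image2 _ hGfin)), ?_, fun Z hZ h3 v hv => ?_⟩,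
    Set.subset_union_left⟩
  · refine Set.union_subset hLsub (Set.union_subset hGsub ?_)
    rintro _ ⟨τ, hτ, σ, hσ, rfl⟩
    exact (symGroup n _).mul_mem (hLsub ⟨τ, hτ, rfl⟩) (hGsub hσ)
  · obtain ⟨σ, hσ, hgood⟩ := hG Z ⟨h3, alive_of_mem_WSet hn hZ⟩
    have hσ' := hGsub hσ
    have hA : ∀ v, fderiv ℂ (Phi n (p + 2)) (proj (σ Z)) v = 0 →
        v ∈ Submodule.span ℂ {v | ∃ X ∈ pulledFields F, v = X (proj (σ Z))} := by
      obtain ⟨-, h1, j, -, h2, -⟩ := hgood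
      -- At a good point two consecutive chain vectors are nonzero, so the truncation lies in W and
      -- in a generic fiber, as the induction hypothesis requires.
      have h2' : om (toSeq (proj (σ Z))) (p + 2) ≠ 0 := by
        rw [om_proj _ (by omega)]
        exact Function.ne_iff.2 ⟨j, h2⟩
      exact hspan _ (mem_WSet_of_ne_zero (q := p + 1) (by rwa [om_proj _ (by omega)]) h2') h2'
    have key := ker_le_span_pullback hσ'.2.1 hσ'.2.2.1 differentiable_Phi hσ'.2.2.2
      (fun v hv => mem_span_of_mem_goodSet hgood hA hv) hv
    refine Submodule.span_mono ?_ key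
    rintro _ ⟨X, hX | ⟨_, ⟨τ, hτ, X, hX, rfl⟩, rfl⟩, rfl⟩
    · exact ⟨_, ⟨σ, Or.inr (Or.inl hσ), X, hX, rfl⟩, rfl⟩
    · have hτ1 := hsub hτ
      have hτ2 := liftPerm_mem_symGroup (by omega) hτ1
      refine ⟨_, ⟨liftPerm τ * σ, Or.inr (Or.inr ⟨τ, hτ, σ, hσ, rfl⟩), lift X,
        lift_mem_goodFields (by omega) hX, rfl⟩, ?_⟩
      simp only
      rw [pullback_mul hσ'.2.1 hσ'.2.2.1 hτ2.2.1 hτ2.2.2.1, lift_pullback hτ1.2.1 hτ1.2.2.1]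

lemma exists_spanning_sequence (hn : 1 ≤ n) :
    ∃ G : (k : ℕ) → Set (Equiv.Perm (Conf n (k + 2))),
      (∀ k, IsSpanning (G k)) ∧ ∀ k, liftPerm '' G k ⊆ G (k + 1) := by
  let G : (k : ℕ) → {F : Set (Equiv.Perm (Conf n (k + 2))) // IsSpanning F} := fun k =>
    Nat.rec ⟨{1}, IsSpanning.two⟩
      (fun k F => ⟨(F.2.succ hn).choose, (F.2.succ hn).choose_spec.1⟩) k
  exact ⟨fun k => (G k).1, fun k => (G k).2, fun k => ((G k).2.succ hn).choose_spec.2⟩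

end Assembly

end SymplecticSpray

end

theorem mainTheorem5 (n : ℕ) (hn : 1 ≤ n) :
    ∃ A : (K : ℕ) → Set (SymplecticSpray.VField n K), ∀ K : ℕ, 2 ≤ K →
      (A K).Finite ∧
      A K ⊆ SymplecticSpray.QSet n K ∧
      (∀ X ∈ A K, Differentiable ℂ X ∧ SymplecticSpray.IsCComplete X ∧
        SymplecticSpray.FiberPreserving (SymplecticSpray.Phi n K) X) ∧
      (∀ Z ∈ SymplecticSpray.WSet n K,
        Function.Surjective (fderiv ℂ (SymplecticSpray.Phi n K) Z)) ∧
      (∀ y ∈ SymplecticSpray.genericStratum n K,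
        SymplecticSpray.SpansTangent n K (A K) y (SymplecticSpray.WSet n K)) ∧
      SymplecticSpray.lift '' A K ⊆ A (K + 1) := by
  open SymplecticSpray in
  obtain ⟨G, hG, hlift⟩ := exists_spanning_sequence hn
  -- The values at K = 0 and K = 1 are irrelevant, as the conclusion concerns K ≥ 2 only.
  refine ⟨fun K => match K with
    | 0 => ∅
    | 1 => ∅
    | k + 2 => pulledFields (G k), fun K hK => ?_⟩
  obtain ⟨k, rfl⟩ := Nat.exists_eq_add_of_le' hK
  obtain ⟨hfin, hsub, hspan⟩ := hG k
  have hprop : ∀ X ∈ pulledFields (G k), Differentiable ℂ X ∧ IsCComplete X ∧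
      FiberPreserving (Phi n (k + 2)) X := by
    rintro _ ⟨σ, hσ, X, ⟨-, h2, h3, fl, h4⟩, rfl⟩
    obtain ⟨-, hs1, hs2, hs3⟩ := hsub hσ
    exact ⟨differentiable_pullback hs1 hs2 (h2.differentiable (by simp)),
      complete_pullback hs1 hs2 h4.complete,
      fiberPreserving_pullback hs1 hs2 differentiable_Phi hs3 h3⟩
  refine ⟨hfin.image2 _ ((finite_principal _).subset fun X hX => hX.1), ?_, hprop,
    fun Z hZ => surjective_of_mem_WSet hn hZ, ?_, ?_⟩
  · rintro _ ⟨σ, hσ, X, hX, rfl⟩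
    exact ⟨σ, (hsub hσ).1, X, hX.1, rfl⟩
  · rintro y ⟨-, hy⟩ Z ⟨hZy, hZ⟩
    have hZy : Phi n (k + 2) Z = y := hZy
    rw [← hZy, halfProj_Phi] at hy
    refine le_antisymm ?_ fun v hv => hspan Z hZ hy v hv
    rw [Submodule.span_le]
    rintro _ ⟨X, hX, rfl⟩
    exact (hprop X hX).2.2 Z
  · rintro _ ⟨_, ⟨σ, hσ, X, hX, rfl⟩, rfl⟩
    have hs := hsub hσ
    exact ⟨liftPerm σ, hlift k ⟨σ, hσ, rfl⟩, lift X, lift_mem_goodFields (by omega) hX,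
      (lift_pullback hs.2.1 hs.2.2.1 X).symm⟩
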